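/- \textbf{Setting.} Let $L_1\subset\mathbb C$ be an analytic Jordan curve, and let $G_1$ and $\Omega_1$ be the bounded and the unbounded component of $\overline{\mathbb C}\setminus L_1$. Write $\mathbb T_r=\{|w|=r\}$, $\mathbb E_r=\{r<|w|\le\infty\}$. Let $\psi$ be the conformal map of $\mathbb E_1$ onto $\Omega_1$ with $\psi(\infty)=\infty$, $\psi'(\infty)>0$; let $\rho\ge 0$ be the smallest number such that $\psi$ has an analytic and univalent continuation (again denoted $\psi$) to $\mathbb E_\rho$, and put $\Omega_\rho=\psi(\mathbb E_\rho)$, $G_\rho=\mathbb C\setminus\overline{\Omega_\rho}$. Let $\varphi$ be a conformal map of $G_1$ onto the open unit disk. An analytic arc with endpoints $f(0),f(1)$ is a set $f([0,1])$, where $f$ is analytic on $[0,1]$, $f'\neq0$ on $[0,1]$, and $f$ is injective on $(0,1)$. Assume: \textbf{A.1.} $\psi$ extends continuously to $\overline{\mathbb E}_\rho$, and there are $s\ge1$ distinct points $\omega_k=\rho e^{i\Theta_k}\in\mathbb T_\rho$, $0\le\Theta_k<2\pi$, $1\le k\le s$, such that $w_1\ne w_2$ in $\mathbb T_\rho$ and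 $\psi(w_1)=\psi(w_2)$ imply $w_1,w_2\in\{\omega_1,\dots,\omega_s\}$; and for each open circular arc composing $\mathbb T_\rho\setminus\{\omega_1,\dots,\omega_s\}$, with endpoints $\omega_j,\omega_k$, the image under $\psi$ of its closure is an analytic arc with endpoints $\psi(\omega_j),\psi(\omega_k)$. \textbf{A.2.} Put $z_k=\psi(\omega_k)$ and let $\lambda_k\pi\in[0,2\pi]$ be the exterior angle at $z_k$ relative to $\omega_k$, i.e. $\arg[\psi(\rho e^{i\theta})-z_k]$ tends to some $\beta_k$ as $\theta\to\Theta_k-$ and to $\beta_k+\lambda_k\pi$ as $\theta\to\Theta_k+$. Then $\lambda_k\notin\{0,1,2\}$ for all $k$. Index the points so that $\lambda_1=\dots=\lambda_u<\lambda_{u+1}\le\dots\le\lambda_s$ with $1\le u\le s$. Let $$A_k=\lim_{w\to\omega_k,\;w\in\mathbb E_\rho}\frac{\psi(w)-z_k}{(w-\omega_k)^{\lambda_k}},$$ with the branch $\Theta_k-\pi<\arg(w-\omega_k)<\Theta_k+\pi$. For $1\le k\le u$ let $\hat A_k=A_ke^{i(\lambda_1+1)(\Theta_k-\Theta_1)}$,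 let $\theta_k\in(0,1]$ be given by $e^{2\pi i\theta_k}=e^{i(\Theta_k-\Theta_1)}$ (so $\theta_1=1$), and put $$H_n(z)=\varphi'(z)\sum_{k=1}^u\frac{\varphi'(z_k)\hat A_k\,e^{2\pi i n\theta_k}}{[\varphi(z)-\varphi(z_k)]^2},\qquad z\in G_\rho,\ n\ge 0.$$ Index further so that $\theta_1,\dots,\theta_{u^*}$ ($1\le u^*\le u$) are linearly independent over $\mathbb Q$ and $\theta_k=\sum_{j=1}^{u^*}r_{kj}\theta_j$ with $r_{kj}\in\mathbb Q$ for $1\le k\le u$. Let $1\le p_k\le q_k$ be the relatively prime integers with $e^{2\pi i r_{k1}}=e^{2\pi i p_k/q_k}$, let $\mathbf q=\operatorname{lcm}(q_1,\dots,q_u)$, and for $\ell\in\{1,\dots,\mathbf q\}$ let $s_{k\ell}\in\{0,\dots,q_k-1\}$ be the residue of $\ell p_k$ modulo $q_k$. \textbf{Theorem.} The functions $f$ on $G_\rho$ that are the limit, locally uniformly on $G_\rho$, of some subsequence of $\{H_n\}_{n\ge0}$ are exactly the functions of the form $$f(z)=\varphi'(z)\sum_{k=1}^u\frac{\varphi'(z_k)\hat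 A_k\,\exp\!\Big(2\pi i\Big(\frac{s_{k\ell}}{q_k}+\sum_{j=2}^{u^*}r_{kj}\alpha_j\Big)\Big)}{[\varphi(z)-\varphi(z_k)]^2},\qquad z\in G_\rho,$$ with $\ell\in\{1,\dots,\mathbf q\}$ and $\alpha_2,\dots,\alpha_{u^*}$ arbitrary real numbers. Moreover, at least one such limit function is not identically zero on $G_\rho$. -/

import Mathlib

open Filter Topology Set

noncomputable section

namespace Carleman

/-- The set `𝔼_r ∖ {∞} = {w : |w| > r}`. -/
def outside (r : ℝ) : Set ℂ := {w | r < ‖w‖}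

/-- An analytic Jordan curve: the image of the unit circle under a map that is analytic in a
neighbourhood of the circle, injective on the circle, and has non-vanishing derivative there. -/
def IsAnalyticJordanCurve (L : Set ℂ) : Prop :=
  ∃ γ : ℂ → ℂ, AnalyticOnNhd ℂ γ (Metric.sphere 0 1) ∧ InjOn γ (Metric.sphere 0 1) ∧
    (∀ w ∈ Metric.sphere (0 : ℂ) 1, deriv γ w ≠ 0) ∧ γ '' Metric.sphere 0 1 = L

/-- The bounded component of the complement of a Jordan curve `L` (the domain `G₁`). -/
def interiorDomain (L : Set ℂ) : Set ℂ :=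
  {z ∈ Lᶜ | Bornology.IsBounded (connectedComponentIn Lᶜ z)}

/-- The (finite points of the) unbounded component of the complement of a Jordan curve `L`
(the domain `Ω₁`, without `∞`). -/
def exteriorDomain (L : Set ℂ) : Set ℂ :=
  {z ∈ Lᶜ | ¬ Bornology.IsBounded (connectedComponentIn Lᶜ z)}

/-- `ψ` is the normalized conformal map of `𝔼₁` onto the exterior `Ω₁` of `L`
(`ψ(∞) = ∞`, `ψ'(∞) > 0`), analytically continued to `𝔼_ρ`, where `ρ ≥ 0` is the smallest number
such that an analytic and univalent continuation to `𝔼_ρ` exists. -/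
structure IsExteriorMap (L : Set ℂ) (ψ : ℂ → ℂ) (ρ : ℝ) : Prop where
  image_eq : ψ '' outside 1 = exteriorDomain L
  deriv_infty : ∃ c : ℝ, 0 < c ∧ Tendsto (fun w => ψ w / w) (Bornology.cobounded ℂ) (𝓝 (c : ℂ))
  differentiableOn_one : DifferentiableOn ℂ ψ (outside 1)
  injOn_one : InjOn ψ (outside 1)
  isLeast : IsLeast {r : ℝ | 0 ≤ r ∧ ∃ g : ℂ → ℂ, DifferentiableOn ℂ g (outside r) ∧
    InjOn g (outside r) ∧ EqOn g ψ (outside 1)} ρ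
  differentiableOn : DifferentiableOn ℂ ψ (outside ρ)
  injOn : InjOn ψ (outside ρ)

/-- The set `G_ρ`, the complement of the closure of `Ω_ρ = ψ(𝔼_ρ)`. -/
def innerSet (ψ : ℂ → ℂ) (ρ : ℝ) : Set ℂ := (closure (ψ '' outside ρ))ᶜ

/-- `φ` is a conformal map of `G` onto the open unit disk. -/
structure IsConformalOntoDisk (G : Set ℂ) (φ : ℂ → ℂ) : Prop where
  differentiableOn : DifferentiableOn ℂ φ G
  injOn : InjOn φ G
  image_eq : φ '' G = Metric.ball 0 1

/-- The point `ρ e^{iθ}`. -/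
def circlePt (ρ θ : ℝ) : ℂ := ρ * Complex.exp (θ * Complex.I)

/-- `S` is an analytic arc with endpoints `a` and `b` (possibly `a = b`). -/
def IsAnalyticArc (S : Set ℂ) (a b : ℂ) : Prop :=
  ∃ f : ℝ → ℂ, AnalyticOnNhd ℝ f (Icc 0 1) ∧ (∀ t ∈ Icc (0 : ℝ) 1, deriv f t ≠ 0) ∧
    InjOn f (Ioo 0 1) ∧ f '' Icc 0 1 = S ∧ f 0 = a ∧ f 1 = b

/-- Condition A.1, for the points `ω_k = ρ e^{iΘ_k}` with arguments `Θ_k ∈ [0, 2π)`.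
An open arc of `𝕋_ρ ∖ {ω_1, …, ω_s}` is `{ρ e^{iθ} : a < θ < b}`, where `ρ e^{ia}` and `ρ e^{ib}`
are among the `ω_k` and no `ρ e^{iθ}` with `a < θ < b` is. -/
structure ConditionA1 (ψ : ℂ → ℂ) (ρ : ℝ) {s : ℕ} (Θ : Fin s → ℝ) : Prop where
  continuousOn : ContinuousOn ψ {w | ρ ≤ ‖w‖}
  arg_mem : ∀ k, Θ k ∈ Ico 0 (2 * Real.pi)
  distinct : Function.Injective fun k => circlePt ρ (Θ k)
  eq_imp : ∀ w₁ w₂ : ℂ, ‖w₁‖ = ρ → ‖w₂‖ = ρ → w₁ ≠ w₂ → ψ w₁ = ψ w₂ →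
    w₁ ∈ range (fun k => circlePt ρ (Θ k)) ∧ w₂ ∈ range (fun k => circlePt ρ (Θ k))
  arcs : ∀ a b : ℝ, a < b → circlePt ρ a ∈ range (fun k => circlePt ρ (Θ k)) →
    circlePt ρ b ∈ range (fun k => circlePt ρ (Θ k)) →
    (∀ θ ∈ Ioo a b, circlePt ρ θ ∉ range (fun k => circlePt ρ (Θ k))) →
    IsAnalyticArc ((fun θ => ψ (circlePt ρ θ)) '' Icc a b) (ψ (circlePt ρ a)) (ψ (circlePt ρ b))

/-- `α ∈ [0, 2π]` is an exterior angle at `z = ψ(ρ e^{iΘ})` relative to `ρ e^{iΘ}`: the argument of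
`ψ(ρ e^{iθ}) - z` tends to `β` as `θ → Θ-` and to `β + α` as `θ → Θ+`. Limits of arguments are
limits of directions; they determine `α` unless `α ∈ {0, 2π}`. -/
def IsExteriorAngle (ψ : ℂ → ℂ) (ρ Θ α : ℝ) : Prop :=
  α ∈ Icc 0 (2 * Real.pi) ∧ ∃ β : ℝ,
    Tendsto (fun θ => (ψ (circlePt ρ θ) - ψ (circlePt ρ Θ)) /
        (‖ψ (circlePt ρ θ) - ψ (circlePt ρ Θ)‖ : ℂ))
      (𝓝[<] Θ) (𝓝 (Complex.exp (β * Complex.I))) ∧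
    Tendsto (fun θ => (ψ (circlePt ρ θ) - ψ (circlePt ρ Θ)) /
        (‖ψ (circlePt ρ θ) - ψ (circlePt ρ Θ)‖ : ℂ))
      (𝓝[>] Θ) (𝓝 (Complex.exp ((β + α : ℝ) * Complex.I)))

/-- Condition A.2: `λ_k π` is the exterior angle at `z_k` relative to `ω_k`, and
`λ_k ∉ {0, 1, 2}`. -/
structure ConditionA2 (ψ : ℂ → ℂ) (ρ : ℝ) {s : ℕ} (Θ lam : Fin s → ℝ) : Prop where
  angle : ∀ k, IsExteriorAngle ψ ρ (Θ k) (lam k * Real.pi)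
  ne : ∀ k, lam k ≠ 0 ∧ lam k ≠ 1 ∧ lam k ≠ 2

/-- The indexing convention `λ_1 = ⋯ = λ_u < λ_{u+1} ≤ ⋯ ≤ λ_s`. -/
structure IsIndexed {s : ℕ} [NeZero s] (lam : Fin s → ℝ) (u : ℕ) : Prop where
  monotone : Monotone lam
  eq_iff : ∀ k : Fin s, lam k = lam 0 ↔ (k : ℕ) < u

/-- The power `(w - ω)^lam`, `ω = ρ e^{iΘ}`, with the branch
`Θ - π < arg (w - ω) < Θ + π`. -/
def branchPow (ρ Θ lam : ℝ) (w : ℂ) : ℂ :=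
  Complex.exp (lam * Θ * Complex.I) *
    ((w - circlePt ρ Θ) * Complex.exp (-(Θ * Complex.I))) ^ (lam : ℂ)

/-- The number `A_k = lim (ψ(w) - z_k) / (w - ω_k)^{λ_k}` as `w → ω_k` in `𝔼_ρ`. -/
def cornerCoeff (ψ : ℂ → ℂ) (ρ Θ lam : ℝ) : ℂ :=
  limUnder (𝓝[outside ρ] (circlePt ρ Θ)) fun w =>
    (ψ w - ψ (circlePt ρ Θ)) / branchPow ρ Θ lam w

/-- `Â_k = A_k e^{i(λ_1+1)(Θ_k-Θ_1)}`. (Used for those `k` with `λ_k = λ_1`.) -/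
def hatCoeff (ψ : ℂ → ℂ) (ρ : ℝ) {s : ℕ} [NeZero s] (Θ lam : Fin s → ℝ) (k : Fin s) : ℂ :=
  cornerCoeff ψ ρ (Θ k) (lam k) *
    Complex.exp (Complex.I * ((lam 0 + 1 : ℝ) * (Θ k - Θ 0 : ℝ)))

/-- `φ'(z) ∑_{k ≤ u} φ'(z_k) Â_k e^{2πi x_k} / [φ(z) - φ(z_k)]²`, where `z_k = ψ(ω_k)`. -/
def kernelSum (ψ φ : ℂ → ℂ) (ρ : ℝ) {s u : ℕ} [NeZero s] (hus : u ≤ s) (Θ lam : Fin s → ℝ)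
    (x : Fin u → ℝ) (z : ℂ) : ℂ :=
  deriv φ z * ∑ k : Fin u,
    deriv φ (ψ (circlePt ρ (Θ (Fin.castLE hus k)))) * hatCoeff ψ ρ Θ lam (Fin.castLE hus k) *
      Complex.exp (2 * Real.pi * Complex.I * x k) /
      (φ z - φ (ψ (circlePt ρ (Θ (Fin.castLE hus k))))) ^ 2

/-- The function `H_n`: `x_k = n θ_k`. -/
def H (ψ φ : ℂ → ℂ) (ρ : ℝ) {s u : ℕ} [NeZero s] (hus : u ≤ s) (Θ lam : Fin s → ℝ)
    (θ : Fin u → ℝ) (n : ℕ) : ℂ → ℂ :=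
  kernelSum ψ φ ρ hus Θ lam fun k => n * θ k

/-- The candidate limit function: `x_k = s_{kℓ} / q_k + ∑_{j=2}^{u*} r_{kj} α_j`, with
`s_{kℓ} = ℓ p_k mod q_k`. Here `u* = v + 1`, and `α_2, …, α_{u*}` is `α : Fin v → ℝ`. -/
def limitFunction (ψ φ : ℂ → ℂ) (ρ : ℝ) {s u v : ℕ} [NeZero s] (hus : u ≤ s)
    (Θ lam : Fin s → ℝ) (r : Fin u → Fin (v + 1) → ℚ) (p q : Fin u → ℕ) (l : ℕ)
    (α : Fin v → ℝ) : ℂ → ℂ :=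
  kernelSum ψ φ ρ hus Θ lam fun k =>
    ((l * p k % q k : ℕ) : ℝ) / (q k : ℝ) + ∑ j : Fin v, (r k j.succ : ℝ) * α j

/-- `θ_k ∈ (0, 1]` and `e^{2πi θ_k} = e^{i(Θ_k - Θ_1)}` for `1 ≤ k ≤ u`. -/
structure IsRelativeArg {s u : ℕ} [NeZero s] (hus : u ≤ s) (Θ : Fin s → ℝ)
    (θ : Fin u → ℝ) : Prop where
  mem : ∀ k, θ k ∈ Ioc 0 1
  exp_eq : ∀ k, Complex.exp (2 * Real.pi * Complex.I * θ k) =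
    Complex.exp (Complex.I * (Θ (Fin.castLE hus k) - Θ 0 : ℝ))

/-- `θ_1, …, θ_{u*}` (`u* = v + 1 ≤ u`) is a basis over `ℚ` for the span of `θ_1, …, θ_u`, and
`θ_k = ∑_j r_{kj} θ_j`. -/
structure IsRationalBasis {u v : ℕ} (hvu : v + 1 ≤ u) (θ : Fin u → ℝ)
    (r : Fin u → Fin (v + 1) → ℚ) : Prop where
  linearIndependent : LinearIndependent ℚ fun j : Fin (v + 1) => θ (Fin.castLE hvu j)
  expansion : ∀ k, θ k = ∑ j : Fin (v + 1), (r k j : ℝ) * θ (Fin.castLE hvu j)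

/-- `1 ≤ p_k ≤ q_k` are relatively prime and `e^{2πi r_{k1}} = e^{2πi p_k/q_k}`. -/
structure IsReducedFraction {u v : ℕ} (r : Fin u → Fin (v + 1) → ℚ) (p q : Fin u → ℕ) :
    Prop where
  one_le : ∀ k, 1 ≤ p k
  le : ∀ k, p k ≤ q k
  coprime : ∀ k, Nat.Coprime (p k) (q k)
  exp_eq : ∀ k, Complex.exp (2 * Real.pi * Complex.I * (r k 0 : ℝ)) =
    Complex.exp (2 * Real.pi * Complex.I * ((p k : ℝ) / (q k : ℝ) : ℝ))

/-- `f` is, on the open set `G`, the limit of some subsequence of `F`, uniformly on compact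
subsets of `G`. -/
def IsSubseqLimitOn (F : ℕ → ℂ → ℂ) (G : Set ℂ) (f : ℂ → ℂ) : Prop :=
  ∃ n : ℕ → ℕ, StrictMono n ∧ TendstoLocallyUniformlyOn (fun i => F (n i)) f atTop G

end Carleman

end

/-! H_n is a combination of u fixed functions g_k (`kernelTerm`) with coefficients e^{2πi nθ_k}, so
its limits are governed by limits of the phase vectors. Since θ_1 = 1, the part n r_{k1} of nθ_k
matters only through n modulo 𝐪. If D is a common denominator of the r_{kj} with j ≥ 2, the
remaining factor is an integer character at the torus point (nθ_j/D)_j. Along n = ℓ + 𝐪m,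
Kronecker's theorem (`mapClusterPt_natCast_mul`), applicable because 1, θ_2, …, θ_{u*} are
independent over ℚ, brings these points close to any prescribed one, so every candidate is a limit.
Conversely, by compactness every sequence of indices has a subsequence with constant residue and
convergent torus point, so every limit is a candidate.

It remains to see that the g_k are continuous and zero-free on G_ρ and that G_ρ is nonempty
(`kernelTerm_facts`, `innerSet_nonempty`). Then, at any z in G_ρ, distinctness of the e^{2πiθ_k} and
a Vandermonde argument give some H_n(z) ≠ 0, and this H_n is itself a candidate, hence a limit.

Zero-freeness rests on the existence and non-vanishing of A_k. Under w = ω_k exp(-i e^ζ) a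
neighbourhood of ω_k in the closed exterior becomes the end of the half strip 0 ≤ Im ζ ≤ π; let Φ =
log(ψ(w) - z_k). Because the two image arcs are analytic, Im Φ is constant on each edge up to a
holomorphic correction that is small with e^Φ. Phragmén–Lindelöf, Schwarz reflection and
Borel–Carathéodory then yield Φ = λζ + c + o(1) (`CornerData.exists_limit`,
`ConditionA1.exists_log_expansion`), so A_k is an exponential.

One also needs ρ < 1, which puts z_k and G_ρ inside G_1: for ρ = 1 the corner would lie on the
analytic curve L, whose tangent line forces λ_k ∈ {0, 1, 2}. Finally, if G_ρ were empty, a right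
inverse χ of ψ would be holomorphic across an arc of the boundary, where 1/|χ| has an interior
maximum. -/

open Filter Topology Set

noncomputable section

namespace Carleman

/-! ### Equidistribution on the torus and Kronecker's theorem. -/

/-- The Haar probability measure on the torus. -/
abbrev torusMeasure (d : Type*) [Fintype d] : MeasureTheory.Measure (UnitAddTorus d) :=
  MeasureTheory.Measure.pi fun _ => AddCircle.haarAddCircle

open MeasureTheory in
theorem integral_mFourier_of_ne_zero {d : Type*} [Fintype d] {k : d → ℤ} (hk : k ≠ 0) :
    ∫ x, UnitAddTorus.mFourier k x ∂torusMeasure d = 0 := by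
  have h := (orthonormal_iff_ite.1 (UnitAddTorus.orthonormal_mFourier (d := d))) 0 k
  rw [if_neg hk.symm] at h
  rw [ContinuousMap.inner_toLp] at h
  simp only [UnitAddTorus.mFourier_zero, ContinuousMap.one_apply, map_one, mul_one] at h
  exact h

theorem tendsto_average_pow_of_ne_one {z : ℂ} (hz : ‖z‖ ≤ 1) (h1 : z ≠ 1) :
    Tendsto (fun M : ℕ => (M : ℂ)⁻¹ * ∑ m ∈ Finset.range M, z ^ m) atTop (𝓝 0) := by
  have hb : ∀ M : ℕ, ‖∑ m ∈ Finset.range M, z ^ m‖ ≤ 2 / ‖z - 1‖ := by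
    intro M
    rw [geom_sum_eq h1, norm_div]
    gcongr
    calc ‖z ^ M - 1‖ ≤ ‖z ^ M‖ + ‖(1 : ℂ)‖ := norm_sub_le _ _
      _ ≤ 1 + 1 := by
        rw [norm_pow, norm_one]
        gcongr
        exact pow_le_one₀ (norm_nonneg _) hz
      _ = 2 := by norm_num
  have h0 : Tendsto (fun M : ℕ => (M : ℂ)⁻¹) atTop (𝓝 0) := tendsto_inv_atTop_nhds_zero_nat
  refine squeeze_zero_norm (a := fun M : ℕ => ‖(M : ℂ)⁻¹‖ * (2 / ‖z - 1‖)) (fun M => ?_) ?_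
  · rw [norm_mul]
    gcongr
    exact hb M
  · simpa using h0.norm.mul_const (2 / ‖z - 1‖)

theorem mFourier_natCast_mul {d : Type*} [Fintype d] (β : d → ℝ) (k : d → ℤ) (m : ℕ) :
    UnitAddTorus.mFourier k (fun i => ((m * β i : ℝ) : UnitAddCircle)) =
      Complex.exp (2 * Real.pi * Complex.I * (∑ i, k i * β i : ℝ)) ^ m := by
  simp only [UnitAddTorus.mFourier, ContinuousMap.coe_mk, fourier_coe_apply]
  rw [← Complex.exp_sum, ← Complex.exp_nat_mul]
  congr 1
  push_cast
  rw [Finset.mul_sum, Finset.mul_sum]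
  refine Finset.sum_congr rfl fun i _ => ?_
  ring

open MeasureTheory in
-- Weyl's criterion: along the orbit of β the k-th character runs through the powers of e^{2πi k·β},
-- and the hypothesis says that this number is 1 only for k = 0. In all other cases the geometric
-- sums are bounded and the averages vanish in the limit.
theorem tendsto_average_mFourier {d : Type*} [Fintype d] (β : d → ℝ)
    (hβ : ∀ (k : d → ℤ) (m : ℤ), ∑ i, k i * β i = m → k = 0) (k : d → ℤ) :
    Tendsto (fun M : ℕ => (M : ℂ)⁻¹ * ∑ m ∈ Finset.range M,
      UnitAddTorus.mFourier k (fun i => ((m * β i : ℝ) : UnitAddCircle))) atTop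
      (𝓝 (∫ x, UnitAddTorus.mFourier k x ∂torusMeasure d)) := by
  simp only [mFourier_natCast_mul]
  by_cases hk : k = 0
  · subst hk
    simp only [Pi.zero_apply, Int.cast_zero, zero_mul, Finset.sum_const_zero, Complex.ofReal_zero,
      mul_zero, Complex.exp_zero, one_pow, Finset.sum_const, Finset.card_range, nsmul_eq_mul,
      mul_one]
    have : ∫ x, UnitAddTorus.mFourier (0 : d → ℤ) x ∂torusMeasure d = 1 := by
      simp [UnitAddTorus.mFourier_zero]
    rw [this]
    refine tendsto_const_nhds.congr' ?_
    filter_upwards [eventually_gt_atTop 0] with M hM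
    rw [inv_mul_cancel₀]
    exact_mod_cast hM.ne'
  · rw [integral_mFourier_of_ne_zero hk]
    refine tendsto_average_pow_of_ne_one ?_ ?_
    · rw [Complex.norm_exp]
      simp
    · intro h
      rw [Complex.exp_eq_one_iff] at h
      obtain ⟨n, hn⟩ := h
      refine hk (hβ k n ?_)
      have h2 : (2 * Real.pi * Complex.I : ℂ) ≠ 0 := Complex.two_pi_I_ne_zero
      have : ((∑ i, k i * β i : ℝ) : ℂ) = n := by
        apply mul_left_cancel₀ h2
        rw [hn]; ring
      exact_mod_cast this

open MeasureTheory in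
/-- **Kronecker's theorem**: if `1` and the `β i` are linearly independent over `ℚ`, the multiples
of `β` are dense modulo one, along arbitrarily large indices. -/
theorem mapClusterPt_natCast_mul {d : Type*} [Fintype d] (β : d → ℝ)
    (hβ : ∀ (k : d → ℤ) (m : ℤ), ∑ i, k i * β i = m → k = 0) (y : UnitAddTorus d) :
    MapClusterPt y atTop fun m : ℕ => fun i => ((m * β i : ℝ) : UnitAddCircle) := by
  set X : ℕ → UnitAddTorus d := fun m i => ((m * β i : ℝ) : UnitAddCircle) with hX
  rw [mapClusterPt_iff_frequently]
  intro s hs hev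
  rw [eventually_atTop] at hev
  obtain ⟨N, hN⟩ := hev
  -- If the orbit avoided `s` from time N on, the averages of a bump function vanishing off the
  -- interior of `s` would tend to 0, whereas equidistribution keeps them near its integral c > 0.
  obtain ⟨g, hg1, hg0, hg⟩ : ∃ g : C(UnitAddTorus d, ℝ), EqOn g 0 (interior s)ᶜ ∧
      EqOn g 1 {y} ∧ ∀ x, g x ∈ Icc (0 : ℝ) 1 :=
    exists_continuous_zero_one_of_isClosed isOpen_interior.isClosed_compl isClosed_singleton
      (by rw [disjoint_singleton_right]; simpa using mem_interior_iff_mem_nhds.2 hs)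
  have hpos : 0 < ∫ x, g x ∂torusMeasure d := by
    refine g.continuous.integral_pos_of_hasCompactSupport_nonneg_nonzero
      (HasCompactSupport.of_compactSpace _) (fun x => (hg x).1) (x := y) ?_
    rw [hg0 rfl]; simp
  set c := ∫ x, g x ∂torusMeasure d with hc
  let G : C(UnitAddTorus d, ℂ) := ⟨fun x => (g x : ℂ), by fun_prop⟩
  have hGint : ∫ x, G x ∂torusMeasure d = c := by
    simp only [G, ContinuousMap.coe_mk]
    rw [hc]; exact integral_ofReal
  let av : ℕ → C(UnitAddTorus d, ℂ) → ℂ := fun M f => (M : ℂ)⁻¹ * ∑ m ∈ Finset.range M, f (X m)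
  have hav : ∀ f ∈ Submodule.span ℂ (range (UnitAddTorus.mFourier (d := d))),
      Tendsto (fun M => av M f) atTop (𝓝 (∫ x, f x ∂torusMeasure d)) := by
    intro f hf
    induction hf using Submodule.span_induction with
    | mem f h => obtain ⟨k, rfl⟩ := h; exact tendsto_average_mFourier β hβ k
    | zero => simp [av]
    | add f f' _ _ h1 h2 =>
      have : ∫ x, (f + f') x ∂torusMeasure d = (∫ x, f x ∂torusMeasure d) + ∫ x, f' x ∂torusMeasure d := by
        simp only [ContinuousMap.add_apply]
        exact integral_add (f.continuous.integrable_of_hasCompactSupport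
          (HasCompactSupport.of_compactSpace _)) (f'.continuous.integrable_of_hasCompactSupport
          (HasCompactSupport.of_compactSpace _))
      rw [this]
      refine (h1.add h2).congr fun M => ?_
      simp [av, Finset.sum_add_distrib, mul_add]
    | smul a f _ h =>
      have : ∫ x, (a • f) x ∂torusMeasure d = a * ∫ x, f x ∂torusMeasure d := by
        simp only [ContinuousMap.smul_apply, smul_eq_mul]
        exact integral_const_mul _ _
      rw [this]
      refine (h.const_mul a).congr fun M => ?_
      simp only [av, ContinuousMap.smul_apply, smul_eq_mul, ← Finset.mul_sum]
      ring
  have hdense : G ∈ closure (Submodule.span ℂ (range (UnitAddTorus.mFourier (d := d))) :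
      Set C(UnitAddTorus d, ℂ)) := by
    have := UnitAddTorus.span_mFourier_closure_eq_top (d := d)
    rw [← Submodule.topologicalClosure_coe, this]; trivial
  -- Replacing G by the trigonometric polynomial P costs at most c/3 in the integral and c/3 in the
  -- averages, which leads to c ≤ 2c/3.
  obtain ⟨P, hP, hPG⟩ := Metric.mem_closure_iff.1 hdense (c / 3) (by positivity)
  have hle : ∀ x, ‖G x - P x‖ ≤ c / 3 := fun x => by
    have := ContinuousMap.norm_coe_le_norm (G - P) x
    rw [dist_eq_norm] at hPG
    exact this.trans hPG.le
  have hint : ‖(c : ℂ) - ∫ x, P x ∂torusMeasure d‖ ≤ c / 3 := by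
    rw [← hGint, ← integral_sub (G.continuous.integrable_of_hasCompactSupport
          (HasCompactSupport.of_compactSpace _)) (P.continuous.integrable_of_hasCompactSupport
          (HasCompactSupport.of_compactSpace _))]
    refine (norm_integral_le_of_norm_le_const (C := c / 3) (ae_of_all _ hle)).trans ?_
    simp
  have hGav : Tendsto (fun M => av M G) atTop (𝓝 0) := by
    have hb : ∀ M, ‖∑ m ∈ Finset.range M, G (X m)‖ ≤ N := by
      intro M
      calc ‖∑ m ∈ Finset.range M, G (X m)‖ ≤ ∑ m ∈ Finset.range M, ‖G (X m)‖ := norm_sum_le _ _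
        _ ≤ ∑ m ∈ Finset.range M, if m < N then (1 : ℝ) else 0 := by
          refine Finset.sum_le_sum fun m _ => ?_
          split_ifs with h
          · have := hg (X m)
            simp only [G, ContinuousMap.coe_mk, Complex.norm_real, Real.norm_eq_abs]
            rw [abs_of_nonneg this.1]; exact this.2
          · have h1 : X m ∉ interior s := fun h' => hN m (not_lt.1 h) (interior_subset h')
            simp [G, hg1 h1]
        _ = ((Finset.range M).filter (· < N)).card := by simp
        _ ≤ (Finset.range N).card := by
          exact_mod_cast Finset.card_le_card fun x hx => by simpa using (Finset.mem_filter.1 hx).2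
        _ = N := by simp
    have h0 : Tendsto (fun M : ℕ => (M : ℂ)⁻¹) atTop (𝓝 0) := tendsto_inv_atTop_nhds_zero_nat
    refine squeeze_zero_norm (a := fun M : ℕ => ‖(M : ℂ)⁻¹‖ * N) (fun M => ?_) ?_
    · simp only [av, norm_mul]
      gcongr
      exact hb M
    · simpa using h0.norm.mul_const (N : ℝ)
  have hdiff : ∀ M, ‖av M G - av M P‖ ≤ c / 3 := by
    intro M
    have : av M G - av M P = (M : ℂ)⁻¹ * ∑ m ∈ Finset.range M, (G (X m) - P (X m)) := by
      simp only [av, mul_sub, Finset.sum_sub_distrib]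
    rw [this]
    rw [norm_mul, norm_inv, Complex.norm_natCast]
    rcases Nat.eq_zero_or_pos M with rfl | hM
    · simp; positivity
    · rw [inv_mul_le_iff₀ (by exact_mod_cast hM)]
      refine (norm_sum_le _ _).trans ((Finset.sum_le_sum fun m _ => hle (X m)).trans ?_)
      simp
  have hlim : ‖(0 : ℂ) - ∫ x, P x ∂torusMeasure d‖ ≤ c / 3 :=
    le_of_tendsto ((hGav.sub (hav P hP)).norm) (Eventually.of_forall hdiff)
  have : ‖(c : ℂ)‖ ≤ c / 3 + c / 3 := by
    calc ‖(c : ℂ)‖ = ‖((c : ℂ) - ∫ x, P x ∂torusMeasure d) - (0 - ∫ x, P x ∂torusMeasure d)‖ := by ring_nf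
      _ ≤ _ := (norm_sub_le _ _).trans (add_le_add hint hlim)
  rw [Complex.norm_real, Real.norm_eq_abs, abs_of_pos hpos] at this
  linarith

/-! ### The phases of H_n and of the candidate limits. -/

theorem mFourier_coe {d : Type*} [Fintype d] (x : d → ℝ) (k : d → ℤ) :
    UnitAddTorus.mFourier k (fun i => ((x i : ℝ) : UnitAddCircle)) =
      Complex.exp (2 * Real.pi * Complex.I * (∑ i, k i * x i : ℝ)) := by
  have h := mFourier_natCast_mul x k 1
  simpa only [Nat.cast_one, one_mul, pow_one] using h

theorem exp_two_pi_mul_add (x y : ℝ) :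
    Complex.exp (2 * Real.pi * Complex.I * (x + y : ℝ)) =
      Complex.exp (2 * Real.pi * Complex.I * x) * Complex.exp (2 * Real.pi * Complex.I * y) := by
  rw [← Complex.exp_add]
  congr 1
  push_cast
  ring

theorem exp_two_pi_mul_natCast_mul (n : ℕ) (x : ℝ) :
    Complex.exp (2 * Real.pi * Complex.I * (n * x : ℝ)) =
      Complex.exp (2 * Real.pi * Complex.I * x) ^ n := by
  rw [← Complex.exp_nat_mul]
  congr 1
  push_cast
  ring

theorem exp_two_pi_div_pow_mod {q : ℕ} (hq : 0 < q) (p n l : ℕ) (h : n ≡ l [MOD q]) :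
    Complex.exp (2 * Real.pi * Complex.I * ((p : ℝ) / (q : ℝ) : ℝ)) ^ n =
      Complex.exp (2 * Real.pi * Complex.I * (((l * p % q : ℕ) : ℝ) / (q : ℝ) : ℝ)) := by
  have hq' : (q : ℂ) ≠ 0 := by exact_mod_cast hq.ne'
  have h2 : n * p ≡ l * p % q [MOD q] := (h.mul_right p).trans (Nat.mod_modEq _ _).symm
  obtain ⟨c, hc⟩ := (Nat.modEq_iff_dvd.1 h2.symm)
  rw [← Complex.exp_nat_mul, Complex.exp_eq_exp_iff_exists_int]
  refine ⟨c, ?_⟩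
  have hc' : (n : ℂ) * p - ((l * p % q : ℕ) : ℂ) = q * c := by exact_mod_cast hc
  push_cast
  field_simp
  linear_combination hc'

variable {u v : ℕ} {hvu : v + 1 ≤ u} {θ : Fin u → ℝ} {r : Fin u → Fin (v + 1) → ℚ}
  {p q : Fin u → ℕ}

theorem IsReducedFraction.pos (hpq : IsReducedFraction r p q) (k : Fin u) : 0 < q k :=
  (hpq.one_le k).trans (hpq.le k)

theorem IsReducedFraction.lcm_pos (hpq : IsReducedFraction r p q) : 0 < Finset.univ.lcm q := by
  rw [Nat.pos_iff_ne_zero, Ne, Finset.lcm_eq_zero_iff]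
  rintro ⟨k, -, hk⟩
  exact (hpq.pos k).ne' hk

/-- The phases of a candidate limit function. -/
def candidatePhase (r : Fin u → Fin (v + 1) → ℚ) (p q : Fin u → ℕ) (l : ℕ) (α : Fin v → ℝ)
    (k : Fin u) : ℝ :=
  ((l * p k % q k : ℕ) : ℝ) / (q k : ℝ) + ∑ j : Fin v, (r k j.succ : ℝ) * α j

/-- A common denominator of the rational coordinates. -/
theorem exists_common_denominator (r : Fin u → Fin (v + 1) → ℚ) :
    ∃ D : ℕ, 0 < D ∧ ∃ R : Fin u → Fin v → ℤ, ∀ k j, (r k j.succ : ℝ) * D = R k j := by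
  refine ⟨∏ k, ∏ j : Fin v, (r k j.succ).den,
    Finset.prod_pos fun k _ => Finset.prod_pos fun j _ => (r k j.succ).den_pos, ?_⟩
  have : ∀ k j, ∃ z : ℤ, (r k (Fin.succ j) : ℝ) *
      ((∏ k, ∏ j : Fin v, (r k j.succ).den : ℕ) : ℝ) = z := by
    intro k j
    obtain ⟨c, hc⟩ : (r k j.succ).den ∣ ∏ k, ∏ j : Fin v, (r k j.succ).den :=
      (Finset.dvd_prod_of_mem (fun j : Fin v => (r k j.succ).den) (Finset.mem_univ j)).trans
        (Finset.dvd_prod_of_mem (fun k => ∏ j : Fin v, (r k j.succ).den) (Finset.mem_univ k))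
    refine ⟨(r k j.succ).num * c, ?_⟩
    rw [hc]
    have h := Rat.mul_den_eq_num (r k j.succ)
    have h' : (r k j.succ : ℝ) * (r k j.succ).den = (r k j.succ).num := by exact_mod_cast h
    push_cast
    rw [← mul_assoc, h']
  choose R hR using this
  exact ⟨R, hR⟩

/-- Dividing α by the common denominator turns the rational exponents r_{kj} into the integers
R_{kj}, so that this factor becomes a genuine character of the torus. -/
theorem exp_candidatePhase {D : ℕ} (hD : 0 < D) {R : Fin u → Fin v → ℤ}
    (hR : ∀ k j, (r k j.succ : ℝ) * D = R k j) (l : ℕ) (α : Fin v → ℝ) (k : Fin u) :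
    Complex.exp (2 * Real.pi * Complex.I * candidatePhase r p q l α k) =
      Complex.exp (2 * Real.pi * Complex.I * (((l * p k % q k : ℕ) : ℝ) / (q k : ℝ) : ℝ)) *
        UnitAddTorus.mFourier (R k) (fun j => ((α j / D : ℝ) : UnitAddCircle)) := by
  rw [candidatePhase, exp_two_pi_mul_add, mFourier_coe]
  congr 4
  refine Finset.sum_congr rfl fun j _ => ?_
  rw [← hR]
  have : (D : ℝ) ≠ 0 := by exact_mod_cast hD.ne'
  field_simp

/-- The coordinate along θ_1 = 1 contributes n r_{k1}, which is periodic in n. The result has the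
shape of `exp_candidatePhase`, so comparing phases reduces to comparing a residue and a point of the
torus. -/
theorem exp_natCast_mul (hr : IsRationalBasis hvu θ r) (hpq : IsReducedFraction r p q)
    (h1 : θ (Fin.castLE hvu 0) = 1) {D : ℕ} (hD : 0 < D) {R : Fin u → Fin v → ℤ}
    (hR : ∀ k j, (r k j.succ : ℝ) * D = R k j) {n l : ℕ}
    (hnl : n ≡ l [MOD Finset.univ.lcm q]) (k : Fin u) :
    Complex.exp (2 * Real.pi * Complex.I * (n * θ k : ℝ)) =
      Complex.exp (2 * Real.pi * Complex.I * (((l * p k % q k : ℕ) : ℝ) / (q k : ℝ) : ℝ)) *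
        UnitAddTorus.mFourier (R k)
          (fun j => ((n * (θ (Fin.castLE hvu j.succ) / D) : ℝ) : UnitAddCircle)) := by
  have hq : q k ∣ Finset.univ.lcm q := Finset.dvd_lcm (Finset.mem_univ k)
  rw [← exp_two_pi_div_pow_mod (hpq.pos k) (p k) n l (hnl.of_dvd hq), ← hpq.exp_eq k,
    ← exp_two_pi_mul_natCast_mul, mFourier_coe, ← exp_two_pi_mul_add]
  congr 3
  rw [hr.expansion k, Fin.sum_univ_succ, h1, mul_one, mul_add, Finset.mul_sum]
  congr 1
  refine Finset.sum_congr rfl fun j _ => ?_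
  rw [← hR]
  have : (D : ℝ) ≠ 0 := by exact_mod_cast hD.ne'
  field_simp

theorem IsRationalBasis.eq_zero_of_sum_eq (hr : IsRationalBasis hvu θ r)
    (h1 : θ (Fin.castLE hvu 0) = 1) {Q D : ℕ} (hQ : 0 < Q) (hD : 0 < D) (k : Fin v → ℤ) (m : ℤ)
    (h : ∑ j, k j * (Q * (θ (Fin.castLE hvu j.succ) / D)) = m) : k = 0 := by
  -- Solving the integer relation for ∑ k_j θ_j gives mD/Q, which is a rational multiple of θ_1 = 1.
  have hli := Fintype.linearIndependent_iff.1 hr.linearIndependent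
    (Fin.cons (-(m * D / Q : ℚ)) fun j => (k j : ℚ)) ?_
  · funext j
    have := hli j.succ
    simpa using this
  · rw [Fin.sum_univ_succ]
    simp only [Fin.cons_zero, Fin.cons_succ, h1, Rat.smul_def]
    have hD' : (D : ℝ) ≠ 0 := by exact_mod_cast hD.ne'
    have hQ' : (Q : ℝ) ≠ 0 := by exact_mod_cast hQ.ne'
    have : ∑ j, ((k j : ℚ) : ℝ) * θ (Fin.castLE hvu j.succ) = m * D / Q := by
      rw [← h, Finset.sum_mul, Finset.sum_div]
      refine Finset.sum_congr rfl fun j _ => ?_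
      push_cast
      field_simp
    rw [this]
    push_cast
    ring

/-- Indices n = l + Qm keep the residue fixed, and Kronecker's theorem in the variable m reaches any
torus point. -/
theorem exists_strictMono_tendsto_exp (hr : IsRationalBasis hvu θ r)
    (hpq : IsReducedFraction r p q) (h1 : θ (Fin.castLE hvu 0) = 1) (l : ℕ) (α : Fin v → ℝ) :
    ∃ n : ℕ → ℕ, StrictMono n ∧ ∀ k,
      Tendsto (fun i => Complex.exp (2 * Real.pi * Complex.I * (n i * θ k : ℝ))) atTop
        (𝓝 (Complex.exp (2 * Real.pi * Complex.I * candidatePhase r p q l α k))) := by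
  obtain ⟨D, hD, R, hR⟩ := exists_common_denominator r
  set Q := Finset.univ.lcm q with hQdef
  have hQ : 0 < Q := hpq.lcm_pos
  -- The target is shifted by the contribution of the constant part l of the index.
  have hcl := mapClusterPt_natCast_mul (fun j : Fin v => Q * (θ (Fin.castLE hvu j.succ) / D))
    (hr.eq_zero_of_sum_eq h1 hQ hD)
    (fun j => ((α j / D - l * (θ (Fin.castLE hvu j.succ) / D) : ℝ) : UnitAddCircle))
  obtain ⟨m, hm, hlim⟩ := hcl.tendsto_subseq
  refine ⟨fun i => l + Q * m i, fun i j hij => ?_, fun k => ?_⟩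
  · exact Nat.add_lt_add_left (Nat.mul_lt_mul_of_pos_left (hm hij) hQ) l
  · have hmod : ∀ i, l + Q * m i ≡ l [MOD Q] := fun i => by simp [Nat.ModEq]
    simp only [fun i => exp_natCast_mul hr hpq h1 hD hR (hmod i) k, exp_candidatePhase hD hR]
    refine Tendsto.const_mul _ (((UnitAddTorus.mFourier (R k)).continuous.tendsto _).comp ?_)
    rw [tendsto_pi_nhds] at hlim ⊢
    intro j
    have := (hlim j).const_add ((l * (θ (Fin.castLE hvu j.succ) / D) : ℝ) : UnitAddCircle)
    rw [← AddCircle.coe_add, add_sub_cancel] at this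
    refine this.congr fun i => ?_
    simp only [Function.comp]
    rw [← AddCircle.coe_add]
    congr 1
    push_cast
    ring

theorem exists_mem_Icc_modEq {Q : ℕ} (hQ : 0 < Q) (n : ℕ) :
    ∃ l ∈ Finset.Icc 1 Q, n ≡ l [MOD Q] := by
  rcases Nat.eq_zero_or_pos (n % Q) with h | h
  -- The residues range over 1, …, Q, so the class of 0 is represented by Q.
  · exact ⟨Q, Finset.mem_Icc.2 ⟨hQ, le_rfl⟩, by simp [Nat.ModEq, h]⟩
  · exact ⟨n % Q, Finset.mem_Icc.2 ⟨h, (Nat.mod_lt _ hQ).le⟩, (Nat.mod_modEq _ _).symm⟩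

/-- The choice α_j = nθ_j reproduces the phases of H_n exactly. This turns the non-vanishing of some
H_n into the non-vanishing of a limit function. -/
theorem exists_candidatePhase_eq (hr : IsRationalBasis hvu θ r)
    (hpq : IsReducedFraction r p q) (h1 : θ (Fin.castLE hvu 0) = 1) (n : ℕ) :
    ∃ l ∈ Finset.Icc 1 (Finset.univ.lcm q), ∃ α : Fin v → ℝ, ∀ k,
      Complex.exp (2 * Real.pi * Complex.I * candidatePhase r p q l α k) =
        Complex.exp (2 * Real.pi * Complex.I * (n * θ k : ℝ)) := by
  obtain ⟨D, hD, R, hR⟩ := exists_common_denominator r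
  obtain ⟨l, hl, hnl⟩ := exists_mem_Icc_modEq hpq.lcm_pos n
  refine ⟨l, hl, fun j => n * θ (Fin.castLE hvu j.succ), fun k => ?_⟩
  rw [exp_natCast_mul hr hpq h1 hD hR hnl, exp_candidatePhase hD hR]
  simp only [mul_div_assoc]

/-- Compactness of the product of the torus with the finite set of residues. -/
theorem exists_subseq_tendsto_exp (hr : IsRationalBasis hvu θ r)
    (hpq : IsReducedFraction r p q) (h1 : θ (Fin.castLE hvu 0) = 1) (n : ℕ → ℕ) :
    ∃ l ∈ Finset.Icc 1 (Finset.univ.lcm q), ∃ α : Fin v → ℝ, ∃ m : ℕ → ℕ, StrictMono m ∧ ∀ k,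
      Tendsto (fun i => Complex.exp (2 * Real.pi * Complex.I * (n (m i) * θ k : ℝ))) atTop
        (𝓝 (Complex.exp (2 * Real.pi * Complex.I * candidatePhase r p q l α k))) := by
  obtain ⟨D, hD, R, hR⟩ := exists_common_denominator r
  have hQ : 0 < Finset.univ.lcm q := hpq.lcm_pos
  choose l hl hnl using fun i => exists_mem_Icc_modEq hQ (n i)
  obtain ⟨⟨y, l0⟩, m, hm, hlim⟩ := CompactSpace.tendsto_subseq
    fun i => ((fun j => ((n i * (θ (Fin.castLE hvu j.succ) / D) : ℝ) : UnitAddCircle),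
      ⟨l i, hl i⟩) : UnitAddTorus (Fin v) × Finset.Icc 1 (Finset.univ.lcm q))
  rw [Prod.tendsto_iff] at hlim
  obtain ⟨hy, hl0⟩ := hlim
  have hl0' : ∀ᶠ i in atTop, l (m i) = l0 := by
    rw [nhds_discrete, tendsto_pure] at hl0
    filter_upwards [hl0] with i hi
    simpa using congrArg Subtype.val hi
  choose Y hY using fun j => QuotientAddGroup.mk_surjective (y j)
  -- The character is evaluated at α_j/D, so a real lift of the limit point has to be multiplied by
  -- D.
  refine ⟨l0, l0.2, fun j => D * Y j, m, hm, fun k => ?_⟩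
  rw [exp_candidatePhase hD hR]
  have hy' : (fun j => ((D * Y j / D : ℝ) : UnitAddCircle)) = y := by
    funext j
    rw [mul_div_cancel_left₀ _ (by exact_mod_cast hD.ne')]
    exact hY j
  rw [hy']
  refine (Tendsto.const_mul _
    (((UnitAddTorus.mFourier (R k)).continuous.tendsto _).comp hy)).congr' ?_
  filter_upwards [hl0'] with i hi
  rw [exp_natCast_mul hr hpq h1 hD hR (hi ▸ hnl (m i))]
  rfl

/-! ### Injective holomorphic functions. -/

theorem not_eventually_eq_of_injOn {f : ℂ → ℂ} {U : Set ℂ} (hU : IsOpen U) (hinj : InjOn f U)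
    {z : ℂ} (hz : z ∈ U) : ¬ ∀ᶠ w in 𝓝 z, f w = f z := by
  intro h
  have h1 : ∀ᶠ w in 𝓝[≠] z, w ∈ U ∧ f w = f z ∧ w ≠ z := by
    filter_upwards [mem_nhdsWithin_of_mem_nhds (hU.mem_nhds hz), mem_nhdsWithin_of_mem_nhds h,
      self_mem_nhdsWithin] with w h1 h2 h3 using ⟨h1, h2, h3⟩
  obtain ⟨w, h1, h2, h3⟩ := h1.exists
  exact h3 (hinj h1 hz h2)

/-- An injective holomorphic function has non-vanishing derivative. -/
theorem deriv_ne_zero_of_injOn {f : ℂ → ℂ} {U : Set ℂ} (hU : IsOpen U)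
    (hf : DifferentiableOn ℂ f U) (hinj : InjOn f U) {z : ℂ} (hz : z ∈ U) : deriv f z ≠ 0 := by
  intro hd
  have hfa : AnalyticAt ℂ f z := hf.analyticAt (hU.mem_nhds hz)
  -- Here f - f(z) = (w - z)^n g with g(z) ≠ 0, and a vanishing derivative leaves n ≥ 2. Then f -
  -- f(z) is the n-th power of a local coordinate `k`, and the points where `k` equals t and ζt,
  -- with ζ a primitive n-th root of unity, share the same value of f.
  obtain ⟨n, g, hga, hg0, hg⟩ := (hfa.sub analyticAt_const).exists_eventuallyEq_pow_smul_nonzero_iff.2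
    (show ¬ ∀ᶠ w in 𝓝 z, (f - fun _ : ℂ => f z) w = 0 by
      simpa [sub_eq_zero] using not_eventually_eq_of_injOn hU hinj hz)
  simp only [Pi.sub_apply, smul_eq_mul] at hg
  have hn0 : n ≠ 0 := by
    rintro rfl
    have := hg.self_of_nhds
    simp only [sub_self, pow_zero, one_mul] at this
    exact hg0 this.symm
  have hn1 : n ≠ 1 := by
    rintro rfl
    have h1 : HasDerivAt (fun w => f w - f z) (g z) z := by
      have := ((hasDerivAt_id z).sub_const z).mul hga.differentiableAt.hasDerivAt
      simp only [id, sub_self, zero_mul, add_zero, one_mul] at this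
      exact this.congr_of_eventuallyEq (hg.mono fun w hw => by simpa using hw)
    have h2 := hfa.differentiableAt.hasDerivAt.sub_const (f z)
    rw [hd] at h2
    exact hg0 (h1.unique h2)
  obtain ⟨c, hc⟩ := IsAlgClosed.exists_pow_nat_eq (g z) (Nat.pos_of_ne_zero hn0)
  have hc0 : c ≠ 0 := by
    rintro rfl
    rw [zero_pow hn0] at hc
    exact hg0 hc.symm
  set h : ℂ → ℂ := fun w => c * Complex.exp (Complex.log (g w / g z) / n) with hh
  have hha : AnalyticAt ℂ h z := by
    refine analyticAt_const.mul (AnalyticAt.cexp ?_)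
    refine AnalyticAt.div_const (AnalyticAt.clog (hga.div_const) ?_)
    rw [div_self hg0]
    exact Complex.one_mem_slitPlane
  have hn' : (n : ℂ) ≠ 0 := by exact_mod_cast hn0
  have hpow : ∀ᶠ w in 𝓝 z, h w ^ n = g w := by
    filter_upwards [hga.continuousAt.eventually_ne hg0] with w hw
    rw [hh]
    simp only
    rw [mul_pow, ← Complex.exp_nat_mul, mul_div_cancel₀ _ hn', Complex.exp_log (div_ne_zero hw hg0),
      hc, mul_div_cancel₀ _ hg0]
  have hhz : h z = c := by simp [hh, div_self hg0]
  set k : ℂ → ℂ := fun w => (w - z) * h w with hk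
  have hks : HasStrictDerivAt k c z := by
    have h1 : HasStrictDerivAt (fun w : ℂ => w - z) 1 z := (hasStrictDerivAt_id z).sub_const z
    have h2 := h1.mul hha.hasStrictDerivAt
    rw [sub_self, zero_mul, add_zero, one_mul, hhz] at h2
    exact h2
  have hmap := hks.map_nhds_eq hc0
  have hkz : k z = 0 := by simp [hk]
  set V : Set ℂ := {w | w ∈ U ∧ f w - f z = k w ^ n}
  have hV : V ∈ 𝓝 z := by
    filter_upwards [hU.mem_nhds hz, hg, hpow] with w h1 h2 h3
    refine ⟨h1, ?_⟩
    rw [h2, hk]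
    simp only
    rw [mul_pow, h3]
  have himg : k '' V ∈ 𝓝 (0 : ℂ) := by
    rw [← hkz, ← hmap]
    exact image_mem_map hV
  have hprim := Complex.isPrimitiveRoot_exp n hn0
  set ζ := Complex.exp (2 * Real.pi * Complex.I / n)
  have himg' : ∀ᶠ t in 𝓝[≠] (0 : ℂ), t ∈ k '' V ∧ ζ * t ∈ k '' V ∧ t ≠ 0 := by
    have hcont : Tendsto (fun t : ℂ => ζ * t) (𝓝 0) (𝓝 0) := by
      have : Continuous fun t : ℂ => ζ * t := by fun_prop
      simpa using this.tendsto 0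
    filter_upwards [mem_nhdsWithin_of_mem_nhds himg,
      mem_nhdsWithin_of_mem_nhds (hcont himg), self_mem_nhdsWithin] with t h1 h2 h3
      using ⟨h1, h2, h3⟩
  obtain ⟨t, ⟨a, ⟨haU, ha⟩, hat⟩, ⟨b, ⟨hbU, hb⟩, hbt⟩, ht⟩ := himg'.exists
  have hab : f a = f b := by
    have : f a - f z = f b - f z := by
      rw [ha, hb, hat, hbt, mul_pow, hprim.pow_eq_one, one_mul]
    exact sub_left_injective this
  have hab' := hinj haU hbU hab
  rw [← hab', hat] at hbt
  have h1 : ζ = 1 := by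
    have : t * ζ = t * 1 := by rw [mul_one, mul_comm]; exact hbt.symm
    exact mul_left_cancel₀ ht this
  exact hn1 (hprim.unique (by rw [h1]; exact IsPrimitiveRoot.one))

/-- A boundary value of an injective holomorphic function is not attained inside. -/
theorem notMem_image_of_tendsto {f : ℂ → ℂ} {U : Set ℂ} (hU : IsOpen U)
    (hf : DifferentiableOn ℂ f U) (hinj : InjOn f U) {w y : ℂ} (hw : w ∉ U)
    (hcl : w ∈ closure U) (hlim : Tendsto f (𝓝[U] w) (𝓝 y)) : y ∉ f '' U := by
  rintro ⟨w', hw', rfl⟩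
  have hne : w ≠ w' := fun h => hw (h ▸ hw')
  obtain ⟨A, B, hA, hB, hwA, hwB, hAB⟩ := t2_separation hne
  have hnb : 𝓝 (f w') ≤ map f (𝓝 w') :=
    (hf.analyticAt (hU.mem_nhds hw')).eventually_constant_or_nhds_le_map_nhds.resolve_left
      (not_eventually_eq_of_injOn hU hinj hw')
  -- By the open mapping theorem, points near w' already cover a neighbourhood of the boundary
  -- value; points of U near w would take such values a second time.
  have h1 : f '' (B ∩ U) ∈ 𝓝 (f w') :=
    hnb (image_mem_map (inter_mem (hB.mem_nhds hwB) (hU.mem_nhds hw')))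
  have : (𝓝[U] w).NeBot := mem_closure_iff_nhdsWithin_neBot.1 hcl
  have h2 : ∀ᶠ a in 𝓝[U] w, f a ∈ f '' (B ∩ U) ∧ a ∈ A ∧ a ∈ U := by
    filter_upwards [hlim h1, mem_nhdsWithin_of_mem_nhds (hA.mem_nhds hwA),
      self_mem_nhdsWithin] with a h1 h2 h3 using ⟨h1, h2, h3⟩
  obtain ⟨a, ⟨b, ⟨hbB, hbU⟩, hb⟩, haA, haU⟩ := h2.exists
  have := hinj hbU haU hb
  exact disjoint_left.1 hAB haA (this ▸ hbB)

/-! ### Morera's theorem, Schwarz reflection and a Borel–Carathéodory estimate. -/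

open Complex in
/-- The integral of `f` along the boundary of the rectangle with opposite corners `a + ci` and
`b + di`. -/
def rectIntegral (f : ℂ → ℂ) (a b c d : ℝ) : ℂ :=
  (∫ x : ℝ in a..b, f (x + c * I)) - (∫ x : ℝ in a..b, f (x + d * I)) +
      I • (∫ y : ℝ in c..d, f (b + y * I)) - I • (∫ y : ℝ in c..d, f (a + y * I))

open Complex in
theorem rectIntegral_add {f : ℂ → ℂ} {a b c d e : ℝ} (he : e ∈ (uIcc c d))
    (hf : ContinuousOn f (uIcc a b ×ℂ (uIcc c d))) :
    rectIntegral f a b c d = rectIntegral f a b c e + rectIntegral f a b e d := by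
  have hcont : ∀ t ∈ (uIcc a b), ContinuousOn (fun y : ℝ => f (t + y * I)) (uIcc c d) := by
    intro t ht
    refine hf.comp (by fun_prop) fun y hy => ?_
    simpa [mem_reProdIm] using ⟨ht, hy⟩
  have hsub1 : (uIcc c e) ⊆ (uIcc c d) := uIcc_subset_uIcc left_mem_uIcc he
  have hsub2 : (uIcc e d) ⊆ (uIcc c d) := uIcc_subset_uIcc he right_mem_uIcc
  have key : ∀ t ∈ (uIcc a b), (∫ y : ℝ in c..d, f (t + y * I)) =
      (∫ y : ℝ in c..e, f (t + y * I)) + ∫ y : ℝ in e..d, f (t + y * I) := fun t ht =>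
    (intervalIntegral.integral_add_adjacent_intervals
      ((hcont t ht).mono hsub1).intervalIntegrable
      ((hcont t ht).mono hsub2).intervalIntegrable).symm
  simp only [rectIntegral, key a left_mem_uIcc, key b right_mem_uIcc, smul_eq_mul]
  ring

open Complex in
/-- A continuous function that is holomorphic off the real line is holomorphic. -/
theorem differentiableOn_of_differentiableAt_off_real {f : ℂ → ℂ} {U : Set ℂ} (hU : IsOpen U)
    (hc : ContinuousOn f U) (hd : ∀ z ∈ U, z.im ≠ 0 → DifferentiableAt ℂ f z) :
    DifferentiableOn ℂ f U := by
  refine (isConservativeOn_and_continuousOn_iff_isDifferentiableOn hU).1 ⟨fun z w hzw => ?_, hc⟩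
  rw [← add_eq_zero_iff_eq_neg, wedgeIntegral_add_wedgeIntegral_eq]
  change rectIntegral f z.re w.re z.im w.im = 0
  have hzw' : (uIcc z.re w.re) ×ℂ (uIcc z.im w.im) ⊆ U := hzw
  have key : ∀ c d : ℝ, (uIcc c d) ⊆ (uIcc z.im w.im) → 0 ∉ Ioo (min c d) (max c d) →
      rectIntegral f z.re w.re c d = 0 := by
    intro c d hcd h0
    have hsub : (uIcc z.re w.re) ×ℂ (uIcc c d) ⊆ U := fun x hx => hzw' ⟨hx.1, hcd hx.2⟩
    refine integral_boundary_rect_eq_zero_of_continuousOn_of_differentiableOn f ⟨z.re, c⟩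
      ⟨w.re, d⟩ (hc.mono hsub) fun x hx => (hd x (hsub ?_) ?_).differentiableWithinAt
    · exact ⟨Ioo_subset_Icc_self hx.1, Ioo_subset_Icc_self hx.2⟩
    · intro h
      exact h0 (h ▸ hx.2)
  -- A rectangle crossing the real line is cut along it; Cauchy's theorem holds for each half, since
  -- it needs only continuity on the closed rectangle.
  by_cases h0 : (0 : ℝ) ∈ Ioo (min z.im w.im) (max z.im w.im)
  · have h0' : (0 : ℝ) ∈ (uIcc z.im w.im) := Ioo_subset_Icc_self h0
    rw [rectIntegral_add h0' (hc.mono hzw'),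
      key _ _ (uIcc_subset_uIcc left_mem_uIcc h0') ?_,
      key _ _ (uIcc_subset_uIcc h0' right_mem_uIcc) ?_, add_zero]
    · rintro ⟨h1, h2⟩
      rcases le_total 0 w.im with h | h
      · rw [min_eq_left h] at h1; exact lt_irrefl _ h1
      · rw [max_eq_left h] at h2; exact lt_irrefl _ h2
    · rintro ⟨h1, h2⟩
      rcases le_total 0 z.im with h | h
      · rw [min_eq_right h] at h1; exact lt_irrefl _ h1
      · rw [max_eq_right h] at h2; exact lt_irrefl _ h2
  · exact key _ _ subset_rfl h0

open Complex ComplexConjugate in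
/-- **Schwarz reflection principle** on a symmetric open set. -/
theorem differentiableOn_reflection {f : ℂ → ℂ} {U : Set ℂ} (hU : IsOpen U)
    (hsymm : ∀ z ∈ U, conj z ∈ U) (hc : ContinuousOn f (U ∩ {z | 0 ≤ z.im}))
    (hd : ∀ z ∈ U, 0 < z.im → DifferentiableAt ℂ f z)
    (hreal : ∀ z ∈ U, z.im = 0 → (f z).im = 0) :
    DifferentiableOn ℂ (fun z => if 0 ≤ z.im then f z else conj (f (conj z))) U := by
  refine differentiableOn_of_differentiableAt_off_real hU ?_ ?_
  · have h1 : ContinuousOn (fun z => if 0 ≤ z.im then f z else conj (f (conj z))) U := by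
      refine ContinuousOn.if (p := fun z : ℂ => 0 ≤ z.im) ?_ ?_ ?_
      · rintro z ⟨hz, hz0⟩
        have hz0' : z.im = 0 := by
          have : frontier {z : ℂ | 0 ≤ z.im} = {z | z.im = 0} := frontier_setOfPred_le_im 0
          rw [this] at hz0
          exact hz0
        have : conj z = z := conj_eq_iff_im.2 hz0'
        rw [this]
        exact (conj_eq_iff_im.2 (hreal z hz hz0')).symm
      · refine hc.mono fun z hz => ⟨hz.1, ?_⟩
        have : closure {z : ℂ | 0 ≤ z.im} = {z | 0 ≤ z.im} :=
          (isClosed_le continuous_const continuous_im).closure_eq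
        exact this ▸ hz.2
      · refine continuous_conj.comp_continuousOn (hc.comp continuous_conj.continuousOn ?_)
        intro z hz
        refine ⟨hsymm z hz.1, ?_⟩
        have h2 : {z : ℂ | ¬ 0 ≤ z.im} = {z | z.im < 0} := by ext; simp
        have : closure {z : ℂ | z.im < 0} = {z | z.im ≤ 0} := closure_setOfPred_im_lt 0
        have h3 := hz.2
        rw [h2, this] at h3
        simpa using h3
    exact h1
  · intro z hz h0
    rcases lt_or_gt_of_ne h0 with h | h
    · have h1 : DifferentiableAt ℂ (fun z => conj (f (conj z))) z := by
        have := (hd (conj z) (hsymm z hz) (by simpa using h)).conj_conj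
        simpa [Function.comp_def] using this
      refine h1.congr_of_eventuallyEq ?_
      filter_upwards [(isOpen_lt continuous_im continuous_const).mem_nhds h] with w hw
      rw [if_neg (not_le.2 hw)]
    · refine (hd z hz h).congr_of_eventuallyEq ?_
      filter_upwards [(isOpen_lt continuous_const continuous_im).mem_nhds h] with w hw
      rw [if_pos (le_of_lt hw)]

open Complex in
-- Borel–Carathéodory for -i(f - f(c)), whose real part is at most 2ε; at half the radius its factor
-- 2‖z - c‖/(R - ‖z - c‖) is at most 2.
theorem norm_sub_le_of_abs_im_le {f : ℂ → ℂ} {c z : ℂ} {R ε : ℝ}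
    (hf : DifferentiableOn ℂ f (Metric.ball c R)) (hε : 0 < ε)
    (him : ∀ w ∈ Metric.ball c R, |(f w).im| ≤ ε) (hz : ‖z - c‖ ≤ R / 2) (hR : 0 < R) :
    ‖f z - f c‖ ≤ 4 * ε := by
  set g : ℂ → ℂ := fun w => -I * (f (c + w) - f c) with hg
  have hmaps : MapsTo (fun w => c + w) (Metric.ball 0 R) (Metric.ball c R) := fun w hw => by
    simpa [dist_eq_norm] using hw
  have hgd : DifferentiableOn ℂ g (Metric.ball 0 R) :=
    (((hf.comp (by fun_prop) hmaps)).sub_const (f c)).const_mul (-I)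
  have hc : c ∈ Metric.ball c R := Metric.mem_ball_self hR
  have hre : MapsTo g (Metric.ball 0 R) {w | w.re ≤ 2 * ε} := by
    intro w hw
    have h1 := abs_le.1 (him _ (hmaps hw))
    have h2 := abs_le.1 (him _ hc)
    simp only [hg, mem_ofPred_eq, neg_mul, neg_re, mul_re, I_re, zero_mul, I_im, one_mul, sub_im,
      zero_sub, neg_neg]
    linarith [h1.2, h2.1]
  have hzb : z - c ∈ Metric.ball (0 : ℂ) R := by
    rw [mem_ball_zero_iff]; linarith
  have := borelCaratheodory_zero (by positivity) hgd hre hR hzb (by simp [hg])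
  have h3 : ‖g (z - c)‖ = ‖f z - f c‖ := by simp [hg]
  rw [h3] at this
  refine this.trans ?_
  rw [div_le_iff₀ (by linarith)]
  nlinarith

/-! ### Phragmén–Lindelöf and reflection in a half strip. -/

/-- The closed half strip `Re ζ ≤ -X`, `0 ≤ Im ζ ≤ π`. -/
def halfStrip (X : ℝ) : Set ℂ := {ζ | ζ.re ≤ -X ∧ 0 ≤ ζ.im ∧ ζ.im ≤ Real.pi}

theorem halfStrip_subset {X Y : ℝ} (h : X ≤ Y) : halfStrip Y ⊆ halfStrip X :=
  fun _ hz => ⟨hz.1.trans (neg_le_neg h), hz.2⟩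

theorem convex_halfStrip (X : ℝ) : Convex ℝ (halfStrip X) :=
  (convex_halfSpace_re_le _).inter
    ((convex_halfSpace_im_ge _).inter (convex_halfSpace_im_le _))

theorem ofReal_neg_mem_halfStrip {X Y : ℝ} (h : X ≤ Y) : ((-Y : ℝ) : ℂ) ∈ halfStrip X :=
  ⟨by simpa using h, by simp, by simpa using Real.pi_pos.le⟩

/-- `G` is continuous on the closed half strip and holomorphic in its interior. -/
structure HoloOnHalfStrip (G : ℂ → ℂ) (X : ℝ) : Prop where
  continuousOn : ContinuousOn G (halfStrip X)
  differentiableAt : ∀ ζ : ℂ, ζ.re < -X → 0 < ζ.im → ζ.im < Real.pi → DifferentiableAt ℂ G ζ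

theorem HoloOnHalfStrip.mono {G : ℂ → ℂ} {X Y : ℝ} (hG : HoloOnHalfStrip G X) (h : X ≤ Y) :
    HoloOnHalfStrip G Y :=
  ⟨hG.continuousOn.mono (halfStrip_subset h),
    fun ζ h1 h2 h3 => hG.differentiableAt ζ (h1.trans_le (neg_le_neg h)) h2 h3⟩

theorem HoloOnHalfStrip.neg {G : ℂ → ℂ} {X : ℝ} (hG : HoloOnHalfStrip G X) :
    HoloOnHalfStrip (fun ζ => -G ζ) X :=
  ⟨hG.continuousOn.neg, fun ζ h1 h2 h3 => (hG.differentiableAt ζ h1 h2 h3).neg⟩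

open Complex ComplexConjugate in
/-- The function obtained by exchanging the two edges of the strip. -/
theorem HoloOnHalfStrip.flip {G : ℂ → ℂ} {X : ℝ} (hG : HoloOnHalfStrip G X) :
    HoloOnHalfStrip (fun ζ => conj (G (conj ζ + Real.pi * I))) X := by
  refine ⟨continuous_conj.comp_continuousOn (hG.continuousOn.comp (by fun_prop) ?_), ?_⟩
  · intro ζ hζ
    refine ⟨by simpa using hζ.1, ?_, ?_⟩
    · simpa using hζ.2.2
    · simpa using hζ.2.1
  · intro ζ h1 h2 h3
    have h := hG.differentiableAt (conj ζ + Real.pi * I) (by simpa using h1) (by simpa using h3)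
      (by simpa using h2)
    have h4 : DifferentiableAt ℂ (fun w => G (w + Real.pi * I)) (conj ζ) :=
      DifferentiableAt.comp (conj ζ) (g := G) (f := fun w => w + Real.pi * I) h
        (by fun_prop)
    have := h4.conj_conj
    simpa [Function.comp_def] using this

open Complex in
theorem re_exp_half_strip (ζ : ℂ) (X : ℝ) :
    (exp ((ζ + X - I * (Real.pi / 2)) / 2)).re =
      Real.exp ((ζ.re + X) / 2) * Real.cos ((ζ.im - Real.pi / 2) / 2) := by
  rw [exp_re]
  congr 2 <;> simp [div_ofNat_re, div_ofNat_im]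

open Complex in
theorem re_exp_neg_half_strip (ζ : ℂ) (X : ℝ) :
    (exp (-((ζ + X - I * (Real.pi / 2)) / 2))).re =
      Real.exp (-((ζ.re + X) / 2)) * Real.cos ((ζ.im - Real.pi / 2) / 2) := by
  rw [exp_re]
  congr 1
  · congr 1
    simp [div_ofNat_re]
  · rw [neg_im, Real.cos_neg]
    congr 1
    simp [div_ofNat_im]

theorem half_le_cos_strip {y : ℝ} (h0 : 0 ≤ y) (h1 : y ≤ Real.pi) :
    1 / 2 ≤ Real.cos ((y - Real.pi / 2) / 2) := by
  rw [← Real.cos_pi_div_three, ← Real.cos_abs ((y - Real.pi / 2) / 2)]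
  refine Real.cos_le_cos_of_nonneg_of_le_pi (abs_nonneg _) ?_ ?_
  · linarith [Real.pi_pos]
  · rw [abs_le]; constructor <;> linarith [Real.pi_pos]

open Complex in
-- Phragmén–Lindelöf. The harmonic barrier Re exp((ζ + X - iπ/2)/2) is at least 1/2 on the end Re ζ
-- = -X, so 2M times it controls G there; ε times the barrier with the opposite exponent controls G
-- far to the left, and then ε tends to 0.
theorem HoloOnHalfStrip.im_le {G : ℂ → ℂ} {X m M : ℝ} (hG : HoloOnHalfStrip G X) (hm0 : 0 ≤ m)
    (hM0 : 0 ≤ M) (hM : ∀ ζ ∈ halfStrip X, (G ζ).im ≤ M)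
    (hm : ∀ ζ ∈ halfStrip X, ζ.im = 0 ∨ ζ.im = Real.pi → (G ζ).im ≤ m) :
    ∀ ζ ∈ halfStrip X, (G ζ).im ≤ m + 2 * M * Real.exp ((ζ.re + X) / 2) := by
  intro ζ hζ
  have key : ∀ ε > 0, (G ζ).im ≤ m + 2 * M * (exp ((ζ + X - I * (Real.pi / 2)) / 2)).re +
      ε * (exp (-((ζ + X - I * (Real.pi / 2)) / 2))).re := by
    intro ε hε
    -- The cosine factor of the barrier is only known to be at least 1/2, hence 2M instead of M.
    obtain ⟨T, hT1, hT2⟩ : ∃ T : ℝ, -ζ.re ≤ T ∧ 2 * M ≤ ε * Real.exp ((T - X) / 2) := by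
      have : Tendsto (fun T : ℝ => ε * Real.exp ((T - X) / 2)) atTop atTop := by
        refine Tendsto.const_mul_atTop hε (Real.tendsto_exp_atTop.comp ?_)
        exact (tendsto_atTop_add_const_right _ (-X) tendsto_id).atTop_div_const (by norm_num)
      obtain ⟨T, h1, h2⟩ := ((eventually_ge_atTop (-ζ.re)).and
        (this.eventually_ge_atTop (2 * M))).exists
      exact ⟨T, h1, h2⟩
    have hTX : -T ≤ -X := by linarith [hζ.1]
    -- log ‖F‖ is Im G minus the barriers, so the maximum modulus principle for F is the maximum
    -- principle for this difference.
    set F : ℂ → ℂ := fun w => exp (-I * G w - 2 * M * exp ((w + X - I * (Real.pi / 2)) / 2) -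
      ε * exp (-((w + X - I * (Real.pi / 2)) / 2))) with hF
    have hFn : ∀ w, ‖F w‖ = Real.exp ((G w).im - 2 * M * (exp ((w + X - I * (Real.pi / 2)) / 2)).re -
      ε * (exp (-((w + X - I * (Real.pi / 2)) / 2))).re) := by
      intro w
      rw [hF]
      simp only [norm_exp]
      congr 1
      simp only [neg_mul, sub_re, neg_re, mul_re, I_re, zero_mul, I_im, one_mul, zero_sub, neg_neg,
        ofReal_re, ofReal_im, sub_zero, re_ofNat, im_ofNat, mul_im, add_zero, mul_zero]
    rcases hTX.eq_or_lt with hTX' | hTX'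
    · have h1 : ζ.re = -X := le_antisymm hζ.1 (by linarith)
      rw [re_exp_half_strip, re_exp_neg_half_strip, h1, neg_add_cancel]
      have h2 := half_le_cos_strip hζ.2.1 hζ.2.2
      simp only [zero_div, neg_zero, Real.exp_zero, one_mul]
      have := hM ζ hζ
      nlinarith
    · set U : Set ℂ := Ioo (-T) (-X) ×ℂ Ioo 0 Real.pi with hU
      have hclU : closure U = Icc (-T) (-X) ×ℂ Icc 0 Real.pi := by
        rw [hU, closure_reProdIm, closure_Ioo hTX'.ne, closure_Ioo Real.pi_pos.ne]
      have hUX : closure U ⊆ halfStrip X := by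
        rw [hclU]
        exact fun w hw => ⟨hw.1.2, hw.2.1, hw.2.2⟩
      have hdc : DiffContOnCl ℂ F U := by
        constructor
        · intro w hw
          have := hG.differentiableAt w hw.1.2 hw.2.1 hw.2.2
          exact DifferentiableAt.differentiableWithinAt (by fun_prop)
        · have := hG.continuousOn.mono hUX
          fun_prop
      have hfr : ∀ w ∈ frontier U, ‖F w‖ ≤ Real.exp m := by
        intro w hw
        have hwX : w ∈ halfStrip X := hUX (frontier_subset_closure hw)
        rw [hFn, Real.exp_le_exp, re_exp_half_strip, re_exp_neg_half_strip]
        have h2 := half_le_cos_strip hwX.2.1 hwX.2.2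
        have e1 := Real.exp_pos ((w.re + X) / 2)
        have e2 := Real.exp_pos (-((w.re + X) / 2))
        have p1 : 0 ≤ 2 * M * (Real.exp ((w.re + X) / 2) * Real.cos ((w.im - Real.pi / 2) / 2)) :=
          mul_nonneg (by linarith) (mul_nonneg e1.le (by linarith))
        have p2 : 0 ≤ ε * (Real.exp (-((w.re + X) / 2)) * Real.cos ((w.im - Real.pi / 2) / 2)) :=
          mul_nonneg hε.le (mul_nonneg e2.le (by linarith))
        have hwM := hM w hwX
        rw [hU, frontier_reProdIm, closure_Ioo hTX'.ne, closure_Ioo Real.pi_pos.ne,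
          frontier_Ioo hTX', frontier_Ioo Real.pi_pos] at hw
        rcases hw with ⟨-, hw⟩ | ⟨hw, -⟩
        · have := hm w hwX hw
          linarith
        · have hw' : w.re = -T ∨ w.re = -X := hw
          rcases hw' with h | h
          · rw [h] at p1 p2 ⊢
            have h3 : -((-T + X) / 2) = (T - X) / 2 := by ring
            rw [h3] at p2 ⊢
            have : M ≤ ε * (Real.exp ((T - X) / 2) * Real.cos ((w.im - Real.pi / 2) / 2)) := by
              rw [← mul_assoc]
              nlinarith [mul_pos hε (Real.exp_pos ((T - X) / 2))]
            linarith
          · rw [h, neg_add_cancel] at p1 p2 ⊢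
            simp only [zero_div, neg_zero, Real.exp_zero, one_mul] at p1 p2 ⊢
            nlinarith
      have hζU : ζ ∈ closure U := by
        rw [hclU]
        exact ⟨⟨by linarith, hζ.1⟩, hζ.2.1, hζ.2.2⟩
      have hbd : Bornology.IsBounded U :=
        (Metric.isBounded_Ioo _ _).reProdIm (Metric.isBounded_Ioo _ _)
      have := norm_le_of_forall_mem_frontier_norm_le hbd hdc hfr hζU
      rw [hFn, Real.exp_le_exp] at this
      linarith
  have hlim : (G ζ).im ≤ m + 2 * M * (exp ((ζ + X - I * (Real.pi / 2)) / 2)).re := by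
    refine le_of_forall_pos_le_add fun δ hδ => ?_
    set E := (exp (-((ζ + X - I * (Real.pi / 2)) / 2))).re
    have h1 := key (δ / (|E| + 1)) (by positivity)
    have h2 : δ / (|E| + 1) * E ≤ δ := by
      rw [div_mul_eq_mul_div, div_le_iff₀ (by positivity)]
      nlinarith [le_abs_self E]
    linarith
  refine hlim.trans ?_
  rw [re_exp_half_strip]
  have := Real.cos_le_one ((ζ.im - Real.pi / 2) / 2)
  have e := Real.exp_pos ((ζ.re + X) / 2)
  gcongr
  nlinarith

theorem HoloOnHalfStrip.abs_im_le {G : ℂ → ℂ} {X m M : ℝ} (hG : HoloOnHalfStrip G X) (hm0 : 0 ≤ m)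
    (hM0 : 0 ≤ M) (hM : ∀ ζ ∈ halfStrip X, |(G ζ).im| ≤ M)
    (hm : ∀ ζ ∈ halfStrip X, ζ.im = 0 ∨ ζ.im = Real.pi → |(G ζ).im| ≤ m) :
    ∀ ζ ∈ halfStrip X, |(G ζ).im| ≤ m + 2 * M * Real.exp ((ζ.re + X) / 2) := by
  intro ζ hζ
  have h1 := hG.im_le hm0 hM0 (fun w hw => (abs_le.1 (hM w hw)).2)
    (fun w hw h => (abs_le.1 (hm w hw h)).2) ζ hζ
  have h2 := hG.neg.im_le hm0 hM0
    (fun w hw => by simpa using neg_le.1 (abs_le.1 (hM w hw)).1)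
    (fun w hw h => by simpa using neg_le.1 (abs_le.1 (hm w hw h)).1) ζ hζ
  rw [Complex.neg_im] at h2
  exact abs_le.2 ⟨by linarith, h1⟩

open Complex ComplexConjugate in
-- Reflection in the bottom edge gives a function holomorphic for |Im ζ| < π. As 2 + 1 < π, it is
-- defined on the whole unit disc about ζ, and smallness of its imaginary part bounds the
-- oscillation.
theorem HoloOnHalfStrip.norm_sub_le_of_bottom {G : ℂ → ℂ} {X ε : ℝ} (hG : HoloOnHalfStrip G X)
    (hε : 0 < ε) (h0 : ∀ ζ ∈ halfStrip X, ζ.im = 0 → (G ζ).im = 0)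
    (him : ∀ ζ ∈ halfStrip X, |(G ζ).im| ≤ ε) {ζ ζ' : ℂ} (hζ : ζ ∈ halfStrip (X + 1))
    (hζ2 : ζ.im ≤ 2) (hζ' : ζ' ∈ halfStrip X) (hd : ‖ζ' - ζ‖ ≤ 1 / 2) :
    ‖G ζ' - G ζ‖ ≤ 4 * ε := by
  set S : Set ℂ := {w | w.re < -X ∧ |w.im| < Real.pi} with hS
  have hSo : IsOpen S := (isOpen_lt continuous_re continuous_const).inter
    (isOpen_lt (continuous_abs.comp continuous_im) continuous_const)
  have hsub : S ∩ {z | 0 ≤ z.im} ⊆ halfStrip X := fun w hw =>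
    ⟨hw.1.1.le, hw.2, (le_abs_self _).trans hw.1.2.le⟩
  have hrefl := differentiableOn_reflection hSo (f := G) (fun z hz => by simpa [hS] using hz)
    (hG.continuousOn.mono hsub)
    (fun z hz h => hG.differentiableAt z hz.1 h ((le_abs_self _).trans_lt hz.2))
    (fun z hz h => h0 z (hsub ⟨hz, h.ge⟩) h)
  have hball : Metric.ball ζ 1 ⊆ S := by
    intro w hw
    rw [Metric.mem_ball, dist_eq_norm] at hw
    have h1 := (abs_le.1 ((abs_re_le_norm (w - ζ)))).2
    have h2 := abs_le.1 ((abs_im_le_norm (w - ζ)))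
    have h3 := hζ.1
    have h4 := hζ.2.1
    rw [sub_re] at h1
    rw [sub_im] at h2
    refine ⟨by linarith, ?_⟩
    rw [abs_lt]
    constructor <;> linarith [Real.pi_gt_three, h2.1, h2.2]
  set g : ℂ → ℂ := fun z => if 0 ≤ z.im then G z else conj (G (conj z)) with hg
  have hgim : ∀ w ∈ Metric.ball ζ 1, |(g w).im| ≤ ε := by
    intro w hw
    have hwS := hball hw
    rcases le_or_gt 0 w.im with h | h
    · rw [hg]; simp only [if_pos h]
      exact him w (hsub ⟨hwS, h⟩)
    · rw [hg]; simp only [if_neg (not_le.2 h)]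
      rw [conj_im, abs_neg]
      refine him _ (hsub ⟨by simpa [hS] using hwS, ?_⟩)
      simpa using h.le
  have := norm_sub_le_of_abs_im_le (hrefl.mono hball) hε hgim (z := ζ') hd one_pos
  simpa [hg, hζ.2.1, hζ'.2.1] using this

open Complex ComplexConjugate in
-- The bottom estimate, applied after exchanging the edges by ζ ↦ conj ζ + πi.
theorem HoloOnHalfStrip.norm_sub_le_of_top {G : ℂ → ℂ} {X ε : ℝ} (hG : HoloOnHalfStrip G X)
    (hε : 0 < ε) (h0 : ∀ ζ ∈ halfStrip X, ζ.im = Real.pi → (G ζ).im = 0)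
    (him : ∀ ζ ∈ halfStrip X, |(G ζ).im| ≤ ε) {ζ ζ' : ℂ} (hζ : ζ ∈ halfStrip (X + 1))
    (hζ2 : Real.pi - 2 ≤ ζ.im) (hζ' : ζ' ∈ halfStrip X) (hd : ‖ζ' - ζ‖ ≤ 1 / 2) :
    ‖G ζ' - G ζ‖ ≤ 4 * ε := by
  have hmem : ∀ {Y : ℝ} {w : ℂ}, w ∈ halfStrip Y → conj w + Real.pi * I ∈ halfStrip Y := by
    intro Y w hw
    refine ⟨by simpa using hw.1, ?_, ?_⟩
    · simpa using hw.2.2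
    · simpa using hw.2.1
  have hinv : ∀ w : ℂ, conj (conj w + Real.pi * I) + Real.pi * I = w := by
    intro w; simp
  have := hG.flip.norm_sub_le_of_bottom hε
    (fun w hw h => by rw [conj_im, h0 _ (hmem hw) (by simp [h]), neg_zero])
    (fun w hw => by rw [conj_im, abs_neg]; exact him _ (hmem hw)) (hmem hζ)
    (by simp; linarith) (hmem hζ') (by
      have : conj ζ' + Real.pi * I - (conj ζ + Real.pi * I) = conj (ζ' - ζ) := by simp
      rw [this, norm_conj]; exact hd)
  rwa [hinv, hinv, ← map_sub, norm_conj] at this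

/-- Subdividing a segment. -/
theorem norm_sub_le_of_convex {D : ℂ → ℂ} {S : Set ℂ} (hS : Convex ℝ S) {κ : ℝ}
    (hD : ∀ ζ ∈ S, ∀ ζ' ∈ S, ‖ζ' - ζ‖ ≤ 1 / 2 → ‖D ζ' - D ζ‖ ≤ κ) (N : ℕ) :
    ∀ ζ ∈ S, ∀ ζ' ∈ S, ‖ζ' - ζ‖ ≤ N / 2 → ‖D ζ' - D ζ‖ ≤ N * κ := by
  induction N with
  | zero =>
    intro ζ _ ζ' _ h
    have : ζ' = ζ := by
      rw [← sub_eq_zero, ← norm_le_zero_iff]; simpa using h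
    simp [this]
  | succ N ih =>
    intro ζ hζ ζ' hζ' h
    have hN : (0 : ℝ) < N + 1 := by positivity
    set ξ : ℂ := ζ + ((N / (N + 1) : ℝ) : ℂ) * (ζ' - ζ) with hξ
    have hξS : ξ ∈ S := by
      have := hS.add_smul_sub_mem hζ hζ' (t := (N / (N + 1) : ℝ))
        ⟨by positivity, by rw [div_le_one hN]; linarith⟩
      simpa [hξ] using this
    push_cast at h
    have h1 : ‖ξ - ζ‖ ≤ N / 2 := by
      rw [hξ, add_sub_cancel_left, norm_mul, Complex.norm_real, Real.norm_eq_abs,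
        abs_of_nonneg (by positivity), div_mul_eq_mul_div, div_le_iff₀ hN]
      have : (0 : ℝ) ≤ N := by positivity
      nlinarith
    have h2 : ‖ζ' - ξ‖ ≤ 1 / 2 := by
      have : ζ' - ξ = ((1 / (N + 1) : ℝ) : ℂ) * (ζ' - ζ) := by
        rw [hξ]
        have : (N : ℂ) + 1 ≠ 0 := by exact_mod_cast hN.ne'
        push_cast
        field_simp
        ring
      rw [this, norm_mul, Complex.norm_real, Real.norm_eq_abs, abs_of_nonneg (by positivity),
        div_mul_eq_mul_div, div_le_iff₀ hN]
      linarith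
    have h3 := ih ζ hζ ξ hξS h1
    have h4 := hD ξ hξS ζ' hζ' h2
    calc ‖D ζ' - D ζ‖ = ‖(D ζ' - D ξ) + (D ξ - D ζ)‖ := by ring_nf
      _ ≤ κ + N * κ := (norm_add_le _ _).trans (add_le_add h4 h3)
      _ = ((N + 1 : ℕ) : ℝ) * κ := by push_cast; ring

/-! ### Almost affine functions on a half strip. -/

/-- A function on a half strip that is almost affine: `Φ` tends to `-∞` at the end of the strip and
its imaginary part is constant on both edges, up to holomorphic corrections `ℓ₁`, `ℓ₂` of
`exp Φ`. -/
structure CornerData (Φ ℓ₁ ℓ₂ : ℂ → ℂ) (X₀ B C r a b : ℝ) : Prop where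
  holo : HoloOnHalfStrip Φ X₀
  re_le : ∀ K : ℝ, ∃ X : ℝ, ∀ ζ ∈ halfStrip X, (Φ ζ).re ≤ K
  im_le : ∀ ζ ∈ halfStrip X₀, |(Φ ζ).im| ≤ B
  norm_exp_lt : ∀ ζ ∈ halfStrip X₀, ‖Complex.exp (Φ ζ)‖ < r
  C_nonneg : 0 ≤ C
  diff₁ : DifferentiableOn ℂ ℓ₁ (Metric.ball 0 r)
  diff₂ : DifferentiableOn ℂ ℓ₂ (Metric.ball 0 r)
  le₁ : ∀ z ∈ Metric.ball (0 : ℂ) r, ‖ℓ₁ z‖ ≤ C * ‖z‖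
  le₂ : ∀ z ∈ Metric.ball (0 : ℂ) r, ‖ℓ₂ z‖ ≤ C * ‖z‖
  bottom : ∀ ζ ∈ halfStrip X₀, ζ.im = 0 → (Φ ζ + ℓ₁ (Complex.exp (Φ ζ))).im = a
  top : ∀ ζ ∈ halfStrip X₀, ζ.im = Real.pi → (Φ ζ + ℓ₂ (Complex.exp (Φ ζ))).im = b

namespace CornerData

variable {Φ ℓ₁ ℓ₂ : ℂ → ℂ} {X₀ B C r a b : ℝ}

theorem mem_ball (h : CornerData Φ ℓ₁ ℓ₂ X₀ B C r a b) {ζ : ℂ} (hζ : ζ ∈ halfStrip X₀) :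
    Complex.exp (Φ ζ) ∈ Metric.ball (0 : ℂ) r :=
  mem_ball_zero_iff.2 (h.norm_exp_lt ζ hζ)

theorem holo_correct (h : CornerData Φ ℓ₁ ℓ₂ X₀ B C r a b) {ℓ : ℂ → ℂ}
    (hℓ : DifferentiableOn ℂ ℓ (Metric.ball 0 r)) (μ : ℝ) :
    HoloOnHalfStrip (fun ζ => Φ ζ + ℓ (Complex.exp (Φ ζ)) - μ * ζ - a * Complex.I) X₀ := by
  constructor
  · have h1 := h.holo.continuousOn
    have h2 : ContinuousOn (fun ζ => ℓ (Complex.exp (Φ ζ))) (halfStrip X₀) :=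
      hℓ.continuousOn.comp (Complex.continuous_exp.comp_continuousOn h1) fun ζ hζ => h.mem_ball hζ
    have h3 : ContinuousOn (fun ζ : ℂ => (μ : ℂ) * ζ) (halfStrip X₀) := by fun_prop
    exact ((h1.add h2).sub h3).sub continuousOn_const
  · intro ζ h1 h2 h3
    have hd := h.holo.differentiableAt ζ h1 h2 h3
    have hb : Complex.exp (Φ ζ) ∈ Metric.ball (0 : ℂ) r := h.mem_ball ⟨h1.le, h2.le, h3.le⟩
    have h4 : DifferentiableAt ℂ (fun ζ => ℓ (Complex.exp (Φ ζ))) ζ :=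
      DifferentiableAt.comp ζ (g := ℓ) (f := fun ζ => Complex.exp (Φ ζ))
        (hℓ.differentiableAt (Metric.isOpen_ball.mem_nhds hb)) (by fun_prop)
    have h5 : DifferentiableAt ℂ (fun ζ : ℂ => (μ : ℂ) * ζ) ζ := by fun_prop
    exact ((hd.add h4).sub h5).sub_const _

/-- On the bottom edge the imaginary part equals Im ℓ - Im ℓ₁ and on the top edge, since μπ = b - a,
it equals Im ℓ - Im ℓ₂. Both are at most 2Cη, and Phragmén–Lindelöf carries the bound inside. -/
theorem abs_im_correct_le (h : CornerData Φ ℓ₁ ℓ₂ X₀ B C r a b) {ℓ : ℂ → ℂ}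
    (hℓ : DifferentiableOn ℂ ℓ (Metric.ball 0 r))
    (hℓC : ∀ z ∈ Metric.ball (0 : ℂ) r, ‖ℓ z‖ ≤ C * ‖z‖) {μ : ℝ} (hμ : μ * Real.pi = b - a)
    {X η : ℝ} (hX : X₀ ≤ X) (hη : ∀ ζ ∈ halfStrip X, ‖Complex.exp (Φ ζ)‖ ≤ η) :
    ∀ ζ ∈ halfStrip X, |(Φ ζ + ℓ (Complex.exp (Φ ζ)) - μ * ζ - a * Complex.I).im| ≤
      2 * C * η + 2 * (B + C * r + |μ| * Real.pi + |a|) * Real.exp ((ζ.re + X) / 2) := by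
  have hsub := halfStrip_subset hX
  have hη0 : 0 ≤ η := (norm_nonneg _).trans (hη _ (ofReal_neg_mem_halfStrip le_rfl))
  have hr0 : 0 ≤ r := (norm_nonneg _).trans
    (h.norm_exp_lt _ (ofReal_neg_mem_halfStrip le_rfl)).le
  have hB0 : 0 ≤ B := (abs_nonneg _).trans (h.im_le _ (ofReal_neg_mem_halfStrip le_rfl))
  have hC := h.C_nonneg
  have hπ := Real.pi_pos
  have him : ∀ ζ, (Φ ζ + ℓ (Complex.exp (Φ ζ)) - μ * ζ - a * Complex.I).im =
      (Φ ζ).im + (ℓ (Complex.exp (Φ ζ))).im - μ * ζ.im - a := fun ζ => by simp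
  have hsmall : ∀ {ℓ' : ℂ → ℂ}, (∀ z ∈ Metric.ball (0 : ℂ) r, ‖ℓ' z‖ ≤ C * ‖z‖) →
      ∀ ζ ∈ halfStrip X, |(ℓ' (Complex.exp (Φ ζ))).im| ≤ C * η := fun hℓ' ζ hζ =>
    (Complex.abs_im_le_norm _).trans ((hℓ' _ (h.mem_ball (hsub hζ))).trans
      (mul_le_mul_of_nonneg_left (hη ζ hζ) hC))
  refine HoloOnHalfStrip.abs_im_le ((h.holo_correct hℓ μ).mono hX) (by positivity)
    (by positivity) ?_ ?_
  · intro ζ hζ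
    rw [him]
    have h1 := abs_le.1 (h.im_le ζ (hsub hζ))
    have h2 : |(ℓ (Complex.exp (Φ ζ))).im| ≤ C * r :=
      (Complex.abs_im_le_norm _).trans ((hℓC _ (h.mem_ball (hsub hζ))).trans
      (mul_le_mul_of_nonneg_left (h.norm_exp_lt ζ (hsub hζ)).le hC))
    have h3 : |μ * ζ.im| ≤ |μ| * Real.pi := by
      rw [abs_mul, abs_of_nonneg hζ.2.1]
      exact mul_le_mul_of_nonneg_left hζ.2.2 (abs_nonneg _)
    have h2' := abs_le.1 h2
    have h3' := abs_le.1 h3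
    have h4 := abs_le.1 (le_refl |a|)
    rw [abs_le]
    constructor <;> linarith [h1.1, h1.2, h2'.1, h2'.2, h3'.1, h3'.2, h4.1, h4.2]
  · rintro ζ hζ h0
    rw [him]
    have e := abs_le.1 (hsmall hℓC ζ hζ)
    rcases h0 with h0 | h0
    · have e1 := abs_le.1 (hsmall h.le₁ ζ hζ)
      have := h.bottom ζ (hsub hζ) h0
      rw [Complex.add_im] at this
      rw [h0, abs_le]
      constructor <;> linarith [e.1, e.2, e1.1, e1.2]
    · have e1 := abs_le.1 (hsmall h.le₂ ζ hζ)
      have := h.top ζ (hsub hζ) h0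
      rw [Complex.add_im] at this
      rw [h0, abs_le]
      constructor <;> linarith [e.1, e.2, e1.1, e1.2]

/-- The correction ℓ₁ makes the imaginary part vanish on the bottom edge, ℓ₂ on the top edge; the
one belonging to the edge near ζ is used, so that reflection applies. Removing the correction again
costs 2Cη, whence 10 = 4·2 + 2. -/
theorem norm_sub_le (h : CornerData Φ ℓ₁ ℓ₂ X₀ B C r a b) {μ : ℝ} (hμ : μ * Real.pi = b - a)
    {X Y η : ℝ} (hX : X₀ ≤ X) (hXY : X ≤ Y) (hη : ∀ ζ ∈ halfStrip X, ‖Complex.exp (Φ ζ)‖ ≤ η) :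
    ∀ ζ ∈ halfStrip (Y + 1), ∀ ζ' ∈ halfStrip (Y + 1), ‖ζ' - ζ‖ ≤ 1 / 2 →
      ‖(Φ ζ' - μ * ζ') - (Φ ζ - μ * ζ)‖ ≤
        10 * C * η + 8 * (B + C * r + |μ| * Real.pi + |a| + 1) * Real.exp ((X - Y) / 2) := by
  intro ζ hζ ζ' hζ' hd
  have hη0 : 0 ≤ η := (norm_nonneg _).trans (hη _ (ofReal_neg_mem_halfStrip le_rfl))
  have hr0 : 0 ≤ r := (norm_nonneg _).trans
    (h.norm_exp_lt _ (ofReal_neg_mem_halfStrip le_rfl)).le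
  have hB0 : 0 ≤ B := (abs_nonneg _).trans (h.im_le _ (ofReal_neg_mem_halfStrip le_rfl))
  have hC := h.C_nonneg
  have hπ := Real.pi_pos
  set M := B + C * r + |μ| * Real.pi + |a| with hM
  have hM0 : 0 ≤ M := by positivity
  set ε := 2 * C * η + 2 * (M + 1) * Real.exp ((X - Y) / 2) with hε
  have hε0 : 0 < ε := by positivity
  have key : ∀ {ℓ : ℂ → ℂ}, (∀ z ∈ Metric.ball (0 : ℂ) r, ‖ℓ z‖ ≤ C * ‖z‖) →
      ‖(Φ ζ' + ℓ (Complex.exp (Φ ζ')) - μ * ζ' - a * Complex.I) -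
        (Φ ζ + ℓ (Complex.exp (Φ ζ)) - μ * ζ - a * Complex.I)‖ ≤ 4 * ε →
      ‖(Φ ζ' - μ * ζ') - (Φ ζ - μ * ζ)‖ ≤ 10 * C * η + 8 * (M + 1) * Real.exp ((X - Y) / 2) := by
    intro ℓ hℓ h1
    have hs : ∀ w ∈ halfStrip (Y + 1), ‖ℓ (Complex.exp (Φ w))‖ ≤ C * η := fun w hw =>
      (hℓ _ (h.mem_ball (halfStrip_subset (by linarith) hw))).trans
        (mul_le_mul_of_nonneg_left (hη w (halfStrip_subset (by linarith) hw)) hC)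
    calc ‖(Φ ζ' - μ * ζ') - (Φ ζ - μ * ζ)‖ = ‖((Φ ζ' + ℓ (Complex.exp (Φ ζ')) - μ * ζ' -
        a * Complex.I) - (Φ ζ + ℓ (Complex.exp (Φ ζ)) - μ * ζ - a * Complex.I)) -
        ℓ (Complex.exp (Φ ζ')) + ℓ (Complex.exp (Φ ζ))‖ := by ring_nf
      _ ≤ 4 * ε + C * η + C * η := (norm_add_le _ _).trans (add_le_add
        ((_root_.norm_sub_le _ _).trans (add_le_add h1 (hs _ hζ'))) (hs _ hζ))
      _ = _ := by rw [hε]; ring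
  have hb : ∀ {ℓ : ℂ → ℂ}, DifferentiableOn ℂ ℓ (Metric.ball 0 r) →
      (∀ z ∈ Metric.ball (0 : ℂ) r, ‖ℓ z‖ ≤ C * ‖z‖) → ∀ ζ ∈ halfStrip Y,
      |(Φ ζ + ℓ (Complex.exp (Φ ζ)) - μ * ζ - a * Complex.I).im| ≤ ε := by
    intro ℓ hℓ hℓC w hw
    refine (h.abs_im_correct_le hℓ hℓC hμ hX hη w (halfStrip_subset hXY hw)).trans ?_
    rw [hε, ← hM]
    have : Real.exp ((w.re + X) / 2) ≤ Real.exp ((X - Y) / 2) := by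
      rw [Real.exp_le_exp]; linarith [hw.1]
    gcongr
    linarith
  have hYsub : halfStrip Y ⊆ halfStrip X₀ := halfStrip_subset (hX.trans hXY)
  have hY1 : halfStrip (Y + 1) ⊆ halfStrip Y := halfStrip_subset (by linarith)
  -- Because π < 4, every point satisfies Im ζ ≤ 2 or Im ζ ≥ π - 2.
  rcases le_total ζ.im 2 with h2 | h2
  · refine key h.le₁ (((h.holo_correct h.diff₁ μ).mono (hX.trans hXY)).norm_sub_le_of_bottom hε0
      ?_ (hb h.diff₁ h.le₁) hζ h2 (hY1 hζ') hd)
    intro w hw h0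
    have := h.bottom w (hYsub hw) h0
    rw [Complex.add_im] at this
    simp [h0, this]
  · refine key h.le₂ (((h.holo_correct h.diff₂ μ).mono (hX.trans hXY)).norm_sub_le_of_top hε0
      ?_ (hb h.diff₂ h.le₂) hζ (by linarith [Real.pi_lt_four]) (hY1 hζ') hd)
    intro w hw h0
    have := h.top w (hYsub hw) h0
    rw [Complex.add_im] at this
    simp [h0, this, hμ]

theorem exists_norm_sub_le (h : CornerData Φ ℓ₁ ℓ₂ X₀ B C r a b) {μ : ℝ}
    (hμ : μ * Real.pi = b - a) {κ : ℝ} (hκ : 0 < κ) :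
    ∃ Y, X₀ ≤ Y ∧ 0 ≤ Y ∧ ∀ ζ ∈ halfStrip Y, ∀ ζ' ∈ halfStrip Y, ‖ζ' - ζ‖ ≤ 1 / 2 →
      ‖(Φ ζ' - μ * ζ') - (Φ ζ - μ * ζ)‖ ≤ κ := by
  have hC := h.C_nonneg
  set η := κ / (2 * (10 * C + 1)) with hη
  have hη0 : 0 < η := by positivity
  obtain ⟨X₁, hX₁⟩ := h.re_le (Real.log η)
  set X := max X₀ X₁
  have hX : ∀ ζ ∈ halfStrip X, ‖Complex.exp (Φ ζ)‖ ≤ η := by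
    intro ζ hζ
    rw [Complex.norm_exp, ← Real.exp_log hη0, Real.exp_le_exp]
    exact hX₁ ζ (halfStrip_subset (le_max_right _ _) hζ)
  set M := 8 * (B + C * r + |μ| * Real.pi + |a| + 1) with hM
  have hlim : Tendsto (fun Y : ℝ => M * Real.exp ((X - Y) / 2)) atTop (𝓝 (M * 0)) := by
    refine Tendsto.const_mul M (Real.tendsto_exp_atBot.comp ?_)
    refine Tendsto.atBot_div_const (by norm_num) ?_
    exact tendsto_atBot_add_const_left _ X tendsto_neg_atTop_atBot
  rw [mul_zero] at hlim
  obtain ⟨Y, ⟨h1, h2⟩, h3⟩ := (((eventually_ge_atTop X).and (eventually_ge_atTop 0)).and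
    (hlim.eventually (ge_mem_nhds (half_pos hκ)))).exists
  have hX0 : X₀ ≤ X := le_max_left _ _
  refine ⟨Y + 1, by linarith, by linarith, fun ζ hζ ζ' hζ' hd => ?_⟩
  refine (h.norm_sub_le hμ hX0 h1 hX ζ hζ ζ' hζ' hd).trans ?_
  have h4 : 10 * C * η ≤ κ / 2 := by
    rw [hη, mul_div_assoc', div_le_div_iff₀ (by positivity) (by norm_num)]
    nlinarith
  linarith

/-- Small increments over steps of length 1/2 add up to growth with an arbitrarily small slope κ: a
first, crude comparison of Φ with μζ. -/
theorem exists_norm_le (h : CornerData Φ ℓ₁ ℓ₂ X₀ B C r a b) {μ : ℝ}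
    (hμ : μ * Real.pi = b - a) {κ : ℝ} (hκ : 0 < κ) :
    ∃ Y A, X₀ ≤ Y ∧ 0 ≤ Y ∧ ∀ ζ ∈ halfStrip Y, ‖Φ ζ - μ * ζ‖ ≤ A + κ * |ζ.re| := by
  obtain ⟨Y, hY1, hY2, hY⟩ := h.exists_norm_sub_le hμ (half_pos hκ)
  set ζ₁ : ℂ := ((-Y : ℝ) : ℂ) with hζ₁
  have hζ₁m : ζ₁ ∈ halfStrip Y := ofReal_neg_mem_halfStrip le_rfl
  refine ⟨Y, ‖Φ ζ₁ - μ * ζ₁‖ + κ * (Y + Real.pi + 1), hY1, hY2, fun ζ hζ => ?_⟩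
  set N := ⌈2 * ‖ζ - ζ₁‖⌉₊ with hN
  have hN1 : 2 * ‖ζ - ζ₁‖ ≤ N := Nat.le_ceil _
  have hN2 : (N : ℝ) < 2 * ‖ζ - ζ₁‖ + 1 := Nat.ceil_lt_add_one (by positivity)
  have h1 := norm_sub_le_of_convex (convex_halfStrip Y) hY N ζ₁ hζ₁m ζ hζ (by linarith)
  have h2 : ‖ζ - ζ₁‖ ≤ |ζ.re| + Y + Real.pi := by
    refine (Complex.norm_le_abs_re_add_abs_im _).trans ?_
    have h3 : |(ζ - ζ₁).re| ≤ |ζ.re| + Y := by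
      rw [hζ₁, Complex.sub_re, Complex.ofReal_re]
      refine (abs_sub _ _).trans ?_
      rw [abs_neg, abs_of_nonneg hY2]
    have h4 : |(ζ - ζ₁).im| ≤ Real.pi := by
      rw [hζ₁, Complex.sub_im, Complex.ofReal_im, sub_zero, abs_of_nonneg hζ.2.1]
      exact hζ.2.2
    linarith
  have h5 : ‖Φ ζ - μ * ζ‖ ≤ ‖Φ ζ₁ - μ * ζ₁‖ + N * (κ / 2) := by
    have := norm_sub_norm_le (Φ ζ - μ * ζ) (Φ ζ₁ - μ * ζ₁)
    linarith
  nlinarith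

/-- If b < a, then μ < 0 and the crude comparison keeps Re Φ bounded below along the negative real
axis, although Re Φ tends to -∞. -/
theorem lt_of_ne (h : CornerData Φ ℓ₁ ℓ₂ X₀ B C r a b) (hab : a ≠ b) : a < b := by
  by_contra hlt
  have hlt' : b < a := lt_of_le_of_ne (not_lt.1 hlt) hab.symm
  have hπ := Real.pi_pos
  set μ := (b - a) / Real.pi with hμd
  have hμ : μ * Real.pi = b - a := by rw [hμd]; field_simp
  have hμ0 : μ < 0 := div_neg_of_neg_of_pos (by linarith) hπ
  obtain ⟨Y, A, hY1, hY2, hY⟩ := h.exists_norm_le hμ (κ := -μ / 2) (by linarith)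
  obtain ⟨X₁, hX₁⟩ := h.re_le (-A - 1)
  set T := max Y X₁
  have hT : 0 ≤ T := hY2.trans (le_max_left _ _)
  have h1 := hY _ (ofReal_neg_mem_halfStrip (le_max_left Y X₁))
  have h2 := hX₁ _ (ofReal_neg_mem_halfStrip (le_max_right Y X₁))
  have h3 := (abs_le.1 ((Complex.abs_re_le_norm _).trans h1)).1
  rw [Complex.sub_re, ← Complex.ofReal_mul, Complex.ofReal_re, Complex.ofReal_re, abs_neg,
    abs_of_nonneg hT] at h3
  nlinarith

/-- Bootstrap: the crude comparison with slope μ/2 gives ‖e^Φ‖ ≤ e^A e^{(μ/2) Re ζ}. This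
exponentially small η is fed back into `norm_sub_le` with Y = 2X. -/
theorem exists_exponential_bound (h : CornerData Φ ℓ₁ ℓ₂ X₀ B C r a b) {μ : ℝ}
    (hμ : μ * Real.pi = b - a) (hμ0 : 0 < μ) :
    ∃ c K X₁, 0 < c ∧ 0 ≤ K ∧ ∀ X, X₁ ≤ X → ∀ ζ ∈ halfStrip (2 * X + 1),
      ∀ ζ' ∈ halfStrip (2 * X + 1), ‖ζ' - ζ‖ ≤ 1 / 2 →
        ‖(Φ ζ' - μ * ζ') - (Φ ζ - μ * ζ)‖ ≤ K * Real.exp (-(c * X)) := by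
  have hC := h.C_nonneg
  have hr0 : 0 ≤ r := (norm_nonneg _).trans
    (h.norm_exp_lt _ (ofReal_neg_mem_halfStrip le_rfl)).le
  have hB0 : 0 ≤ B := (abs_nonneg _).trans (h.im_le _ (ofReal_neg_mem_halfStrip le_rfl))
  have hπ := Real.pi_pos
  obtain ⟨Y, A, hY1, hY2, hY⟩ := h.exists_norm_le hμ (half_pos hμ0)
  -- μ/2 is the decay rate of e^Φ, and 1/2 comes from the Phragmén–Lindelöf term exp((X - 2X)/2).
  set c := min (μ / 2) (1 / 2) with hc
  set M := B + C * r + |μ| * Real.pi + |a| + 1 with hM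
  have hM0 : 0 ≤ M := by positivity
  refine ⟨c, 10 * C * Real.exp A + 8 * M, Y, by positivity, by positivity,
    fun X hX ζ hζ ζ' hζ' hd => ?_⟩
  have hX0 : 0 ≤ X := hY2.trans hX
  have hη : ∀ w ∈ halfStrip X, ‖Complex.exp (Φ w)‖ ≤ Real.exp A * Real.exp (-(c * X)) := by
    intro w hw
    have h1 := (abs_le.1 ((Complex.abs_re_le_norm _).trans (hY w (halfStrip_subset hX hw)))).2
    have hw0 : w.re ≤ 0 := hw.1.trans (by linarith)
    rw [abs_of_nonpos hw0, Complex.sub_re, Complex.re_ofReal_mul] at h1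
    rw [Complex.norm_exp, ← Real.exp_add, Real.exp_le_exp]
    have h2 : c ≤ μ / 2 := min_le_left _ _
    have h3 := hw.1
    nlinarith
  refine (h.norm_sub_le hμ (hY1.trans hX) (by linarith) hη ζ hζ ζ' hζ' hd).trans ?_
  have h4 : Real.exp ((X - 2 * X) / 2) ≤ Real.exp (-(c * X)) := by
    rw [Real.exp_le_exp]
    have h2 : c ≤ 1 / 2 := min_le_right _ _
    nlinarith
  calc 10 * C * (Real.exp A * Real.exp (-(c * X))) + 8 * M * Real.exp ((X - 2 * X) / 2)
      ≤ 10 * C * (Real.exp A * Real.exp (-(c * X))) + 8 * M * Real.exp (-(c * X)) := by gcongr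
    _ = _ := by ring

/-- Asymptotics of almost affine functions at the end of a half strip. -/
theorem exists_limit (h : CornerData Φ ℓ₁ ℓ₂ X₀ B C r a b) {μ : ℝ}
    (hμ : μ * Real.pi = b - a) (hμ0 : 0 < μ) :
    ∃ c : ℂ, ∀ ε > 0, ∃ X, ∀ ζ ∈ halfStrip X, ‖Φ ζ - μ * ζ - c‖ ≤ ε := by
  obtain ⟨c, K, X₁, hc, hK, hinc⟩ := h.exists_exponential_bound hμ hμ0
  have hπ := Real.pi_lt_four
  set n₀ := ⌈X₁⌉₊
  have hn₀ : ∀ n : ℕ, X₁ ≤ ((n + n₀ : ℕ) : ℝ) := fun n => by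
    push_cast
    have := Nat.le_ceil X₁
    have : (0 : ℝ) ≤ n := by positivity
    linarith
  -- Consecutive sample points are 2 apart, hence 4 steps of length 1/2; the increments between them
  -- are dominated by a geometric series.
  set P : ℕ → ℂ := fun n => ((-(2 * ((n + n₀ : ℕ) : ℝ) + 1) : ℝ) : ℂ) with hP
  set D : ℂ → ℂ := fun ζ => Φ ζ - μ * ζ with hD
  have hPm : ∀ n, P n ∈ halfStrip (2 * ((n + n₀ : ℕ) : ℝ) + 1) := fun n =>
    ofReal_neg_mem_halfStrip le_rfl
  have hexp : ∀ n : ℕ, Real.exp (-(c * ((n + n₀ : ℕ) : ℝ))) ≤ Real.exp (-c) ^ n := by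
    intro n
    rw [← Real.exp_nat_mul, Real.exp_le_exp]
    push_cast
    have : 0 ≤ c * n₀ := by positivity
    nlinarith
  have hstep : ∀ (n N : ℕ), ∀ ζ ∈ halfStrip (2 * ((n + n₀ : ℕ) : ℝ) + 1), ‖ζ - P n‖ ≤ N / 2 →
      ‖D ζ - D (P n)‖ ≤ N * (K * Real.exp (-c) ^ n) := by
    intro n N ζ hζ hd
    refine (norm_sub_le_of_convex (convex_halfStrip _) (hinc _ (hn₀ n)) N _ (hPm n) ζ hζ hd).trans ?_
    have := hexp n
    gcongr
  have hlt : Real.exp (-c) < 1 := by rw [Real.exp_lt_one_iff]; linarith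
  have hcauchy : CauchySeq fun n => D (P n) := by
    refine cauchySeq_of_le_geometric (Real.exp (-c)) (4 * K) hlt fun n => ?_
    rw [dist_comm, dist_eq_norm]
    have := hstep n 4 (P (n + 1)) (halfStrip_subset (by push_cast; linarith) (hPm (n + 1))) ?_
    · refine this.trans (le_of_eq ?_); push_cast; ring
    · simp only [hP]
      rw [← Complex.ofReal_sub, Complex.norm_real, Real.norm_eq_abs, abs_le]
      push_cast
      constructor <;> linarith
  obtain ⟨c₀, hc₀⟩ := cauchySeq_tendsto_of_complete hcauchy
  refine ⟨c₀, fun ε hε => ?_⟩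
  have h1 : Tendsto (fun n : ℕ => ((12 : ℕ) : ℝ) * (K * Real.exp (-c) ^ n)) atTop (𝓝 0) := by
    have := (tendsto_pow_atTop_nhds_zero_of_lt_one (Real.exp_pos _).le hlt).const_mul K
    simpa using this.const_mul ((12 : ℕ) : ℝ)
  have h2 := h1.eventually (ge_mem_nhds (half_pos hε))
  have h3 : ∀ᶠ n in atTop, ‖D (P n) - c₀‖ ≤ ε / 2 := by
    filter_upwards [Metric.tendsto_nhds.1 hc₀ (ε / 2) (half_pos hε)] with n hn
    rw [← dist_eq_norm]; exact hn.le
  obtain ⟨N, hN⟩ := eventually_atTop.1 (h2.and h3)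
  refine ⟨2 * ((N + n₀ : ℕ) : ℝ) + 1, fun ζ hζ => ?_⟩
  obtain ⟨n, hn1, hn2⟩ : ∃ n : ℕ, 2 * ((n + n₀ : ℕ) : ℝ) + 1 ≤ -ζ.re ∧
      -ζ.re ≤ 2 * ((n + n₀ : ℕ) : ℝ) + 3 ∧ N ≤ n := by
    have h4 : 2 * ((N + n₀ : ℕ) : ℝ) + 1 ≤ -ζ.re := by linarith [hζ.1]
    have h5 : ((N + n₀ : ℕ) : ℝ) ≤ (-ζ.re - 1) / 2 := by linarith
    have h6 : N + n₀ ≤ ⌊(-ζ.re - 1) / 2⌋₊ := Nat.le_floor h5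
    have h7 : (⌊(-ζ.re - 1) / 2⌋₊ : ℝ) ≤ (-ζ.re - 1) / 2 :=
      Nat.floor_le (le_trans (by positivity) h5)
    have h8 := Nat.lt_floor_add_one ((-ζ.re - 1) / 2)
    refine ⟨⌊(-ζ.re - 1) / 2⌋₊ - n₀, ?_, ?_, by omega⟩
    · rw [Nat.sub_add_cancel (by omega)]; linarith
    · rw [Nat.sub_add_cancel (by omega)]; linarith
  have hζn : ζ ∈ halfStrip (2 * ((n + n₀ : ℕ) : ℝ) + 1) := ⟨by linarith, hζ.2⟩
  -- Horizontal distance at most 2 and vertical distance at most π < 4: 12 steps of length 1/2.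
  have hdist : ‖ζ - P n‖ ≤ ((12 : ℕ) : ℝ) / 2 := by
    refine (Complex.norm_le_abs_re_add_abs_im _).trans ?_
    have h4 : |(ζ - P n).re| ≤ 2 := by
      simp only [hP, Complex.sub_re, Complex.ofReal_re]
      rw [abs_le]; constructor <;> linarith [hn2.1]
    have h5 : |(ζ - P n).im| ≤ 4 := by
      simp only [hP, Complex.sub_im, Complex.ofReal_im, sub_zero]
      rw [abs_of_nonneg hζ.2.1]; linarith [hζ.2.2]
    push_cast
    linarith
  have h4 := hstep n 12 ζ hζn hdist
  obtain ⟨h5, h6⟩ := hN n hn2.2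
  calc ‖Φ ζ - μ * ζ - c₀‖ = ‖(D ζ - D (P n)) + (D (P n) - c₀)‖ := by simp [hD]
    _ ≤ ε / 2 + ε / 2 := (norm_add_le _ _).trans (add_le_add (h4.trans h5) h6)
    _ = ε := by ring

end CornerData

/-! ### Straightening analytic arcs. -/

/-- A real analytic curve extends to a holomorphic function. -/
theorem exists_complex_extension {f : ℝ → ℂ} {t₀ : ℝ} (hf : AnalyticAt ℝ f t₀) :
    ∃ F : ℂ → ℂ, AnalyticAt ℂ F 0 ∧ ∀ᶠ x : ℝ in 𝓝 0, F x = f (t₀ + x) := by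
  obtain ⟨p, r, hp⟩ := hf
  obtain ⟨s, hs0, hsr⟩ := ENNReal.lt_iff_exists_nnreal_btwn.1 hp.r_pos
  have hs0' : 0 < s := by exact_mod_cast hs0
  -- The same Taylor coefficients, read as a power series in a complex variable.
  set q : FormalMultilinearSeries ℂ ℂ ℂ := FormalMultilinearSeries.ofScalars ℂ p.coeff with hq
  have hqr : (s : ENNReal) ≤ q.radius := by
    obtain ⟨C, hC0, hC⟩ := p.norm_mul_pow_le_of_lt_radius (hsr.trans_le hp.r_le)
    refine q.le_radius_of_bound C fun n => (le_trans ?_ (hC n))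
    gcongr
    rw [hq, FormalMultilinearSeries.norm_apply_eq_norm_coef,
      FormalMultilinearSeries.norm_apply_eq_norm_coef, FormalMultilinearSeries.coeff_ofScalars]
  have hq0 : 0 < q.radius := lt_of_lt_of_le hs0 hqr
  refine ⟨q.sum, (q.hasFPowerSeriesOnBall hq0).analyticAt, ?_⟩
  have hball : ∀ᶠ x : ℝ in 𝓝 0, x ∈ Metric.ball (0 : ℝ) s := Metric.ball_mem_nhds _ (by exact_mod_cast hs0')
  filter_upwards [hball] with x hx
  have hx' : x ∈ Metric.eball (0 : ℝ) r := by
    refine Metric.eball_subset_eball hsr.le ?_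
    rwa [Metric.eball_coe]
  have h1 := hp.hasSum hx'
  rw [← h1.tsum_eq, FormalMultilinearSeries.sum]
  refine tsum_congr fun n => ?_
  rw [FormalMultilinearSeries.apply_eq_pow_smul_coeff,
    FormalMultilinearSeries.apply_eq_pow_smul_coeff, hq, FormalMultilinearSeries.coeff_ofScalars]
  simp

/-- A holomorphic coordinate that straightens a real analytic curve. -/
theorem exists_straightening {f : ℝ → ℂ} {t₀ σ : ℝ} (hf : AnalyticAt ℝ f t₀)
    (hd : deriv f t₀ ≠ 0) (hσ : σ ≠ 0) :
    ∃ E : ℂ → ℂ, AnalyticAt ℂ E (f t₀) ∧ E (f t₀) = 0 ∧ deriv E (f t₀) ≠ 0 ∧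
      (∀ᶠ x : ℝ in 𝓝 0, E (f (t₀ + σ * x)) = x) ∧
      ∀ᶠ z in 𝓝 (f t₀), (E z).im = 0 → z = f (t₀ + σ * (E z).re) := by
  obtain ⟨F₀, hF₀, hF₀f⟩ := exists_complex_extension hf
  have hmul : Tendsto (fun x : ℝ => σ * x) (𝓝 0) (𝓝 0) := by
    have : Continuous fun x : ℝ => σ * x := by fun_prop
    simpa using this.tendsto 0
  set F : ℂ → ℂ := fun z => F₀ (σ * z) with hFdef
  have hF : AnalyticAt ℂ F 0 := by
    have h1 : AnalyticAt ℂ (fun z : ℂ => (σ : ℂ) * z) 0 := analyticAt_const.mul analyticAt_id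
    exact AnalyticAt.fun_comp (by simpa using hF₀) h1
  have hFf : ∀ᶠ x : ℝ in 𝓝 0, F x = f (t₀ + σ * x) := by
    filter_upwards [hmul.eventually hF₀f] with x hx
    rw [← hx, hFdef]
    simp
  have hF0 : F 0 = f t₀ := by simpa using hFf.self_of_nhds
  have hFd : deriv F 0 ≠ 0 := by
    have h1 : HasDerivAt (fun x : ℝ => F x) (deriv F 0) (0 : ℝ) := by
      have h := hF.differentiableAt.hasDerivAt
      exact HasDerivAt.comp_ofReal (by simpa using h)
    have h2 : HasDerivAt (fun x : ℝ => f (t₀ + σ * x)) (σ • deriv f t₀) (0 : ℝ) := by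
      have h3 : HasDerivAt (fun x : ℝ => t₀ + σ * x) σ 0 := by
        simpa using ((hasDerivAt_id (0 : ℝ)).const_mul σ).const_add t₀
      have h4 : HasDerivAt f (deriv f t₀) (t₀ + σ * 0) := by
        simpa using hf.differentiableAt.hasDerivAt
      exact h4.scomp (0 : ℝ) h3
    rw [h1.unique (h2.congr_of_eventuallyEq hFf)]
    exact smul_ne_zero hσ hd
  set E := hF.hasStrictDerivAt.localInverse _ _ _ hFd with hE
  have hEa : AnalyticAt ℂ E (f t₀) := hF0 ▸ hF.analyticAt_localInverse hFd
  have hleft : ∀ᶠ x in 𝓝 (0 : ℂ), E (F x) = x :=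
    HasStrictDerivAt.eventually_left_inverse hF.hasStrictDerivAt hFd
  have hright : ∀ᶠ z in 𝓝 (f t₀), F (E z) = z := by
    rw [← hF0]
    exact HasStrictDerivAt.eventually_right_inverse hF.hasStrictDerivAt hFd
  have hE0 : E (f t₀) = 0 := by rw [← hF0]; exact hleft.self_of_nhds
  refine ⟨E, hEa, hE0, ?_, ?_, ?_⟩
  · intro h0
    have h1 : HasDerivAt E 0 (F 0) := by
      rw [hF0]
      rw [← h0]; exact hEa.differentiableAt.hasDerivAt
    have h2 : HasDerivAt (fun x => E (F x)) (0 * deriv F 0) 0 :=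
      h1.comp 0 hF.differentiableAt.hasDerivAt
    have h3 : HasDerivAt (fun x => E (F x)) 1 0 :=
      (hasDerivAt_id (0 : ℂ)).congr_of_eventuallyEq hleft
    have := h2.unique h3
    simp at this
  · have hcoe : Tendsto (fun x : ℝ => (x : ℂ)) (𝓝 0) (𝓝 0) := by
      simpa using Complex.continuous_ofReal.tendsto 0
    filter_upwards [hcoe.eventually hleft, hFf] with x h1 h2
    rw [← h2, h1]
  · have hre : Tendsto (fun z => (E z).re) (𝓝 (f t₀)) (𝓝 0) := by
      have := (Complex.continuous_re.tendsto _).comp hEa.continuousAt.tendsto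
      simpa [hE0, Function.comp_def] using this
    filter_upwards [hright, hre.eventually hFf] with z h1 h2 h3
    rw [← h2]
    have : (((E z).re : ℝ) : ℂ) = E z := by
      apply Complex.ext <;> simp [h3]
    rw [this, h1]

theorem eq_of_mapClusterPt_of_tendsto {α X : Type*} [TopologicalSpace X] [T2Space X] {l : Filter α}
    {g : α → X} {x y : X} (h : MapClusterPt y l g) (hg : Tendsto g l (𝓝 x)) : y = x :=
  eq_of_nhds_neBot (NeBot.mono h (inf_le_inf_left _ hg))

/-- Two injective parametrizations of the same arc differ by a monotone change of parameter; near
an endpoint, one of them is straightened by a holomorphic coordinate. -/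
theorem exists_straightening_endpoint {f g : ℝ → ℂ} {a b : ℝ} (hab : a < b)
    (hf : AnalyticOnNhd ℝ f (Icc 0 1)) (hd : ∀ t ∈ Icc (0 : ℝ) 1, deriv f t ≠ 0)
    (hfi : InjOn f (Ioo 0 1)) (hg : ContinuousOn g (Icc a b)) (hgi : InjOn g (Ioo a b))
    (himg : f '' Icc 0 1 = g '' Icc a b) (hend : ∀ x ∈ Ioo a b, g x ≠ f 0 ∧ g x ≠ f 1) :
    ∃ E : ℂ → ℂ, AnalyticAt ℂ E (g a) ∧ E (g a) = 0 ∧ deriv E (g a) ≠ 0 ∧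
      (∀ᶠ x in 𝓝[>] a, (E (g x)).im = 0 ∧ 0 < (E (g x)).re) ∧
      ∀ᶠ z in 𝓝 (g a), (E z).im = 0 → 0 ≤ (E z).re → z ∈ g '' Icc a b := by
  have hτ : ∀ x ∈ Ioo a b, ∃ t ∈ Ioo (0 : ℝ) 1, f t = g x := by
    intro x hx
    have : g x ∈ f '' Icc 0 1 := himg ▸ mem_image_of_mem g (Ioo_subset_Icc_self hx)
    obtain ⟨t, ht, htx⟩ := this
    refine ⟨t, ⟨lt_of_le_of_ne ht.1 ?_, lt_of_le_of_ne ht.2 ?_⟩, htx⟩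
    · rintro rfl
      exact (hend x hx).1 htx.symm
    · rintro rfl
      exact (hend x hx).2 htx.symm
  choose! τ hτ1 hτ2 using hτ
  have huniq : ∀ x ∈ Ioo a b, ∀ t ∈ Icc (0 : ℝ) 1, f t = g x → t = τ x := by
    intro x hx t ht htx
    refine hfi ⟨lt_of_le_of_ne ht.1 ?_, lt_of_le_of_ne ht.2 ?_⟩ (hτ1 x hx) (htx.trans (hτ2 x hx).symm)
    · rintro rfl
      exact (hend x hx).1 htx.symm
    · rintro rfl
      exact (hend x hx).2 htx.symm
  -- The parameter of a point of the open arc is unique in the compact interval [0, 1], so every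
  -- cluster value of τ at x is τ(x).
  have hτc : ContinuousOn τ (Ioo a b) := by
    intro x hx
    refine isCompact_Icc.tendsto_nhds_of_unique_mapClusterPt (s := Icc (0 : ℝ) 1) ?_ ?_
    · filter_upwards [self_mem_nhdsWithin] with y hy using Ioo_subset_Icc_self (hτ1 y hy)
    · intro t ht hcl
      refine huniq x hx t ht ?_
      refine eq_of_mapClusterPt_of_tendsto (hcl.continuousAt_comp (hf t ht).continuousAt) ?_
      have h1 : Tendsto g (𝓝[Ioo a b] x) (𝓝 (g x)) :=
        (hg x (Ioo_subset_Icc_self hx)).mono Ioo_subset_Icc_self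
      refine h1.congr' ?_
      filter_upwards [self_mem_nhdsWithin] with y hy using (hτ2 y hy).symm
  have hτi : InjOn τ (Ioo a b) := by
    intro x hx y hy hxy
    exact hgi hx hy (by rw [← hτ2 x hx, ← hτ2 y hy, hxy])
  have hne : (Ioo a b).Nonempty := nonempty_Ioo.2 hab
  -- Being continuous and injective, τ is strictly monotone: t₀ is its infimum or supremum, and σ =
  -- ±1 records the direction so that the arc leaves t₀ on the positive side.
  obtain ⟨t₀, σ, ht₀, hσ, hlim, hpos, hmem⟩ : ∃ t₀ σ : ℝ, t₀ ∈ Icc (0 : ℝ) 1 ∧ σ ≠ 0 ∧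
      Tendsto τ (𝓝[>] a) (𝓝 t₀) ∧ (∀ x ∈ Ioo a b, 0 < (τ x - t₀) / σ) ∧
      ∀ᶠ x in 𝓝[≥] (0 : ℝ), t₀ + σ * x ∈ Icc (0 : ℝ) 1 := by
    have hbelow : BddBelow (τ '' Ioo a b) :=
      ⟨0, by rintro _ ⟨x, hx, rfl⟩; exact (hτ1 x hx).1.le⟩
    have habove : BddAbove (τ '' Ioo a b) :=
      ⟨1, by rintro _ ⟨x, hx, rfl⟩; exact (hτ1 x hx).2.le⟩
    obtain ⟨m, hm⟩ := hne
    rcases ContinuousOn.strictMonoOn_of_injOn_Ioo hab hτc hτi with hmono | hanti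
    · have hle : ∀ x ∈ Ioo a b, sInf (τ '' Ioo a b) < τ x := by
        intro x hx
        obtain ⟨y, hy1, hy2⟩ := exists_between hx.1
        have hy : y ∈ Ioo a b := ⟨hy1, hy2.trans hx.2⟩
        exact (csInf_le hbelow (mem_image_of_mem τ hy)).trans_lt (hmono hy hx hy2)
      have h0 : 0 ≤ sInf (τ '' Ioo a b) :=
        le_csInf ⟨_, mem_image_of_mem τ hm⟩ (by rintro _ ⟨x, hx, rfl⟩; exact (hτ1 x hx).1.le)
      have h1 : sInf (τ '' Ioo a b) < 1 := (hle m hm).trans (hτ1 m hm).2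
      refine ⟨sInf (τ '' Ioo a b), 1, ⟨h0, h1.le⟩, one_ne_zero,
        hmono.monotoneOn.tendsto_nhdsWithin_Ioo_right ⟨m, hm⟩ hbelow, ?_, ?_⟩
      · intro x hx
        rw [div_one, sub_pos]; exact hle x hx
      · filter_upwards [self_mem_nhdsWithin, mem_nhdsWithin_of_mem_nhds
          (Iio_mem_nhds (sub_pos.2 h1))] with x hx1 hx2
        rw [mem_Ici] at hx1
        rw [mem_Iio] at hx2
        constructor <;> linarith
    · have hle : ∀ x ∈ Ioo a b, τ x < sSup (τ '' Ioo a b) := by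
        intro x hx
        obtain ⟨y, hy1, hy2⟩ := exists_between hx.1
        have hy : y ∈ Ioo a b := ⟨hy1, hy2.trans hx.2⟩
        exact (hanti hy hx hy2).trans_le (le_csSup habove (mem_image_of_mem τ hy))
      have h0 : sSup (τ '' Ioo a b) ≤ 1 :=
        csSup_le ⟨_, mem_image_of_mem τ hm⟩ (by rintro _ ⟨x, hx, rfl⟩; exact (hτ1 x hx).2.le)
      have h1 : 0 < sSup (τ '' Ioo a b) := (hτ1 m hm).1.trans (hle m hm)
      refine ⟨sSup (τ '' Ioo a b), -1, ⟨h1.le, h0⟩, by norm_num,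
        hanti.antitoneOn.tendsto_nhdsWithin_Ioo_right ⟨m, hm⟩ habove, ?_, ?_⟩
      · intro x hx
        have := hle x hx
        rw [div_neg, div_one]; linarith
      · filter_upwards [self_mem_nhdsWithin, mem_nhdsWithin_of_mem_nhds
          (Iio_mem_nhds h1)] with x hx1 hx2
        rw [mem_Ici] at hx1
        rw [mem_Iio] at hx2
        constructor <;> linarith
  have hIoo : ∀ᶠ x in 𝓝[>] a, x ∈ Ioo a b := Ioo_mem_nhdsGT hab
  have hga : f t₀ = g a := by
    have h1 : Tendsto (fun x => f (τ x)) (𝓝[>] a) (𝓝 (f t₀)) :=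
      (hf t₀ ht₀).continuousAt.tendsto.comp hlim
    have h2 : Tendsto g (𝓝[>] a) (𝓝 (g a)) := by
      have := (hg a (left_mem_Icc.2 hab.le)).mono Ioo_subset_Icc_self
      rw [ContinuousWithinAt, nhdsWithin_Ioo_eq_nhdsGT hab] at this
      exact this
    refine tendsto_nhds_unique h1 (h2.congr' ?_)
    filter_upwards [hIoo] with x hx using (hτ2 x hx).symm
  obtain ⟨E, hEa, hE0, hEd, hE1, hE2⟩ := exists_straightening (hf t₀ ht₀) (hd t₀ ht₀) hσ
  rw [hga] at hEa hE0 hEd hE2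
  refine ⟨E, hEa, hE0, hEd, ?_, ?_⟩
  · have h1 : Tendsto (fun x => (τ x - t₀) / σ) (𝓝[>] a) (𝓝 0) := by
      have := (hlim.sub_const t₀).div_const σ
      simpa using this
    filter_upwards [h1.eventually hE1, hIoo] with x hx1 hx2
    rw [mul_div_cancel₀ _ hσ, add_sub_cancel, hτ2 x hx2] at hx1
    rw [hx1]
    exact ⟨Complex.ofReal_im _, by rw [Complex.ofReal_re]; exact hpos x hx2⟩
  · have hre : Tendsto (fun z => (E z).re) (𝓝 (g a)) (𝓝 0) := by
      have := (Complex.continuous_re.tendsto _).comp hEa.continuousAt.tendsto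
      simpa [hE0, Function.comp_def] using this
    rw [eventually_nhdsWithin_iff] at hmem
    filter_upwards [hE2, hre.eventually hmem] with z hz1 hz2 hz3 hz4
    rw [hz1 hz3, ← himg]
    exact mem_image_of_mem f (hz2 hz4)

/-! ### The circle of radius ρ, its corners and the adjacent arcs. -/

theorem continuous_circlePt (ρ : ℝ) : Continuous (circlePt ρ) := by
  unfold circlePt
  fun_prop

theorem norm_circlePt {ρ : ℝ} (hρ : 0 ≤ ρ) (θ : ℝ) : ‖circlePt ρ θ‖ = ρ := by
  rw [circlePt, norm_mul, Complex.norm_exp_ofReal_mul_I, mul_one, Complex.norm_real,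
    Real.norm_eq_abs, abs_of_nonneg hρ]

theorem circlePt_add_two_pi (ρ θ : ℝ) : circlePt ρ (θ + 2 * Real.pi) = circlePt ρ θ := by
  rw [circlePt, circlePt]
  push_cast
  rw [add_mul, Complex.exp_add, Complex.exp_two_pi_mul_I, mul_one]

theorem circlePt_eq_iff {ρ : ℝ} (hρ : ρ ≠ 0) {x y : ℝ} :
    circlePt ρ x = circlePt ρ y ↔ ∃ n : ℤ, x = y + n * (2 * Real.pi) := by
  rw [circlePt, circlePt, mul_right_inj' (by exact_mod_cast hρ), Complex.exp_eq_exp_iff_exists_int]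
  refine exists_congr fun n => ?_
  constructor
  · intro h
    have : (x : ℂ) = y + n * (2 * Real.pi) := by
      apply mul_right_cancel₀ Complex.I_ne_zero
      rw [h]; ring
    exact_mod_cast this
  · rintro rfl
    push_cast; ring

theorem circlePt_injOn {ρ : ℝ} (hρ : ρ ≠ 0) {S : Set ℝ}
    (hS : ∀ x ∈ S, ∀ y ∈ S, x - y < 2 * Real.pi) : InjOn (circlePt ρ) S := by
  intro x hx y hy h
  obtain ⟨n, hn⟩ := (circlePt_eq_iff hρ).1 h
  have h1 := hS x hx y hy
  have h2 := hS y hy x hx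
  have hπ := Real.pi_pos
  have h3 : (n : ℝ) < 1 := by
    by_contra hc
    nlinarith [not_lt.1 hc]
  have h4 : (-1 : ℝ) < n := by
    by_contra hc
    nlinarith [not_lt.1 hc]
  have h5 : n < 1 := by exact_mod_cast h3
  have h6 : -1 < n := by exact_mod_cast h4
  have : n = 0 := by omega
  simpa [this] using hn

theorem exists_circlePt_eq {ρ : ℝ} {w : ℂ} (h : ‖w‖ = ρ) : ∃ θ, circlePt ρ θ = w :=
  ⟨w.arg, by rw [circlePt, ← h]; exact Complex.norm_mul_exp_arg_mul_I w⟩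

/-- The full turn a + 2π always qualifies, so a nearest corner exists; with a single corner on the
circle it is a + 2π itself. -/
theorem exists_next_corner {ρ : ℝ} (hρ : ρ ≠ 0) {T : Set ℂ} (hT : T.Finite) {a : ℝ}
    (ha : circlePt ρ a ∈ T) :
    ∃ b, a < b ∧ b ≤ a + 2 * Real.pi ∧ circlePt ρ b ∈ T ∧ ∀ θ ∈ Ioo a b, circlePt ρ θ ∉ T := by
  have hfin : (Ioc a (a + 2 * Real.pi) ∩ circlePt ρ ⁻¹' T).Finite := by
    refine Set.Finite.of_finite_image (hT.subset ?_) (circlePt_injOn hρ ?_) (f := circlePt ρ)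
    · rintro _ ⟨x, hx, rfl⟩; exact hx.2
    · intro x hx y hy; linarith [hx.1.2, hy.1.1]
  obtain ⟨b, hb, hmin⟩ := hfin.exists_minimal
    ⟨a + 2 * Real.pi, ⟨by linarith [Real.pi_pos], le_rfl⟩, by
      rw [mem_preimage, circlePt_add_two_pi]; exact ha⟩
  refine ⟨b, hb.1.1, hb.1.2, hb.2, fun θ hθ hθT => ?_⟩
  have := hmin (y := θ) ⟨⟨hθ.1, hθ.2.le.trans hb.1.2⟩, hθT⟩ hθ.2.le
  exact absurd hθ.2 (not_lt.2 this)

theorem exists_prev_corner {ρ : ℝ} (hρ : ρ ≠ 0) {T : Set ℂ} (hT : T.Finite) {b : ℝ}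
    (hb : circlePt ρ b ∈ T) :
    ∃ a, a < b ∧ b ≤ a + 2 * Real.pi ∧ circlePt ρ a ∈ T ∧ ∀ θ ∈ Ioo a b, circlePt ρ θ ∉ T := by
  have hfin : (Ico (b - 2 * Real.pi) b ∩ circlePt ρ ⁻¹' T).Finite := by
    refine Set.Finite.of_finite_image (hT.subset ?_) (circlePt_injOn hρ ?_) (f := circlePt ρ)
    · rintro _ ⟨x, hx, rfl⟩; exact hx.2
    · intro x hx y hy; linarith [hx.1.2, hy.1.1]
  obtain ⟨a, ha, hmax⟩ := hfin.exists_maximal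
    ⟨b - 2 * Real.pi, ⟨le_rfl, by linarith [Real.pi_pos]⟩, by
      rw [mem_preimage, ← circlePt_add_two_pi, sub_add_cancel]; exact hb⟩
  refine ⟨a, ha.1.2, by linarith [ha.1.1], ha.2, fun θ hθ hθT => ?_⟩
  have := hmax (y := θ) ⟨⟨ha.1.1.trans hθ.1.le, hθ.2⟩, hθT⟩ hθ.1.le
  exact absurd hθ.1 (not_lt.2 this)

section ConditionA1

variable {ψ : ℂ → ℂ} {ρ : ℝ} {s : ℕ} {Θ : Fin s → ℝ}

theorem ConditionA1.continuous_circlePt (hA1 : ConditionA1 ψ ρ Θ) (hρ : 0 < ρ) :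
    Continuous fun θ => ψ (circlePt ρ θ) :=
  hA1.continuousOn.comp_continuous (Carleman.continuous_circlePt ρ) fun θ =>
    (norm_circlePt hρ.le θ).ge

theorem ConditionA1.ne_of_notMem (hA1 : ConditionA1 ψ ρ Θ) (hρ : 0 < ρ) {x y : ℝ}
    (hx : circlePt ρ x ∉ range fun k => circlePt ρ (Θ k))
    (hxy : circlePt ρ x ≠ circlePt ρ y) : ψ (circlePt ρ x) ≠ ψ (circlePt ρ y) := fun h =>
  hx (hA1.eq_imp _ _ (norm_circlePt hρ.le x) (norm_circlePt hρ.le y) hxy h).1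

theorem ConditionA1.ne_corner (hA1 : ConditionA1 ψ ρ Θ) (hρ : 0 < ρ) {x y : ℝ}
    (hx : circlePt ρ x ∉ range fun k => circlePt ρ (Θ k))
    (hy : circlePt ρ y ∈ range fun k => circlePt ρ (Θ k)) :
    ψ (circlePt ρ x) ≠ ψ (circlePt ρ y) :=
  hA1.ne_of_notMem hρ hx fun h => hx (h ▸ hy)

theorem ConditionA1.injOn_arc (hA1 : ConditionA1 ψ ρ Θ) (hρ : 0 < ρ) {a b : ℝ}
    (hb2 : b ≤ a + 2 * Real.pi)
    (hab : ∀ θ ∈ Ioo a b, circlePt ρ θ ∉ range fun k => circlePt ρ (Θ k)) :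
    InjOn (fun θ => ψ (circlePt ρ θ)) (Ioo a b) := by
  have hinj : InjOn (circlePt ρ) (Ioo a b) :=
    circlePt_injOn hρ.ne' fun x hx y hy => by linarith [hx.2, hy.1]
  intro x hx y hy h
  by_contra hne
  exact hA1.ne_of_notMem hρ (hab x hx) (fun h' => hne (hinj hx hy h')) h

/-- The last clause makes the preimage of the nonnegative ray part of the boundary curve near the
corner. The values of ψ outside the circle therefore omit it, which later bounds an argument. -/
theorem ConditionA1.exists_straightening_right (hA1 : ConditionA1 ψ ρ Θ) (hρ : 0 < ρ) {a : ℝ}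
    (ha : circlePt ρ a ∈ range fun k => circlePt ρ (Θ k)) :
    ∃ E : ℂ → ℂ, AnalyticAt ℂ E (ψ (circlePt ρ a)) ∧ E (ψ (circlePt ρ a)) = 0 ∧
      deriv E (ψ (circlePt ρ a)) ≠ 0 ∧
      (∀ᶠ θ in 𝓝[>] a, (E (ψ (circlePt ρ θ))).im = 0 ∧ 0 < (E (ψ (circlePt ρ θ))).re) ∧
      ∀ᶠ z in 𝓝 (ψ (circlePt ρ a)), (E z).im = 0 → 0 ≤ (E z).re →
        z ∈ range fun θ => ψ (circlePt ρ θ) := by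
  obtain ⟨b, hab, hb2, hb, hno⟩ := exists_next_corner hρ.ne' (finite_range _) ha
  obtain ⟨f, hf, hd, hfi, himg, hf0, hf1⟩ := hA1.arcs a b hab ha hb hno
  obtain ⟨E, h1, h2, h3, h4, h5⟩ := exists_straightening_endpoint (g := fun θ => ψ (circlePt ρ θ))
    hab hf hd hfi (hA1.continuous_circlePt hρ).continuousOn (hA1.injOn_arc hρ hb2 hno) himg
    fun x hx => by
      rw [hf0, hf1]
      exact ⟨hA1.ne_corner hρ (hno x hx) ha, hA1.ne_corner hρ (hno x hx) hb⟩
  refine ⟨E, h1, h2, h3, h4, h5.mono fun z hz hz1 hz2 => ?_⟩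
  exact image_subset_range _ _ (hz hz1 hz2)

theorem ConditionA1.exists_straightening_left (hA1 : ConditionA1 ψ ρ Θ) (hρ : 0 < ρ) {b : ℝ}
    (hb : circlePt ρ b ∈ range fun k => circlePt ρ (Θ k)) :
    ∃ E : ℂ → ℂ, AnalyticAt ℂ E (ψ (circlePt ρ b)) ∧ E (ψ (circlePt ρ b)) = 0 ∧
      deriv E (ψ (circlePt ρ b)) ≠ 0 ∧
      (∀ᶠ θ in 𝓝[<] b, (E (ψ (circlePt ρ θ))).im = 0 ∧ 0 < (E (ψ (circlePt ρ θ))).re) ∧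
      ∀ᶠ z in 𝓝 (ψ (circlePt ρ b)), (E z).im = 0 → 0 ≤ (E z).re →
        z ∈ range fun θ => ψ (circlePt ρ θ) := by
  obtain ⟨a, hab, hb2, ha, hno⟩ := exists_prev_corner hρ.ne' (finite_range _) hb
  obtain ⟨f, hf, hd, hfi, himg, hf0, hf1⟩ := hA1.arcs a b hab ha hb hno
  have hmem : ∀ {x}, x ∈ Ioo (-b) (-a) → -x ∈ Ioo a b := fun hx =>
    ⟨by linarith [hx.2], by linarith [hx.1]⟩
  obtain ⟨E, h1, h2, h3, h4, h5⟩ := exists_straightening_endpoint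
    (g := fun θ => ψ (circlePt ρ (-θ))) (neg_lt_neg hab) hf hd hfi
    ((hA1.continuous_circlePt hρ).comp continuous_neg).continuousOn
    (fun x hx y hy h => neg_injective (hA1.injOn_arc hρ hb2 hno (hmem hx) (hmem hy) h))
    (himg.trans (by
      ext z
      constructor
      · rintro ⟨x, hx, rfl⟩
        exact ⟨-x, ⟨neg_le_neg hx.2, neg_le_neg hx.1⟩, by simp⟩
      · rintro ⟨x, hx, rfl⟩
        exact ⟨-x, ⟨by linarith [hx.2], by linarith [hx.1]⟩, rfl⟩))
    fun x hx => by
      rw [hf0, hf1]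
      exact ⟨hA1.ne_corner hρ (hno _ (hmem hx)) ha, hA1.ne_corner hρ (hno _ (hmem hx)) hb⟩
  simp only [neg_neg] at h1 h2 h3 h4 h5
  refine ⟨E, h1, h2, h3, ?_, h5.mono fun z hz hz1 hz2 => ?_⟩
  · have hneg : Tendsto (fun x : ℝ => -x) (𝓝[<] b) (𝓝[>] (-b)) := tendsto_neg_nhdsLT
    filter_upwards [hneg.eventually h4] with x hx
    simpa using hx
  · obtain ⟨x, -, hx⟩ := hz hz1 hz2
    exact ⟨-x, hx⟩

end ConditionA1

/-! ### Logarithms in the half-strip coordinate. -/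

/-- Near a zero of order one, `E` is, up to a constant, `z ↦ z exp (ℓ z)`. -/
theorem exists_log_correction {E : ℂ → ℂ} {z₀ : ℂ} (hE : AnalyticAt ℂ E z₀) (h0 : E z₀ = 0)
    (hd : deriv E z₀ ≠ 0) :
    ∃ (ℓ : ℂ → ℂ) (r C : ℝ), 0 < r ∧ 0 ≤ C ∧ DifferentiableOn ℂ ℓ (Metric.ball 0 r) ∧
      (∀ z ∈ Metric.ball (0 : ℂ) r, ‖ℓ z‖ ≤ C * ‖z‖) ∧
      ∀ z ∈ Metric.ball (0 : ℂ) r, deriv E z₀ * (z * Complex.exp (ℓ z)) = E (z₀ + z) := by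
  set d := deriv E z₀ with hdd
  set e : ℂ → ℂ := fun z => dslope E z₀ (z₀ + z) with he
  have hea : AnalyticAt ℂ e 0 := by
    obtain ⟨p, hp⟩ := hE
    have h1 : AnalyticAt ℂ (dslope E z₀) z₀ := ⟨_, hp.has_fpower_series_dslope_fslope⟩
    have h2 : AnalyticAt ℂ (fun z : ℂ => z₀ + z) 0 := analyticAt_const.add analyticAt_id
    exact AnalyticAt.fun_comp (by simpa using h1) h2
  have he0 : e 0 = d := by simp [he, hdd]
  have hmul : ∀ z, z * e z = E (z₀ + z) := by
    intro z
    have := sub_smul_dslope E z₀ (z₀ + z)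
    rw [add_sub_cancel_left, smul_eq_mul, h0, sub_zero] at this
    exact this
  set ℓ : ℂ → ℂ := fun z => Complex.log (e z / d) with hℓ
  have hℓa : AnalyticAt ℂ ℓ 0 := by
    refine AnalyticAt.clog hea.div_const ?_
    rw [he0, div_self hd]
    exact Complex.one_mem_slitPlane
  have hℓ0 : ℓ 0 = 0 := by simp [hℓ, he0, div_self hd]
  obtain ⟨C, hC0, hC⟩ : ∃ C, 0 ≤ C ∧ ∀ᶠ z in 𝓝 (0 : ℂ), ‖ℓ z‖ ≤ C * ‖z‖ := by
    have := hℓa.differentiableAt.isBigO_sub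
    simp only [hℓ0, sub_zero] at this
    obtain ⟨C, hC0, hC⟩ := this.exists_nonneg
    exact ⟨C, hC0, hC.bound⟩
  have hne : ∀ᶠ z in 𝓝 (0 : ℂ), e z ≠ 0 := hea.continuousAt.eventually_ne (by rw [he0]; exact hd)
  obtain ⟨r, hr, hball⟩ := Metric.eventually_nhds_iff_ball.1
    ((hℓa.eventually_analyticAt.and hC).and hne)
  refine ⟨ℓ, r, C, hr, hC0, fun z hz => (hball z hz).1.1.differentiableAt.differentiableWithinAt,
    fun z hz => (hball z hz).1.2, fun z hz => ?_⟩
  rw [hℓ]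
  simp only
  rw [Complex.exp_log (div_ne_zero (hball z hz).2 hd), ← hmul]
  field_simp

/-- A real function on a preconnected set that avoids the multiples of `2π` stays between two
consecutive ones. -/
theorem exists_int_forall_mem_Ioo {X : Type*} [TopologicalSpace X] {S : Set X}
    (hS : IsPreconnected S) (hne : S.Nonempty) {u : X → ℝ} (hu : ContinuousOn u S)
    (h : ∀ x ∈ S, ∀ n : ℤ, u x ≠ 2 * Real.pi * n) :
    ∃ m : ℤ, ∀ x ∈ S, 2 * Real.pi * m < u x ∧ u x < 2 * Real.pi * (m + 1) := by
  obtain ⟨x₀, hx₀⟩ := hne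
  have hπ := Real.two_pi_pos
  set m := ⌊u x₀ / (2 * Real.pi)⌋
  have h1 : 2 * Real.pi * m ≤ u x₀ := by
    have := Int.floor_le (u x₀ / (2 * Real.pi))
    rwa [le_div_iff₀ hπ, mul_comm] at this
  have h2 : u x₀ < 2 * Real.pi * (m + 1) := by
    have := Int.lt_floor_add_one (u x₀ / (2 * Real.pi))
    rwa [div_lt_iff₀ hπ, mul_comm] at this
  refine ⟨m, fun x hx => ⟨?_, ?_⟩⟩
  · by_contra hc
    obtain ⟨y, hy, hyu⟩ := hS.intermediate_value hx hx₀ hu ⟨not_lt.1 hc, h1⟩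
    exact h y hy m hyu
  · by_contra hc
    obtain ⟨y, hy, hyu⟩ := hS.intermediate_value hx₀ hx hu ⟨h2.le, not_lt.1 hc⟩
    exact h y hy (m + 1) (by rw [hyu]; push_cast; ring)

theorem exists_int_forall_eq {X : Type*} [TopologicalSpace X] {S : Set X}
    (hS : IsPreconnected S) (hne : S.Nonempty) {u : X → ℝ} (hu : ContinuousOn u S)
    (h : ∀ x ∈ S, ∃ n : ℤ, u x = 2 * Real.pi * n) :
    ∃ m : ℤ, ∀ x ∈ S, u x = 2 * Real.pi * m := by
  have key : ∀ x ∈ S, ∀ y ∈ S, ¬ u x < u y := by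
    intro x hx y hy hlt
    obtain ⟨n, hn⟩ := h x hx
    obtain ⟨k, hk⟩ := h y hy
    have hπ := Real.pi_pos
    have hnk : n < k := by
      rw [hn, hk] at hlt
      exact_mod_cast lt_of_mul_lt_mul_left hlt (by positivity)
    have hnk' : (n : ℝ) + 1 ≤ k := by exact_mod_cast hnk
    obtain ⟨z, hz, hzu⟩ := hS.intermediate_value hx hy hu
      (show u x + Real.pi ∈ Icc (u x) (u y) from ⟨by linarith, by rw [hn, hk]; nlinarith⟩)
    obtain ⟨j, hj⟩ := h z hz
    rw [hj, hn] at hzu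
    have : (2 * j : ℝ) = 2 * n + 1 := by
      apply mul_left_cancel₀ hπ.ne'
      linarith
    have : 2 * j = 2 * n + 1 := by exact_mod_cast this
    omega
  obtain ⟨x₀, hx₀⟩ := hne
  obtain ⟨m, hm⟩ := h x₀ hx₀
  exact ⟨m, fun x hx => hm ▸ le_antisymm (not_lt.1 (key x₀ hx₀ x hx)) (not_lt.1 (key x hx x₀ hx₀))⟩

/-- Clamping to the half strip. -/
def clampHalfStrip (X : ℝ) (ζ : ℂ) : ℂ :=
  (min ζ.re (-X) : ℝ) + (max 0 (min ζ.im Real.pi) : ℝ) * Complex.I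

theorem continuous_clampHalfStrip (X : ℝ) : Continuous (clampHalfStrip X) := by
  unfold clampHalfStrip
  fun_prop

theorem clampHalfStrip_mem (X : ℝ) (ζ : ℂ) : clampHalfStrip X ζ ∈ halfStrip X := by
  refine ⟨?_, ?_, ?_⟩ <;> simp [clampHalfStrip, Real.pi_pos.le]

theorem clampHalfStrip_eq {X : ℝ} {ζ : ℂ} (h : ζ ∈ halfStrip X) : clampHalfStrip X ζ = ζ := by
  apply Complex.ext
  · simpa [clampHalfStrip] using h.1
  · simp [clampHalfStrip, min_eq_left h.2.2, h.2.1]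

/-- A logarithm of a non-vanishing function on a half strip. -/
theorem exists_log_halfStrip {Z : ℂ → ℂ} {X : ℝ} (hZ : HoloOnHalfStrip Z X)
    (h0 : ∀ ζ ∈ halfStrip X, Z ζ ≠ 0) :
    ∃ Φ : ℂ → ℂ, HoloOnHalfStrip Φ X ∧ ∀ ζ ∈ halfStrip X, Complex.exp (Φ ζ) = Z ζ := by
  have hsc : IsSimplyConnected (univ : Set ℂ) := by
    have : ContractibleSpace (univ : Set ℂ) :=
      (convex_univ (𝕜 := ℝ) (E := ℂ)).contractibleSpace univ_nonempty
    exact SimplyConnectedSpace.ofContractible (univ : Set ℂ)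
  -- The clamp retracts the plane onto the closed strip, so a continuous logarithm can be taken on
  -- the simply connected plane, edges included.
  have hcont : ContinuousOn (fun ζ => Z (clampHalfStrip X ζ)) univ :=
    hZ.continuousOn.comp (continuous_clampHalfStrip X).continuousOn
      fun ζ _ => clampHalfStrip_mem X ζ
  obtain ⟨Φ, hΦc, hΦ⟩ := Complex.exists_continuousOn_eqOn_exp_comp hsc isOpen_univ hcont (by
    rintro ⟨ζ, -, hζ⟩
    exact h0 _ (clampHalfStrip_mem X ζ) hζ)
  have hΦe : ∀ ζ ∈ halfStrip X, Complex.exp (Φ ζ) = Z ζ := by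
    intro ζ hζ
    have := hΦ (mem_univ ζ)
    simpa [clampHalfStrip_eq hζ] using this
  rw [continuousOn_univ] at hΦc
  refine ⟨Φ, ⟨hΦc.continuousOn, fun ζ h1 h2 h3 => ?_⟩, hΦe⟩
  have hζ : ζ ∈ halfStrip X := ⟨h1.le, h2.le, h3.le⟩
  have hd := hZ.differentiableAt ζ h1 h2 h3
  have hnhds : ∀ᶠ w in 𝓝 ζ, w ∈ halfStrip X := by
    filter_upwards [(isOpen_lt Complex.continuous_re continuous_const).mem_nhds h1,
      (isOpen_lt continuous_const Complex.continuous_im).mem_nhds h2,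
      (isOpen_lt Complex.continuous_im continuous_const).mem_nhds h3] with w a b c
      using ⟨le_of_lt a, le_of_lt b, le_of_lt c⟩
  have hZ0 := h0 ζ hζ
  -- Near ζ the continuous logarithm differs from Φ(ζ) by the principal logarithm of Z(w)/Z(ζ),
  -- hence is holomorphic.
  have hg : DifferentiableAt ℂ (fun w => Φ ζ + Complex.log (Z w / Z ζ)) ζ := by
    refine DifferentiableAt.const_add _ (DifferentiableAt.clog (hd.div_const _) ?_)
    rw [div_self hZ0]; exact Complex.one_mem_slitPlane
  refine hg.congr_of_eventuallyEq ?_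
  have hsmall : ∀ᶠ w in 𝓝 ζ, ‖Φ w - Φ ζ‖ < 1 := by
    have := hΦc.tendsto ζ
    filter_upwards [Metric.tendsto_nhds.1 this 1 one_pos] with w hw
    rwa [← dist_eq_norm]
  filter_upwards [hnhds, hsmall] with w hw1 hw2
  rw [← hΦe w hw1, ← hΦe ζ hζ, ← Complex.exp_sub]
  have him := abs_lt.1 ((Complex.abs_im_le_norm (Φ w - Φ ζ)).trans_lt hw2)
  rw [Complex.log_exp (by linarith [Real.pi_gt_three]) (by linarith [Real.pi_gt_three])]
  ring

open Complex in
/-- The map of the half strip onto a neighbourhood of a boundary point in the exterior of a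
circle. -/
def cornerMap (ρ Θ : ℝ) (ζ : ℂ) : ℂ := circlePt ρ Θ * exp (-I * exp ζ)

open Complex in
-- The sign of sin(Im ζ) shows that the edges go to the circle and the open strip to its exterior.
theorem norm_cornerMap {ρ : ℝ} (hρ : 0 ≤ ρ) (Θ : ℝ) (ζ : ℂ) :
    ‖cornerMap ρ Θ ζ‖ = ρ * Real.exp (Real.exp ζ.re * Real.sin ζ.im) := by
  rw [cornerMap, norm_mul, norm_circlePt hρ, norm_exp]
  simp [exp_im]

theorem le_norm_cornerMap {ρ : ℝ} (hρ : 0 ≤ ρ) (Θ : ℝ) {ζ : ℂ} (h0 : 0 ≤ ζ.im)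
    (h1 : ζ.im ≤ Real.pi) : ρ ≤ ‖cornerMap ρ Θ ζ‖ := by
  rw [norm_cornerMap hρ]
  have := Real.sin_nonneg_of_nonneg_of_le_pi h0 h1
  nlinarith [Real.one_le_exp (mul_nonneg (Real.exp_pos ζ.re).le this)]

theorem cornerMap_mem_outside {ρ : ℝ} (hρ : 0 < ρ) (Θ : ℝ) {ζ : ℂ} (h0 : 0 < ζ.im)
    (h1 : ζ.im < Real.pi) : cornerMap ρ Θ ζ ∈ outside ρ := by
  change ρ < _
  rw [norm_cornerMap hρ.le]
  have := Real.sin_pos_of_pos_of_lt_pi h0 h1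
  nlinarith [Real.one_lt_exp_iff.2 (mul_pos (Real.exp_pos ζ.re) this)]

open Complex in
theorem cornerMap_bottom (ρ Θ : ℝ) {ζ : ℂ} (h : ζ.im = 0) :
    cornerMap ρ Θ ζ = circlePt ρ (Θ - Real.exp ζ.re) := by
  have : ζ = (ζ.re : ℂ) := Complex.ext rfl (by simp [h])
  rw [cornerMap, circlePt, circlePt, mul_assoc, ← Complex.exp_add, this]
  congr 2
  push_cast
  rw [ofReal_re]
  ring

open Complex in
theorem cornerMap_top (ρ Θ : ℝ) {ζ : ℂ} (h : ζ.im = Real.pi) :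
    cornerMap ρ Θ ζ = circlePt ρ (Θ + Real.exp ζ.re) := by
  have : ζ = (ζ.re : ℂ) + Real.pi * I := Complex.ext (by simp) (by simp [h])
  rw [cornerMap, circlePt, circlePt, mul_assoc, ← Complex.exp_add]
  have h2 : exp ζ = -Real.exp ζ.re := by
    rw [this, Complex.exp_add, exp_pi_mul_I]
    push_cast
    simp
  rw [h2]
  congr 2
  push_cast
  ring

open Complex in
theorem exists_forall_cornerMap {ρ : ℝ} (hρ : 0 ≤ ρ) (Θ : ℝ) {P : ℂ → Prop}
    (hP : ∀ᶠ w in 𝓝[{w | ρ ≤ ‖w‖}] (circlePt ρ Θ), P w) :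
    ∃ X, ∀ ζ ∈ halfStrip X, P (cornerMap ρ Θ ζ) := by
  have hcont : Continuous fun ξ : ℂ => circlePt ρ Θ * exp (-I * ξ) := by fun_prop
  have h1 := hcont.tendsto 0
  simp only [mul_zero, Complex.exp_zero, mul_one] at h1
  obtain ⟨δ, hδ, hball⟩ := Metric.eventually_nhds_iff_ball.1
    (h1.eventually (eventually_nhdsWithin_iff.1 hP))
  refine ⟨-Real.log δ + 1, fun ζ hζ => hball (exp ζ) ?_ (le_norm_cornerMap hρ Θ hζ.2.1 hζ.2.2)⟩
  rw [mem_ball_zero_iff, norm_exp, ← Real.lt_log_iff_exp_lt hδ]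
  linarith [hζ.1]

/-- The part of the half strip that avoids the two edges. -/
theorem halfStrip_subset_closure (X : ℝ) :
    halfStrip X ⊆ closure {ζ | ζ.re ≤ -X ∧ 0 < ζ.im ∧ ζ.im < Real.pi} := by
  intro ζ hζ
  have hπ := Real.pi_pos
  set p : ℂ := ζ.re + (Real.pi / 2 : ℝ) * Complex.I with hp
  have hc : Continuous fun t : ℝ => ζ + t * (p - ζ) := by fun_prop
  have hlim : Tendsto (fun t : ℝ => ζ + t * (p - ζ)) (𝓝[>] 0) (𝓝 ζ) := by
    have := hc.tendsto 0
    simp only [Complex.ofReal_zero, zero_mul, add_zero] at this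
    exact this.mono_left nhdsWithin_le_nhds
  refine mem_closure_of_tendsto hlim ?_
  filter_upwards [Ioo_mem_nhdsGT (zero_lt_one' ℝ)] with t ht
  have him : (ζ + t * (p - ζ)).im = ζ.im + t * (Real.pi / 2 - ζ.im) := by
    simp [hp]
  have hre : (ζ + t * (p - ζ)).re = ζ.re := by simp [hp]
  refine ⟨by rw [hre]; exact hζ.1, ?_, ?_⟩
  · rw [him]; nlinarith [hζ.2.1, ht.1, ht.2, mul_nonneg (sub_nonneg.2 ht.2.le) hζ.2.1, mul_pos ht.1 hπ]
  · rw [him]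
    nlinarith [hζ.2.2, ht.1, ht.2, mul_nonneg (sub_nonneg.2 ht.2.le) (sub_nonneg.2 hζ.2.2),
      mul_pos ht.1 hπ]

theorem isClosed_halfStrip (X : ℝ) : IsClosed (halfStrip X) :=
  (isClosed_le Complex.continuous_re continuous_const).inter
    ((isClosed_le continuous_const Complex.continuous_im).inter
      (isClosed_le Complex.continuous_im continuous_const))

open Complex in
-- With ℓ from `exists_log_correction`, E(z₀ + e^Φ) has argument u = Im(Φ + ℓ(e^Φ)) + arg E'(z₀).
-- Inside the strip E omits the nonnegative ray, so u avoids 2πℤ and stays in one interval of length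
-- 2π. On the edge E is positive, so u is a multiple of 2π and, by connectedness, constant.
theorem exists_edge_correction {Φ E : ℂ → ℂ} {X : ℝ} {z₀ : ℂ} (hΦ : HoloOnHalfStrip Φ X)
    (hre : ∀ K : ℝ, ∃ Y : ℝ, ∀ ζ ∈ halfStrip Y, (Φ ζ).re ≤ K)
    (hE : AnalyticAt ℂ E z₀) (h0 : E z₀ = 0) (hd : deriv E z₀ ≠ 0) {e : ℝ}
    (he0 : 0 ≤ e) (he1 : e ≤ Real.pi)
    (hedge : ∀ ζ ∈ halfStrip X, ζ.im = e →
      (E (z₀ + exp (Φ ζ))).im = 0 ∧ 0 < (E (z₀ + exp (Φ ζ))).re)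
    (homit : ∀ ζ ∈ halfStrip X, 0 < ζ.im → ζ.im < Real.pi →
      (E (z₀ + exp (Φ ζ))).im = 0 → ¬ 0 ≤ (E (z₀ + exp (Φ ζ))).re) :
    ∃ (ℓ : ℂ → ℂ) (r C Y a : ℝ), X ≤ Y ∧ 0 < r ∧ 0 ≤ C ∧ DifferentiableOn ℂ ℓ (Metric.ball 0 r) ∧
      (∀ z ∈ Metric.ball (0 : ℂ) r, ‖ℓ z‖ ≤ C * ‖z‖) ∧
      (∀ ζ ∈ halfStrip Y, ‖exp (Φ ζ)‖ < r) ∧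
      (∀ ζ ∈ halfStrip Y, ζ.im = e → (Φ ζ + ℓ (exp (Φ ζ))).im = a) ∧
      ∀ ζ ∈ halfStrip Y, |(Φ ζ + ℓ (exp (Φ ζ))).im - a| ≤ 2 * Real.pi := by
  obtain ⟨ℓ, r, C, hr, hC, hℓd, hℓC, hℓ⟩ := exists_log_correction hE h0 hd
  obtain ⟨Y₀, hY₀⟩ := hre (Real.log r - 1)
  set Y := max X Y₀
  have hXY : X ≤ Y := le_max_left _ _
  have hsub := halfStrip_subset hXY
  have hsmall : ∀ ζ ∈ halfStrip Y, ‖exp (Φ ζ)‖ < r := by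
    intro ζ hζ
    rw [norm_exp, ← Real.lt_log_iff_exp_lt hr]
    linarith [hY₀ ζ (halfStrip_subset (le_max_right _ _) hζ)]
  set d := deriv E z₀
  set u : ℂ → ℝ := fun ζ => (Φ ζ + ℓ (exp (Φ ζ))).im + arg d with hu
  have hform : ∀ ζ ∈ halfStrip Y, E (z₀ + exp (Φ ζ)) =
      (‖d‖ * Real.exp (Φ ζ + ℓ (exp (Φ ζ))).re : ℝ) * exp (u ζ * I) := by
    intro ζ hζ
    rw [← hℓ _ (mem_ball_zero_iff.2 (hsmall ζ hζ)), ← Complex.exp_add]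
    conv_lhs => rw [← norm_mul_exp_arg_mul_I d, ← re_add_im (Φ ζ + ℓ (exp (Φ ζ))), Complex.exp_add]
    rw [hu]
    push_cast
    rw [add_mul, Complex.exp_add]
    ring
  have hpos : ∀ ζ, 0 < ‖d‖ * Real.exp (Φ ζ + ℓ (exp (Φ ζ))).re := fun ζ => by positivity
  have huc : ContinuousOn u (halfStrip Y) := by
    have h1 := hΦ.continuousOn.mono hsub
    have h2 : ContinuousOn (fun ζ => ℓ (exp (Φ ζ))) (halfStrip Y) :=
      hℓd.continuousOn.comp (continuous_exp.comp_continuousOn h1)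
        fun ζ hζ => mem_ball_zero_iff.2 (hsmall ζ hζ)
    exact (continuous_im.comp_continuousOn (h1.add h2)).add continuousOn_const
  set S : Set ℂ := {ζ | ζ.re ≤ -Y ∧ 0 < ζ.im ∧ ζ.im < Real.pi} with hS
  have hSsub : S ⊆ halfStrip Y := fun ζ h => ⟨h.1, h.2.1.le, h.2.2.le⟩
  have hSconv : Convex ℝ S := (convex_halfSpace_re_le _).inter
    ((convex_halfSpace_im_gt _).inter (convex_halfSpace_im_lt _))
  have hSne : S.Nonempty := ⟨(-Y : ℝ) + (Real.pi / 2 : ℝ) * I, by simp,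
    by simpa using Real.pi_pos, by simpa using half_lt_self Real.pi_pos⟩
  obtain ⟨m, hm⟩ := exists_int_forall_mem_Ioo hSconv.isPreconnected hSne (huc.mono hSsub) (by
    intro ζ hζ n hn
    have h1 := hform ζ (hSsub hζ)
    rw [hn, show ((2 * Real.pi * n : ℝ) : ℂ) * I = n * (2 * Real.pi * I) by push_cast; ring,
      exp_int_mul_two_pi_mul_I, mul_one] at h1
    refine homit ζ (hsub (hSsub hζ)) hζ.2.1 hζ.2.2 ?_ ?_
    · rw [h1, ofReal_im]
    · rw [h1, ofReal_re]; exact (hpos ζ).le)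
  have hcl : closure S = halfStrip Y :=
    (closure_minimal hSsub (isClosed_halfStrip Y)).antisymm (halfStrip_subset_closure Y)
  have hbd : ∀ ζ ∈ halfStrip Y, 2 * Real.pi * m ≤ u ζ ∧ u ζ ≤ 2 * Real.pi * (m + 1) := by
    intro ζ hζ
    rw [← hcl] at hζ huc
    exact ⟨le_on_closure (fun x hx => (hm x hx).1.le) continuousOn_const huc hζ,
      le_on_closure (fun x hx => (hm x hx).2.le) huc continuousOn_const hζ⟩
  set T : Set ℂ := {ζ | ζ.re ≤ -Y ∧ ζ.im = e} with hT
  have hTsub : T ⊆ halfStrip Y := fun ζ h => ⟨h.1, h.2 ▸ he0, h.2 ▸ he1⟩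
  have hTconv : Convex ℝ T := (convex_halfSpace_re_le _).inter
    (convex_hyperplane (f := fun z : ℂ => z.im) ⟨fun _ _ => rfl, fun c x => by simp⟩ e)
  have hT0 : ((-Y : ℝ) : ℂ) + e * I ∈ T := ⟨by simp, by simp⟩
  obtain ⟨m', hm'⟩ := exists_int_forall_eq hTconv.isPreconnected ⟨_, hT0⟩ (huc.mono hTsub) (by
    intro ζ hζ
    obtain ⟨h1, h2⟩ := hedge ζ (hsub (hTsub hζ)) hζ.2
    have h3 := hform ζ (hTsub hζ)
    rw [h3, im_ofReal_mul, exp_ofReal_mul_I_im] at h1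
    rw [h3, re_ofReal_mul, exp_ofReal_mul_I_re] at h2
    have hc : 0 < Real.cos (u ζ) := pos_of_mul_pos_right h2 (hpos ζ).le
    have hs : Real.sin (u ζ) = 0 := (mul_eq_zero.1 h1).resolve_left (hpos ζ).ne'
    have hc1 : Real.cos (u ζ) = 1 := by
      have := Real.sin_sq_add_cos_sq (u ζ)
      rw [hs] at this
      nlinarith
    obtain ⟨n, hn⟩ := (Real.cos_eq_one_iff _).1 hc1
    exact ⟨n, by rw [← hn]; ring⟩)
  have hmm := hbd _ (hTsub hT0)
  rw [hm' _ hT0] at hmm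
  refine ⟨ℓ, r, C, Y, 2 * Real.pi * m' - arg d, hXY, hr, hC, hℓd, hℓC, hsmall,
    fun ζ hζ h => ?_, fun ζ hζ => ?_⟩
  · have := hm' ζ ⟨hζ.1, h⟩
    simp only [hu] at this
    linarith
  · have := hbd ζ hζ
    have h2 : (Φ ζ + ℓ (exp (Φ ζ))).im - (2 * Real.pi * m' - arg d) = u ζ - 2 * Real.pi * m' := by
      simp only [hu]; ring
    rw [h2, abs_le]
    constructor <;> linarith

/-! ### Asymptotics of ψ at a corner. -/

theorem outside_subset_closedOutside (ρ : ℝ) : outside ρ ⊆ {w | ρ ≤ ‖w‖} :=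
  fun w (h : ρ < ‖w‖) => show ρ ≤ ‖w‖ from h.le

theorem isOpen_outside (ρ : ℝ) : IsOpen (outside ρ) := isOpen_lt continuous_const continuous_norm

theorem mem_closure_outside {ρ : ℝ} (hρ : 0 < ρ) {w : ℂ} (hw : ‖w‖ = ρ) :
    w ∈ closure (outside ρ) := by
  have hc : Continuous fun t : ℝ => (1 + t : ℝ) * w := by fun_prop
  have hlim : Tendsto (fun t : ℝ => (1 + t : ℝ) * w) (𝓝[>] 0) (𝓝 w) := by
    have := hc.tendsto 0
    simp only [add_zero, Complex.ofReal_one, one_mul] at this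
    exact this.mono_left nhdsWithin_le_nhds
  refine mem_closure_of_tendsto hlim ?_
  filter_upwards [self_mem_nhdsWithin] with t (ht : 0 < t)
  change ρ < ‖_‖
  rw [norm_mul, hw, Complex.norm_real, Real.norm_eq_abs, abs_of_pos (by linarith)]
  nlinarith

section

variable {ψ : ℂ → ℂ} {ρ : ℝ} {s : ℕ} {Θ : Fin s → ℝ}

theorem ConditionA1.tendsto (hA1 : ConditionA1 ψ ρ Θ) {w : ℂ} (hw : ρ ≤ ‖w‖) :
    Tendsto ψ (𝓝[outside ρ] w) (𝓝 (ψ w)) :=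
  (hA1.continuousOn w hw).mono_left (nhdsWithin_mono _ (outside_subset_closedOutside ρ))

theorem ConditionA1.notMem_image (hA1 : ConditionA1 ψ ρ Θ) (hd : DifferentiableOn ℂ ψ (outside ρ))
    (hinj : InjOn ψ (outside ρ)) (hρ : 0 < ρ) {w : ℂ} (hw : ‖w‖ = ρ) : ψ w ∉ ψ '' outside ρ :=
  notMem_image_of_tendsto (isOpen_outside ρ) hd hinj (fun h : ρ < ‖w‖ => h.ne' hw)
    (mem_closure_outside hρ hw) (hA1.tendsto hw.ge)

end

section

variable {ψ : ℂ → ℂ} {ρ : ℝ} {s : ℕ} {Θ : Fin s → ℝ}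

open Complex in
/-- A logarithm of the increment of `ψ` at a boundary point, in the coordinate of the half
strip. -/
theorem ConditionA1.exists_log (hA1 : ConditionA1 ψ ρ Θ)
    (hd : DifferentiableOn ℂ ψ (outside ρ)) (hinj : InjOn ψ (outside ρ)) (hρ : 0 < ρ) (τ : ℝ)
    (hne₁ : ∀ᶠ θ in 𝓝[<] τ, ψ (circlePt ρ θ) ≠ ψ (circlePt ρ τ))
    (hne₂ : ∀ᶠ θ in 𝓝[>] τ, ψ (circlePt ρ θ) ≠ ψ (circlePt ρ τ)) :
    ∃ (Φ : ℂ → ℂ) (X : ℝ), HoloOnHalfStrip Φ X ∧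
      (∀ ζ ∈ halfStrip X, exp (Φ ζ) = ψ (cornerMap ρ τ ζ) - ψ (circlePt ρ τ)) ∧
      ∀ K : ℝ, ∃ Y : ℝ, ∀ ζ ∈ halfStrip Y, (Φ ζ).re ≤ K := by
  have hcm : Continuous (cornerMap ρ τ) := by unfold cornerMap; fun_prop
  have hcmd : Differentiable ℂ (cornerMap ρ τ) := by unfold cornerMap; fun_prop
  have hZ : ∀ X, HoloOnHalfStrip (fun ζ => ψ (cornerMap ρ τ ζ) - ψ (circlePt ρ τ)) X := by
    intro X
    refine ⟨(hA1.continuousOn.comp hcm.continuousOn fun ζ hζ =>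
      le_norm_cornerMap hρ.le τ hζ.2.1 hζ.2.2).sub continuousOn_const, fun ζ _ h1 h2 => ?_⟩
    have hmem := cornerMap_mem_outside hρ τ h1 h2
    exact (((hd _ hmem).differentiableAt ((isOpen_outside ρ).mem_nhds hmem)).comp ζ
      (hcmd ζ)).sub_const _
  obtain ⟨δ₁, hδ₁, h₁⟩ := (mem_nhdsLT_iff_exists_Ioo_subset).1 hne₁
  obtain ⟨δ₂, hδ₂, h₂⟩ := (mem_nhdsGT_iff_exists_Ioo_subset).1 hne₂
  rw [mem_Iio] at hδ₁
  rw [mem_Ioi] at hδ₂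
  set δ := min (τ - δ₁) (δ₂ - τ) with hδ
  have hδ0 : 0 < δ := lt_min (by linarith) (by linarith)
  set X := -Real.log δ + 1 with hX
  have hexp : ∀ ζ ∈ halfStrip X, Real.exp ζ.re < δ := by
    intro ζ hζ
    rw [← Real.lt_log_iff_exp_lt hδ0]
    linarith [hζ.1]
  have hne : ∀ ζ ∈ halfStrip X, ψ (cornerMap ρ τ ζ) - ψ (circlePt ρ τ) ≠ 0 := by
    intro ζ hζ
    rw [sub_ne_zero]
    have h3 := hexp ζ hζ
    have h4 := Real.exp_pos ζ.re
    rcases hζ.2.1.eq_or_lt with h | h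
    · rw [cornerMap_bottom ρ τ h.symm]
      exact h₁ ⟨by linarith [min_le_left (τ - δ₁) (δ₂ - τ)], by linarith⟩
    rcases hζ.2.2.eq_or_lt with h' | h'
    · rw [cornerMap_top ρ τ h']
      exact h₂ ⟨by linarith, by linarith [min_le_right (τ - δ₁) (δ₂ - τ)]⟩
    · intro heq
      exact hA1.notMem_image hd hinj hρ (norm_circlePt hρ.le τ)
        ⟨_, cornerMap_mem_outside hρ τ h h', heq⟩
  obtain ⟨Φ, hΦ, hΦe⟩ := exists_log_halfStrip (hZ X) hne
  refine ⟨Φ, X, hΦ, hΦe, fun K => ?_⟩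
  have hcont := hA1.continuousOn (circlePt ρ τ) (norm_circlePt hρ.le τ).ge
  obtain ⟨Y, hY⟩ := exists_forall_cornerMap hρ.le τ
    (Metric.tendsto_nhds.1 hcont (Real.exp K) (Real.exp_pos K))
  refine ⟨max X Y, fun ζ hζ => ?_⟩
  have h1 := hY ζ (halfStrip_subset (le_max_right _ _) hζ)
  rw [dist_eq_norm, ← hΦe ζ (halfStrip_subset (le_max_left _ _) hζ), norm_exp] at h1
  exact (Real.exp_lt_exp.1 h1).le

open Complex in
theorem tendsto_im_of_re_atBot {Φ ℓ : ℂ → ℂ} {r C Y a e : ℝ}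
    (hre : ∀ K : ℝ, ∃ Y : ℝ, ∀ ζ ∈ halfStrip Y, (Φ ζ).re ≤ K) (hC : 0 ≤ C)
    (hℓ : ∀ z ∈ Metric.ball (0 : ℂ) r, ‖ℓ z‖ ≤ C * ‖z‖)
    (hsmall : ∀ ζ ∈ halfStrip Y, ‖exp (Φ ζ)‖ < r) (he0 : 0 ≤ e) (he1 : e ≤ Real.pi)
    (hedge : ∀ ζ ∈ halfStrip Y, ζ.im = e → (Φ ζ + ℓ (exp (Φ ζ))).im = a) :
    Tendsto (fun x : ℝ => (Φ (x + e * I)).im) atBot (𝓝 a) := by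
  rw [Metric.tendsto_nhds]
  intro ε hε
  obtain ⟨Y₁, hY₁⟩ := hre (Real.log (ε / (C + 1)) - 1)
  filter_upwards [Iic_mem_atBot (-max Y Y₁)] with x hx
  have hmem : ∀ {Z}, Z ≤ max Y Y₁ → (x + e * I : ℂ) ∈ halfStrip Z := fun h =>
    ⟨by simpa using (mem_Iic.1 hx).trans (neg_le_neg h), by simpa using he0, by simpa using he1⟩
  have h1 := hedge _ (hmem (le_max_left _ _)) (by simp)
  have h2 := hℓ _ (mem_ball_zero_iff.2 (hsmall _ (hmem (le_max_left _ _))))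
  have h3 : ‖exp (Φ (x + e * I))‖ < ε / (C + 1) := by
    rw [norm_exp, ← Real.lt_log_iff_exp_lt (by positivity)]
    linarith [hY₁ _ (hmem (le_max_right _ _))]
  rw [dist_eq_norm, ← h1, add_im, sub_add_cancel_left, norm_neg, Real.norm_eq_abs]
  refine (abs_im_le_norm _).trans_lt (h2.trans_lt ?_)
  rw [lt_div_iff₀ (by positivity)] at h3
  nlinarith [norm_nonneg (exp (Φ (x + e * I)))]

open Complex in
theorem exp_eq_of_tendsto_direction {α : Type*} {l : Filter α} [l.NeBot] {g : α → ℂ} {a : ℝ}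
    {d : ℂ} (hg : Tendsto (fun x => (g x).im) l (𝓝 a))
    (hd : Tendsto (fun x => exp (g x) / (‖exp (g x)‖ : ℂ)) l (𝓝 d)) : exp (a * I) = d := by
  refine tendsto_nhds_unique (f := fun x => exp (((g x).im : ℂ) * I)) (l := l) ?_ ?_
  · have hc : Continuous fun t : ℝ => exp ((t : ℂ) * I) := by fun_prop
    exact (hc.tendsto a).comp hg
  · refine hd.congr fun x => ?_
    have h : (‖exp (g x)‖ : ℂ) = exp ((g x).re : ℂ) := by
      rw [norm_exp, ofReal_exp]
    rw [h, ← Complex.exp_sub]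
    congr 1
    rw [sub_eq_iff_eq_add, add_comm]
    exact (re_add_im _).symm

open Complex in
/-- The expansion `log (ψ(w) - ψ(ω)) = λ ζ + c + o(1)` at a corner. -/
theorem ConditionA1.exists_log_expansion (hA1 : ConditionA1 ψ ρ Θ)
    (hd : DifferentiableOn ℂ ψ (outside ρ)) (hinj : InjOn ψ (outside ρ)) (hρ : 0 < ρ)
    {τ lam : ℝ} (hτ : circlePt ρ τ ∈ range fun k => circlePt ρ (Θ k))
    (hangle : IsExteriorAngle ψ ρ τ (lam * Real.pi)) (h0 : lam ≠ 0) (h2 : lam ≠ 2) :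
    ∃ (Φ : ℂ → ℂ) (c : ℂ) (X : ℝ),
      (∀ ζ ∈ halfStrip X, exp (Φ ζ) = ψ (cornerMap ρ τ ζ) - ψ (circlePt ρ τ)) ∧
      ∀ ε > 0, ∃ X, ∀ ζ ∈ halfStrip X, ‖Φ ζ - lam * ζ - c‖ ≤ ε := by
  obtain ⟨E₁, hE₁, hE₁0, hE₁d, hedge₁, hom₁⟩ := hA1.exists_straightening_left hρ hτ
  obtain ⟨E₂, hE₂, hE₂0, hE₂d, hedge₂, hom₂⟩ := hA1.exists_straightening_right hρ hτ
  have hπ := Real.pi_pos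
  obtain ⟨Φ, X, hΦ, hΦe, hre⟩ := hA1.exists_log hd hinj hρ τ
    (hedge₁.mono fun θ h heq => by rw [heq, hE₁0] at h; simp at h)
    (hedge₂.mono fun θ h heq => by rw [heq, hE₂0] at h; simp at h)
  have hz : ∀ ζ ∈ halfStrip X, ψ (circlePt ρ τ) + exp (Φ ζ) = ψ (cornerMap ρ τ ζ) := by
    intro ζ hζ; rw [hΦe ζ hζ]; ring
  have hcont := hA1.continuousOn (circlePt ρ τ) (norm_circlePt hρ.le τ).ge
  obtain ⟨Y₁, hY₁⟩ := exists_forall_cornerMap hρ.le τ (hcont.eventually hom₁)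
  obtain ⟨Y₂, hY₂⟩ := exists_forall_cornerMap hρ.le τ (hcont.eventually hom₂)
  have hexp : Tendsto Real.exp atBot (𝓝[>] 0) := Real.tendsto_exp_atBot_nhdsGT
  have hleft : Tendsto (fun x : ℝ => τ - Real.exp x) atBot (𝓝[<] τ) := by
    rw [tendsto_nhdsWithin_iff]
    refine ⟨?_, Eventually.of_forall fun x => by simp [Real.exp_pos]⟩
    simpa using tendsto_const_nhds.sub (hexp.mono_right nhdsWithin_le_nhds)
  have hright : Tendsto (fun x : ℝ => τ + Real.exp x) atBot (𝓝[>] τ) := by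
    rw [tendsto_nhdsWithin_iff]
    refine ⟨?_, Eventually.of_forall fun x => by simp [Real.exp_pos]⟩
    simpa using tendsto_const_nhds.add (hexp.mono_right nhdsWithin_le_nhds)
  obtain ⟨T₁, hT₁⟩ := eventually_atBot.1 (hleft.eventually hedge₁)
  obtain ⟨T₂, hT₂⟩ := eventually_atBot.1 (hright.eventually hedge₂)
  set M := max (max X (max Y₁ Y₂)) (max (-T₁) (-T₂)) with hM
  have hXM : X ≤ M := (le_max_left _ _).trans (le_max_left _ _)
  have hY₁M : Y₁ ≤ M := (le_max_left _ _).trans ((le_max_right _ _).trans (le_max_left _ _))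
  have hY₂M : Y₂ ≤ M := (le_max_right _ _).trans ((le_max_right _ _).trans (le_max_left _ _))
  have hT₁M : -M ≤ T₁ := by
    linarith [(le_max_left (-T₁) (-T₂)).trans (le_max_right (max X (max Y₁ Y₂)) _)]
  have hT₂M : -M ≤ T₂ := by
    linarith [(le_max_right (-T₁) (-T₂)).trans (le_max_right (max X (max Y₁ Y₂)) _)]
  -- A boundary value of the univalent ψ is not attained in the exterior; this supplies the omitted
  -- rays on both edges.
  have hnot : ∀ ζ ∈ halfStrip M, 0 < ζ.im → ζ.im < Real.pi →
      ψ (cornerMap ρ τ ζ) ∉ range fun θ => ψ (circlePt ρ θ) := by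
    rintro ζ - h1 h2 ⟨θ, hθ⟩
    exact hA1.notMem_image hd hinj hρ (norm_circlePt hρ.le θ)
      ⟨_, cornerMap_mem_outside hρ τ h1 h2, hθ.symm⟩
  obtain ⟨ℓ₁, r₁, C₁, Z₁, a, hMZ₁, hr₁, hC₁, hℓd₁, hℓC₁, hsm₁, hbot, hbd₁⟩ :=
    exists_edge_correction (hΦ.mono hXM) hre hE₁ hE₁0 hE₁d le_rfl hπ.le
      (fun ζ hζ h => by
        rw [hz ζ (halfStrip_subset hXM hζ), cornerMap_bottom ρ τ h]
        exact hT₁ _ (hζ.1.trans hT₁M))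
      (fun ζ hζ h1 h2 h3 h4 => by
        rw [hz ζ (halfStrip_subset hXM hζ)] at h3 h4
        exact hnot ζ hζ h1 h2 (hY₁ ζ (halfStrip_subset hY₁M hζ) h3 h4))
  obtain ⟨ℓ₂, r₂, C₂, Z₂, b, hMZ₂, hr₂, hC₂, hℓd₂, hℓC₂, hsm₂, htop, hbd₂⟩ :=
    exists_edge_correction (hΦ.mono hXM) hre hE₂ hE₂0 hE₂d hπ.le le_rfl
      (fun ζ hζ h => by
        rw [hz ζ (halfStrip_subset hXM hζ), cornerMap_top ρ τ h]
        exact hT₂ _ (hζ.1.trans hT₂M))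
      (fun ζ hζ h1 h2 h3 h4 => by
        rw [hz ζ (halfStrip_subset hXM hζ)] at h3 h4
        exact hnot ζ hζ h1 h2 (hY₂ ζ (halfStrip_subset hY₂M hζ) h3 h4))
  set Z := max Z₁ Z₂ with hZ
  set r := min r₁ r₂ with hr
  obtain ⟨W, hW⟩ := hre (Real.log r - 1)
  have hr0 : 0 < r := lt_min hr₁ hr₂
  set N := max Z W
  have hs₁ : halfStrip N ⊆ halfStrip Z₁ :=
    halfStrip_subset ((le_max_left _ _).trans (le_max_left _ _))
  have hs₂ : halfStrip N ⊆ halfStrip Z₂ :=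
    halfStrip_subset ((le_max_right _ _).trans (le_max_left _ _))
  have hXN : X ≤ N := hXM.trans (hMZ₁.trans ((le_max_left _ _).trans (le_max_left _ _)))
  have hdata : CornerData Φ ℓ₁ ℓ₂ N (2 * Real.pi + |a| + C₁ * r₁) (max C₁ C₂) r a b :=
    { holo := hΦ.mono hXN
      re_le := hre
      im_le := fun ζ hζ => by
        have h1 := hbd₁ ζ (hs₁ hζ)
        have h2 := hsm₁ ζ (hs₁ hζ)
        have h3 := (abs_im_le_norm _).trans (hℓC₁ _ (mem_ball_zero_iff.2 h2))
        have h4 : C₁ * ‖exp (Φ ζ)‖ ≤ C₁ * r₁ := mul_le_mul_of_nonneg_left h2.le hC₁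
        rw [add_im, abs_le] at h1
        rw [abs_le] at h3 ⊢
        constructor <;> linarith [neg_abs_le a, le_abs_self a]
      norm_exp_lt := fun ζ hζ => by
        rw [norm_exp, ← Real.lt_log_iff_exp_lt hr0]
        linarith [hW ζ (halfStrip_subset (le_max_right _ _) hζ)]
      C_nonneg := hC₁.trans (le_max_left _ _)
      diff₁ := hℓd₁.mono (Metric.ball_subset_ball (min_le_left _ _))
      diff₂ := hℓd₂.mono (Metric.ball_subset_ball (min_le_right _ _))
      le₁ := fun z hz => (hℓC₁ z (Metric.ball_subset_ball (min_le_left _ _) hz)).trans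
        (mul_le_mul_of_nonneg_right (le_max_left _ _) (norm_nonneg _))
      le₂ := fun z hz => (hℓC₂ z (Metric.ball_subset_ball (min_le_right _ _) hz)).trans
        (mul_le_mul_of_nonneg_right (le_max_right _ _) (norm_nonneg _))
      bottom := fun ζ hζ h => hbot ζ (hs₁ hζ) h
      top := fun ζ hζ h => htop ζ (hs₂ hζ) h }
  obtain ⟨⟨hl0, hl2⟩, β, hβ₁, hβ₂⟩ := hangle
  have hta := tendsto_im_of_re_atBot hre hC₁ hℓC₁ hsm₁ le_rfl hπ.le hbot
  have htb := tendsto_im_of_re_atBot hre hC₂ hℓC₂ hsm₂ hπ.le le_rfl htop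
  have hmemX : ∀ {e : ℝ}, 0 ≤ e → e ≤ Real.pi → ∀ x : ℝ, x ≤ -X → (x + e * I : ℂ) ∈ halfStrip X :=
    fun he0 he1 x hx => ⟨by simpa using hx, by simpa using he0, by simpa using he1⟩
  have hexpa : exp (a * I) = exp (β * I) := by
    refine exp_eq_of_tendsto_direction hta ((hβ₁.comp hleft).congr' ?_)
    filter_upwards [Iic_mem_atBot (-X)] with x hx
    have hm := hmemX le_rfl hπ.le x hx
    rw [hΦe _ hm, cornerMap_bottom ρ τ (by simp)]
    simp
  have hexpb : exp (b * I) = exp ((β + lam * Real.pi : ℝ) * I) := by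
    refine exp_eq_of_tendsto_direction htb ((hβ₂.comp hright).congr' ?_)
    filter_upwards [Iic_mem_atBot (-X)] with x hx
    have hm := hmemX hπ.le le_rfl x hx
    rw [hΦe _ hm, cornerMap_top ρ τ (by simp)]
    simp
  -- The bound around the bottom value a holds on the whole strip; it is evaluated along the top
  -- edge, where Im Φ tends to b.
  have hba : |b - a| ≤ 2 * Real.pi := by
    have hcorr : Tendsto (fun x : ℝ => (ℓ₁ (exp (Φ (x + Real.pi * I)))).im) atBot (𝓝 0) := by
      refine squeeze_zero_norm' (a := fun x : ℝ => C₁ * ‖exp (Φ (x + Real.pi * I))‖) ?_ ?_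
      · filter_upwards [Iic_mem_atBot (-Z₁)] with x hx
        have hm : (x + Real.pi * I : ℂ) ∈ halfStrip Z₁ :=
          ⟨by simpa using hx, by simpa using hπ.le, by simp⟩
        exact (abs_im_le_norm _).trans (hℓC₁ _ (mem_ball_zero_iff.2 (hsm₁ _ hm)))
      · rw [show (0 : ℝ) = C₁ * 0 by simp]
        refine Tendsto.const_mul C₁ ?_
        simp only [norm_exp]
        refine Real.tendsto_exp_atBot.comp (tendsto_atBot.2 fun K => ?_)
        obtain ⟨V, hV⟩ := hre K
        filter_upwards [Iic_mem_atBot (-V)] with x hx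
        exact hV _ ⟨by simpa using hx, by simpa using hπ.le, by simp⟩
    have hlim := ((htb.add hcorr).sub_const a).abs
    rw [add_zero] at hlim
    refine le_of_tendsto hlim ?_
    filter_upwards [Iic_mem_atBot (-Z₁)] with x hx
    have := hbd₁ (x + Real.pi * I) ⟨by simpa using hx, by simpa using hπ.le, by simp⟩
    rwa [add_im] at this
  obtain ⟨n₁, hn₁⟩ := Complex.exp_eq_exp_iff_exists_int.1 hexpa
  obtain ⟨n₂, hn₂⟩ := Complex.exp_eq_exp_iff_exists_int.1 hexpb
  have hna : a = β + n₁ * (2 * Real.pi) := by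
    have : (a : ℂ) = β + n₁ * (2 * Real.pi) := mul_right_cancel₀ I_ne_zero (by rw [hn₁]; ring)
    exact_mod_cast this
  have hnb : b = β + lam * Real.pi + n₂ * (2 * Real.pi) := by
    have : (b : ℂ) = (β + lam * Real.pi : ℝ) + n₂ * (2 * Real.pi) :=
      mul_right_cancel₀ I_ne_zero (by rw [hn₂]; ring)
    exact_mod_cast this
  have hl0' : 0 < lam := lt_of_le_of_ne (nonneg_of_mul_nonneg_left hl0 hπ) (Ne.symm h0)
  have hl2' : lam < 2 := lt_of_le_of_ne (le_of_mul_le_mul_right hl2 hπ) h2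
  -- Directions determine a and b only modulo 2π, leaving an integer n. As 0 < λ < 2, a = b is
  -- impossible; then a < b and b - a ≤ 2π force n = 0.
  have hdiff : b - a = (lam + 2 * ((n₂ - n₁ : ℤ) : ℝ)) * Real.pi := by
    rw [hna, hnb]; push_cast; ring
  set n := n₂ - n₁
  have hne : a ≠ b := by
    intro h
    rw [h, sub_self] at hdiff
    have h3 : lam + 2 * (n : ℝ) = 0 := (mul_eq_zero.1 hdiff.symm).resolve_right hπ.ne'
    have h4 : (-1 : ℝ) < n := by linarith
    have h5 : (n : ℝ) < 0 := by linarith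
    have h6 : -1 < n := by exact_mod_cast h4
    have h7 : n < 0 := by exact_mod_cast h5
    omega
  have hlt := hdata.lt_of_ne hne
  have hn : n = 0 := by
    have h3 : 0 < lam + 2 * (n : ℝ) := pos_of_mul_pos_left (by rw [← hdiff]; linarith) hπ.le
    have h4 : lam + 2 * (n : ℝ) ≤ 2 := by
      refine le_of_mul_le_mul_right ?_ hπ
      rw [← hdiff]; exact (abs_le.1 hba).2
    have h5 : (-1 : ℝ) < n := by linarith
    have h6 : (n : ℝ) < 1 := by linarith
    have h7 : -1 < n := by exact_mod_cast h5
    have h8 : n < 1 := by exact_mod_cast h6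
    omega
  rw [hn, Int.cast_zero, mul_zero, add_zero] at hdiff
  obtain ⟨c, hc⟩ := hdata.exists_limit hdiff.symm hl0'
  exact ⟨Φ, c, X, hΦe, hc⟩

end

open Complex in
theorem tendsto_log_div_sub_one :
    Tendsto (fun v : ℂ => log v / (v - 1)) (𝓝[≠] 1) (𝓝 1) := by
  have h := (hasDerivAt_log (z := 1) one_mem_slitPlane).tendsto_slope
  rw [inv_one] at h
  refine h.congr fun v => ?_
  simp [slope, div_eq_inv_mul]

theorem neBot_nhdsWithin_outside {ρ : ℝ} (hρ : 0 < ρ) {w : ℂ} (hw : ‖w‖ = ρ) :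
    (𝓝[outside ρ] w).NeBot :=
  mem_closure_iff_nhdsWithin_neBot.1 (mem_closure_outside hρ hw)

section

variable {ψ : ℂ → ℂ} {ρ : ℝ} {s : ℕ} {Θ : Fin s → ℝ}

open Complex in
-- The corner map is inverted by ζ = log(i log(w/ω)), and w - ω agrees with ω log(w/ω) up to a
-- factor κ → 1. Hence (w - ω)^λ is a constant times e^{λζ + o(1)}, and the expansion of Φ makes the
-- quotient converge to an exponential.
theorem ConditionA1.exists_tendsto_div_branchPow (hA1 : ConditionA1 ψ ρ Θ)
    (hd : DifferentiableOn ℂ ψ (outside ρ)) (hinj : InjOn ψ (outside ρ)) (hρ : 0 < ρ)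
    {τ lam : ℝ} (hτ : circlePt ρ τ ∈ range fun k => circlePt ρ (Θ k))
    (hangle : IsExteriorAngle ψ ρ τ (lam * Real.pi)) (h0 : lam ≠ 0) (h2 : lam ≠ 2) :
    ∃ c : ℂ, Tendsto (fun w => (ψ w - ψ (circlePt ρ τ)) / branchPow ρ τ lam w)
      (𝓝[outside ρ] (circlePt ρ τ)) (𝓝 (exp c)) := by
  obtain ⟨Φ, c, X, hΦ, hc⟩ := hA1.exists_log_expansion hd hinj hρ hτ hangle h0 h2
  set ω := circlePt ρ τ with hω
  have hωn : ‖ω‖ = ρ := norm_circlePt hρ.le τ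
  have hω0 : ω ≠ 0 := norm_pos_iff.1 (hωn ▸ hρ)
  set l := 𝓝[outside ρ] ω with hl
  have hv : Tendsto (fun w => w / ω) l (𝓝[≠] 1) := by
    rw [tendsto_nhdsWithin_iff]
    refine ⟨?_, ?_⟩
    · have h := (continuous_id.div_const ω).tendsto ω
      rw [id, div_self hω0] at h
      exact h.mono_left nhdsWithin_le_nhds
    · filter_upwards [self_mem_nhdsWithin] with w (hw : ρ < ‖w‖) h
      have h1 : w = ω := by rw [mem_singleton_iff, div_eq_one_iff_eq hω0] at h; exact h
      rw [h1, hωn] at hw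
      exact lt_irrefl _ hw
  have hnorm : ∀ᶠ w in l, 1 < ‖w / ω‖ := by
    filter_upwards [self_mem_nhdsWithin] with w (hw : ρ < ‖w‖)
    rwa [norm_div, hωn, one_lt_div hρ]
  set κ : ℂ → ℂ := fun w => (w / ω - 1) / log (w / ω) with hκ
  have hκlim : Tendsto κ l (𝓝 1) := by
    have h := (tendsto_log_div_sub_one.comp hv).inv₀ one_ne_zero
    rw [inv_one] at h
    exact h.congr fun w => by simp [hκ]
  have hlogκ : Tendsto (fun w => log (κ w)) l (𝓝 0) := by
    have h := (continuousAt_clog one_mem_slitPlane).tendsto.comp hκlim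
    rwa [log_one] at h
  set ζ : ℂ → ℂ := fun w => log (I * log (w / ω)) with hζ
  have hlog0 : Tendsto (fun w => ‖log (w / ω)‖) l (𝓝 0) := by
    have h := ((continuousAt_clog one_mem_slitPlane).tendsto.comp
      (hv.mono_right nhdsWithin_le_nhds)).norm
    simpa using h
  have him : ∀ᶠ w in l, log (w / ω) ≠ 0 ∧ 0 < (ζ w).im ∧ (ζ w).im < Real.pi := by
    filter_upwards [hnorm] with w hw
    have h1 : 0 < (log (w / ω)).re := by rw [log_re]; exact Real.log_pos hw
    have h2 : 0 < (I * log (w / ω)).im := by simpa using h1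
    refine ⟨fun h => by simp [h] at h1, ?_, ?_⟩
    · rw [hζ, log_im]
      exact lt_of_le_of_ne (arg_nonneg_iff.2 h2.le) fun h => by
        rw [eq_comm, arg_eq_zero_iff] at h
        exact h2.ne' h.2
    · rw [hζ, log_im]
      exact lt_of_le_of_ne (arg_le_pi _) fun h => h2.ne' (arg_eq_pi_iff.1 h).2
  have hstrip : ∀ Y, ∀ᶠ w in l, ζ w ∈ halfStrip Y := by
    intro Y
    filter_upwards [him, hlog0.eventually (gt_mem_nhds (Real.exp_pos (-Y)))] with w hw hw2
    refine ⟨?_, hw.2.1.le, hw.2.2.le⟩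
    rw [hζ, log_re, norm_mul, norm_I, one_mul, Real.log_le_iff_le_exp (norm_pos_iff.2 hw.1)]
    exact hw2.le
  have hmap : ∀ᶠ w in l, cornerMap ρ τ (ζ w) = w := by
    filter_upwards [him, hnorm] with w hw hw2
    have hw0 : w / ω ≠ 0 := norm_pos_iff.1 (one_pos.trans hw2)
    rw [cornerMap, ← hω, hζ, exp_log (mul_ne_zero I_ne_zero hw.1), ← mul_assoc, neg_mul, I_mul_I,
      neg_neg, one_mul, exp_log hw0]
    field_simp
  have hpow : ∀ᶠ w in l, branchPow ρ τ lam w = exp (lam * τ * I +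
      lam * (Real.log ρ + ζ w - (Real.pi / 2 : ℝ) * I + log (κ w))) := by
    have hsm : ∀ᶠ w in l, ‖log (κ w)‖ < 1 := by
      have := hlogκ.norm
      rw [norm_zero] at this
      exact this.eventually (gt_mem_nhds one_pos)
    filter_upwards [him, hnorm, hsm, hκlim.eventually_ne one_ne_zero] with w hw hw2 hw3 hw4
    have h1 : exp (Real.log ρ + ζ w - (Real.pi / 2 : ℝ) * I + log (κ w)) =
        (w - ω) * exp (-(τ * I)) := by
      rw [Complex.exp_add, Complex.exp_sub, Complex.exp_add, exp_log hw4, hζ,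
        exp_log (mul_ne_zero I_ne_zero hw.1), ← ofReal_exp, Real.exp_log hρ]
      push_cast
      rw [exp_pi_div_two_mul_I, hκ]
      have h3 : log (w / ω) ≠ 0 := hw.1
      have h4 : ω * exp (-(τ * I)) = ρ := by
        rw [hω, circlePt, mul_assoc, ← Complex.exp_add]; simp
      have h5 : (ρ : ℂ) * (I * log (w / ω)) / I * ((w / ω - 1) / log (w / ω)) =
          ρ * (w / ω - 1) := by
        field_simp
      rw [h5, ← h4]
      field_simp
    have h2 : log ((w - ω) * exp (-(τ * I))) =
        Real.log ρ + ζ w - (Real.pi / 2 : ℝ) * I + log (κ w) := by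
      -- Im ζ - π/2 lies in (-π/2, π/2) and the logarithm of κ is small, so the principal branch is
      -- the prescribed one.
      have h3 := abs_lt.1 ((abs_im_le_norm _).trans_lt hw3)
      have hπ := Real.pi_gt_three
      have h4 : (Real.log ρ + ζ w - (Real.pi / 2 : ℝ) * I + log (κ w)).im =
          (ζ w).im - Real.pi / 2 + (log (κ w)).im := by simp
      rw [← h1, log_exp] <;> rw [h4] <;> linarith [hw.2.1, hw.2.2]
    have h5 : (w - ω) * exp (-(τ * I)) ≠ 0 := h1 ▸ Complex.exp_ne_zero _
    rw [branchPow, ← hω, cpow_def_of_ne_zero h5, h2, ← Complex.exp_add]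
    congr 1
    ring
  have hlim : Tendsto (fun w => Φ (ζ w) - lam * ζ w) l (𝓝 c) := by
    rw [Metric.tendsto_nhds]
    intro ε hε
    obtain ⟨Y, hY⟩ := hc (ε / 2) (half_pos hε)
    filter_upwards [hstrip Y] with w hw
    rw [dist_eq_norm]
    linarith [hY _ hw]
  set c' := c - lam * τ * I - lam * Real.log ρ + lam * (Real.pi / 2 : ℝ) * I with hc'
  refine ⟨c', ?_⟩
  have hlim2 : Tendsto (fun w => (Φ (ζ w) - lam * ζ w) - lam * τ * I - lam * Real.log ρ +
      lam * (Real.pi / 2 : ℝ) * I - lam * log (κ w)) l (𝓝 c') := by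
    have := (((hlim.sub_const (lam * τ * I)).sub_const (lam * Real.log ρ)).add_const
      (lam * (Real.pi / 2 : ℝ) * I)).sub (hlogκ.const_mul (lam : ℂ))
    simpa [hc'] using this
  refine ((continuous_exp.tendsto c').comp hlim2).congr' ?_
  filter_upwards [hstrip X, hmap, hpow] with w h1 h3 h4
  have h5 := hΦ _ h1
  rw [h3] at h5
  rw [← h5, h4, ← Complex.exp_sub, Function.comp]
  congr 1
  ring

theorem ConditionA1.cornerCoeff_ne_zero (hA1 : ConditionA1 ψ ρ Θ)
    (hd : DifferentiableOn ℂ ψ (outside ρ)) (hinj : InjOn ψ (outside ρ)) (hρ : 0 < ρ)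
    {τ lam : ℝ} (hτ : circlePt ρ τ ∈ range fun k => circlePt ρ (Θ k))
    (hangle : IsExteriorAngle ψ ρ τ (lam * Real.pi)) (h0 : lam ≠ 0) (h2 : lam ≠ 2) :
    cornerCoeff ψ ρ τ lam ≠ 0 := by
  obtain ⟨c, hc⟩ := hA1.exists_tendsto_div_branchPow hd hinj hρ hτ hangle h0 h2
  have := neBot_nhdsWithin_outside hρ (norm_circlePt hρ.le τ)
  -- `limUnder` is meaningful here only because convergence has been established.
  rw [cornerCoeff, hc.limUnder_eq]
  exact Complex.exp_ne_zero c

end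

/-! ### The Jordan curve, ρ < 1 and the inclusion of G_ρ in G_1. -/

section Components

variable {L : Set ℂ}

theorem isOpen_interiorDomain (hL : IsClosed L) : IsOpen (interiorDomain L) := by
  rw [isOpen_iff_mem_nhds]
  intro z hz
  have ho := hL.isOpen_compl.connectedComponentIn (x := z)
  refine mem_of_superset (ho.mem_nhds (mem_connectedComponentIn hz.1)) fun y hy => ?_
  refine ⟨connectedComponentIn_subset _ _ hy, ?_⟩
  rw [← connectedComponentIn_eq hy]
  exact hz.2

theorem mem_interiorDomain_iff {z : ℂ} : z ∈ interiorDomain L ↔ z ∉ L ∧ z ∉ exteriorDomain L := by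
  constructor
  · exact fun h => ⟨h.1, fun h' => h'.2 h.2⟩
  · exact fun h => ⟨h.1, by_contra fun hb => h.2 ⟨h.1, hb⟩⟩

theorem closure_exteriorDomain_subset (hL : IsClosed L) :
    closure (exteriorDomain L) ⊆ exteriorDomain L ∪ L := by
  have h : exteriorDomain L ∪ L = (interiorDomain L)ᶜ := by
    ext z
    rw [mem_compl_iff, mem_interiorDomain_iff, mem_union]
    tauto
  refine closure_minimal subset_union_left ?_
  rw [h]
  exact (isOpen_interiorDomain hL).isClosed_compl

end Components

theorem IsAnalyticJordanCurve.isClosed {L : Set ℂ} (hL : IsAnalyticJordanCurve L) : IsClosed L := by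
  obtain ⟨γ, hγ, -, -, rfl⟩ := hL
  exact ((isCompact_sphere 0 1).image_of_continuousOn hγ.continuousOn).isClosed

theorem tendsto_of_tendsto_comp_of_injOn {X Y α : Type*} [TopologicalSpace X]
    [TopologicalSpace Y] [T2Space Y] {K : Set X} (hK : IsCompact K) {γ : X → Y}
    (hγ : ContinuousOn γ K) (hinj : InjOn γ K) {l : Filter α} {t : α → X} {x : X} (hx : x ∈ K)
    (ht : ∀ a, t a ∈ K) (h : Tendsto (fun a => γ (t a)) l (𝓝 (γ x))) : Tendsto t l (𝓝 x) := by
  have : CompactSpace K := isCompact_iff_compactSpace.1 hK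
  have hemb : IsClosedEmbedding (K.domRestrict γ) :=
    Continuous.isClosedEmbedding (continuousOn_iff_continuous_domRestrict.1 hγ) hinj.injective
  have h2 : Tendsto (fun a => (⟨t a, ht a⟩ : K)) l (𝓝 ⟨x, hx⟩) := by
    rw [hemb.isInducing.tendsto_nhds_iff]
    exact h
  exact (continuous_subtype_val.tendsto (⟨x, hx⟩ : K)).comp h2

open Complex ComplexConjugate in
-- The squared direction of a chord of the unit circle is -tξ, which is continuous as t → ξ:
-- squaring removes the sign distinguishing the two sides.
theorem sub_sq_of_norm_eq_one {t ξ : ℂ} (ht : ‖t‖ = 1) (hξ : ‖ξ‖ = 1) :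
    (t - ξ) ^ 2 = -(t * ξ) * (‖t - ξ‖ : ℂ) ^ 2 := by
  have h1 : t * conj t = 1 := by rw [mul_conj, normSq_eq_norm_sq, ht]; simp
  have h2 : ξ * conj ξ = 1 := by rw [mul_conj, normSq_eq_norm_sq, hξ]; simp
  have h3 : (‖t - ξ‖ : ℂ) ^ 2 = (t - ξ) * conj (t - ξ) := by
    rw [mul_conj, normSq_eq_norm_sq]; push_cast; ring
  rw [h3, map_sub]
  linear_combination (t * ξ - ξ ^ 2) * h1 - (t ^ 2 - t * ξ) * h2

/-- An analytic Jordan curve has a tangent line at each of its points. -/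
theorem IsAnalyticJordanCurve.exists_tendsto_direction_sq {L : Set ℂ}
    (hL : IsAnalyticJordanCurve L) {z₀ : ℂ} (hz₀ : z₀ ∈ L) :
    ∃ D : ℂ, ∀ {α : Type} {l : Filter α} {g : α → ℂ}, (∀ x, g x ∈ L) → Tendsto g l (𝓝 z₀) →
      (∀ᶠ x in l, g x ≠ z₀) →
      Tendsto (fun x => ((g x - z₀) / (‖g x - z₀‖ : ℂ)) ^ 2) l (𝓝 D) := by
  obtain ⟨γ, hγ, hinj, hder, rfl⟩ := hL
  obtain ⟨ξ, hξ, rfl⟩ := hz₀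
  have hd : HasDerivAt γ (deriv γ ξ) ξ := (hγ ξ hξ).differentiableAt.hasDerivAt
  have hξ1 : ‖ξ‖ = 1 := mem_sphere_zero_iff_norm.1 hξ
  refine ⟨(deriv γ ξ / (‖deriv γ ξ‖ : ℂ)) ^ 2 * -(ξ * ξ), fun {α l g} hg hlim hne => ?_⟩
  choose t ht hgt using hg
  have htξ : Tendsto t l (𝓝 ξ) := by
    refine tendsto_of_tendsto_comp_of_injOn (isCompact_sphere 0 1) hγ.continuousOn hinj hξ ht ?_
    simpa [hgt] using hlim
  have hne' : ∀ᶠ x in l, t x ≠ ξ := hne.mono fun x hx h => hx (by rw [← hgt, h])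
  have hslope : Tendsto (fun x => slope γ ξ (t x)) l (𝓝 (deriv γ ξ)) :=
    hd.tendsto_slope.comp (tendsto_nhdsWithin_iff.2 ⟨htξ, hne'⟩)
  have hn : (‖deriv γ ξ‖ : ℂ) ≠ 0 := by exact_mod_cast norm_ne_zero_iff.2 (hder ξ hξ)
  have h1 : Tendsto (fun x => (slope γ ξ (t x) / (‖slope γ ξ (t x)‖ : ℂ)) ^ 2 * -(t x * ξ)) l
      (𝓝 ((deriv γ ξ / (‖deriv γ ξ‖ : ℂ)) ^ 2 * -(ξ * ξ))) := by
    refine ((hslope.div ((Complex.continuous_ofReal.tendsto _).comp hslope.norm) hn).pow 2).mul ?_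
    exact (htξ.mul_const ξ).neg
  refine h1.congr' ?_
  filter_upwards [hne, hne'] with x hx hx'
  have h2 : g x - γ ξ = slope γ ξ (t x) * (t x - ξ) := by
    rw [slope, vsub_eq_sub, smul_eq_mul, hgt]
    field_simp [sub_ne_zero.2 hx']
  have hs : slope γ ξ (t x) ≠ 0 := fun h => hx (by rw [h, zero_mul, sub_eq_zero] at h2; exact h2)
  have h3 : (‖slope γ ξ (t x)‖ : ℂ) ≠ 0 := by exact_mod_cast norm_ne_zero_iff.2 hs
  have h4 : (‖t x - ξ‖ : ℂ) ≠ 0 := by exact_mod_cast norm_ne_zero_iff.2 (sub_ne_zero.2 hx')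
  rw [h2, norm_mul, Complex.ofReal_mul, div_pow, div_pow, mul_pow, mul_pow,
    sub_sq_of_norm_eq_one (mem_sphere_zero_iff_norm.1 (ht x)) hξ1]
  field_simp

open Complex in
/-- A continuous injective self-map of the unit circle is onto. -/
theorem surjOn_sphere_of_injOn {h : ℂ → ℂ} (hc : ContinuousOn h (Metric.sphere 0 1))
    (hm : MapsTo h (Metric.sphere 0 1) (Metric.sphere 0 1))
    (hinj : InjOn h (Metric.sphere 0 1)) : SurjOn h (Metric.sphere 0 1) (Metric.sphere 0 1) := by
  intro ξ hξ
  by_contra hno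
  have hξ1 : ‖ξ‖ = 1 := mem_sphere_zero_iff_norm.1 hξ
  have hξ0 : ξ ≠ 0 := norm_pos_iff.1 (by rw [hξ1]; exact one_pos)
  have hcp : ∀ t, circlePt 1 t ∈ Metric.sphere (0 : ℂ) 1 := fun t =>
    mem_sphere_zero_iff_norm.2 (norm_circlePt zero_le_one t)
  -- If ξ is omitted, this argument never jumps, so it is a continuous periodic real function. The
  -- difference of its values at antipodal points changes sign, hence vanishes somewhere, and two
  -- antipodal points have the same image.
  set G : ℝ → ℝ := fun t => arg (-h (circlePt 1 t) / ξ) with hG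
  have hn : ∀ t, ‖-h (circlePt 1 t) / ξ‖ = 1 := fun t => by
    rw [norm_div, norm_neg, mem_sphere_zero_iff_norm.1 (hm (hcp t)), hξ1, div_one]
  have hGc : Continuous G := by
    rw [continuous_iff_continuousAt]
    intro t
    have h1 : Continuous fun t => -h (circlePt 1 t) / ξ :=
      ((hc.comp_continuous (continuous_circlePt 1) hcp).neg).div_const ξ
    refine ContinuousAt.comp (g := arg) (continuousAt_arg ?_) h1.continuousAt
    rw [mem_slitPlane_iff_arg]
    refine ⟨fun harg => hno ⟨circlePt 1 t, hcp t, ?_⟩, fun h0 => by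
      have := hn t; rw [h0] at this; simp at this⟩
    have h2 := norm_mul_exp_arg_mul_I (-h (circlePt 1 t) / ξ)
    rw [harg, hn, exp_pi_mul_I, ofReal_one, one_mul, eq_div_iff hξ0] at h2
    linear_combination h2
  have hper : G (0 + Real.pi + Real.pi) = G 0 := by
    have : (0 : ℝ) + Real.pi + Real.pi = 0 + 2 * Real.pi := by ring
    rw [hG]; simp only
    rw [this, circlePt_add_two_pi]
  have hdc : Continuous fun t => G t - G (t + Real.pi) := by fun_prop
  obtain ⟨t, ht⟩ : ∃ t, G t - G (t + Real.pi) = 0 := by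
    have hpc := isPreconnected_univ (α := ℝ)
    rcases le_total (G 0 - G (0 + Real.pi)) 0 with h1 | h1
    · have := hpc.intermediate_value (mem_univ 0) (mem_univ (0 + Real.pi)) hdc.continuousOn
        (show (0 : ℝ) ∈ Icc _ _ from ⟨h1, by rw [hper]; linarith⟩)
      obtain ⟨t, -, ht⟩ := this
      exact ⟨t, ht⟩
    · have := hpc.intermediate_value (mem_univ (0 + Real.pi)) (mem_univ 0) hdc.continuousOn
        (show (0 : ℝ) ∈ Icc _ _ from ⟨by rw [hper]; linarith, h1⟩)
      obtain ⟨t, -, ht⟩ := this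
      exact ⟨t, ht⟩
  have h2 : -h (circlePt 1 t) / ξ = -h (circlePt 1 (t + Real.pi)) / ξ :=
    Complex.ext_norm_arg (by rw [hn, hn]) (sub_eq_zero.1 ht)
  rw [div_left_inj' hξ0, neg_inj] at h2
  have h3 := hinj (hcp _) (hcp _) h2
  obtain ⟨n, h4⟩ := (circlePt_eq_iff one_ne_zero).1 h3
  have h5 : (1 + 2 * n : ℝ) = 0 := by
    apply mul_left_cancel₀ Real.pi_ne_zero
    linarith
  have h6 : (1 + 2 * n : ℤ) = 0 := by exact_mod_cast h5
  omega

section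

variable {L : Set ℂ} {ψ : ℂ → ℂ} {ρ : ℝ} {s : ℕ} {Θ lam : Fin s → ℝ}

theorem IsExteriorMap.le_one (hψ : IsExteriorMap L ψ ρ) : ρ ≤ 1 :=
  hψ.isLeast.2 ⟨zero_le_one, ψ, hψ.differentiableOn_one, hψ.injOn_one, fun _ _ => rfl⟩

theorem IsExteriorMap.pos (hψ : IsExteriorMap L ψ ρ) {τ α : ℝ} (hα : IsExteriorAngle ψ ρ τ α) :
    0 < ρ := by
  refine lt_of_le_of_ne hψ.isLeast.1.1 fun h => ?_
  obtain ⟨-, β, hβ, -⟩ := hα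
  have h0 : ∀ θ, circlePt ρ θ = 0 := fun θ => by rw [circlePt, ← h]; simp
  -- For ρ = 0 all the directions are 0/0 = 0, which cannot tend to a point of the unit circle.
  simp only [h0, sub_self, norm_zero, Complex.ofReal_zero, div_zero] at hβ
  exact Complex.exp_ne_zero _ (tendsto_nhds_unique hβ tendsto_const_nhds)

theorem image_mem_of_norm_eq_one (hL : IsAnalyticJordanCurve L) (hψ : IsExteriorMap L ψ ρ)
    (hA1 : ConditionA1 ψ ρ Θ) {w : ℂ} (hw : ‖w‖ = 1) : ψ w ∈ L := by
  have hlim : Tendsto ψ (𝓝[outside 1] w) (𝓝 (ψ w)) :=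
    (hA1.continuousOn w (hψ.le_one.trans hw.ge)).mono_left
      (nhdsWithin_mono _ fun x (hx : 1 < ‖x‖) => hψ.le_one.trans hx.le)
  have hcl := mem_closure_outside one_pos hw
  have h1 : ψ w ∉ exteriorDomain L := by
    rw [← hψ.image_eq]
    exact notMem_image_of_tendsto (isOpen_outside 1) hψ.differentiableOn_one hψ.injOn_one
      (fun h : 1 < ‖w‖ => h.ne' hw) hcl hlim
  have h2 : ψ w ∈ closure (exteriorDomain L) := by
    have := mem_closure_iff_nhdsWithin_neBot.1 hcl
    refine mem_closure_of_tendsto hlim ?_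
    filter_upwards [self_mem_nhdsWithin] with x hx
    rw [← hψ.image_eq]
    exact mem_image_of_mem ψ hx
  exact (closure_exteriorDomain_subset hL.isClosed h2).resolve_left h1

open Complex in
-- For ρ = 1 both one-sided directions at the corner are tangent to the analytic curve L, so their
-- squares coincide and μ is an integer in [0, 2].
theorem lt_one_of_angle (hL : IsAnalyticJordanCurve L) (hψ : IsExteriorMap L ψ ρ)
    (hA1 : ConditionA1 ψ ρ Θ) {τ μ : ℝ} (hangle : IsExteriorAngle ψ ρ τ (μ * Real.pi))
    (h0 : μ ≠ 0) (h1 : μ ≠ 1) (h2 : μ ≠ 2) : ρ < 1 := by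
  refine lt_of_le_of_ne hψ.le_one fun hρ => ?_
  have hpos := hψ.pos hangle
  have hmem : ∀ θ, ψ (circlePt ρ θ) ∈ L := fun θ =>
    image_mem_of_norm_eq_one hL hψ hA1 (by rw [norm_circlePt hpos.le, hρ])
  obtain ⟨D, hD⟩ := hL.exists_tendsto_direction_sq (hmem τ)
  obtain ⟨⟨hl0, hl2⟩, β, hβ₁, hβ₂⟩ := hangle
  have hc := (hA1.continuous_circlePt hpos).tendsto τ
  have key : ∀ {l : Filter ℝ} [l.NeBot] {x : ℝ}, l ≤ 𝓝 τ →
      Tendsto (fun θ => (ψ (circlePt ρ θ) - ψ (circlePt ρ τ)) /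
        (‖ψ (circlePt ρ θ) - ψ (circlePt ρ τ)‖ : ℂ)) l (𝓝 (exp (x * I))) →
      exp (x * I) ^ 2 = D := by
    intro l _ x hl hx
    refine tendsto_nhds_unique (hx.pow 2) (hD hmem (hc.mono_left hl) ?_)
    filter_upwards [hx.eventually_ne (Complex.exp_ne_zero _)] with θ hθ heq
    rw [heq, sub_self, zero_div] at hθ
    exact hθ rfl
  have h3 := (key nhdsWithin_le_nhds hβ₁).trans (key nhdsWithin_le_nhds hβ₂).symm
  rw [← Complex.exp_nat_mul, ← Complex.exp_nat_mul, Complex.exp_eq_exp_iff_exists_int] at h3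
  obtain ⟨n, hn⟩ := h3
  have h4 : (μ : ℂ) = -n := by
    apply mul_left_cancel₀ (mul_ne_zero (two_pi_I_ne_zero) one_ne_zero)
    push_cast at hn
    linear_combination -hn
  have h5 : μ = ((-n : ℤ) : ℝ) := by push_cast; exact_mod_cast h4
  have hπ := Real.pi_pos
  have h6 : 0 ≤ μ := nonneg_of_mul_nonneg_left hl0 hπ
  have h7 : μ ≤ 2 := le_of_mul_le_mul_right hl2 hπ
  rw [h5] at h6 h7 h0 h1 h2
  set m := -n
  have h8 : 0 ≤ m := by exact_mod_cast h6
  have h9 : m ≤ 2 := by exact_mod_cast h7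
  interval_cases m <;> simp_all

/-- Read through the parametrization of L, ψ is an injective continuous self-map of the circle,
hence onto. This replaces any appeal to the Jordan curve theorem. -/
theorem image_sphere_one_eq (hL : IsAnalyticJordanCurve L) (hψ : IsExteriorMap L ψ ρ)
    (hA1 : ConditionA1 ψ ρ Θ) (hρ : ρ < 1) : L ⊆ ψ '' Metric.sphere 0 1 := by
  have hmem : ∀ w ∈ Metric.sphere (0 : ℂ) 1, ψ w ∈ L := fun w hw =>
    image_mem_of_norm_eq_one hL hψ hA1 (mem_sphere_zero_iff_norm.1 hw)
  have hsub : Metric.sphere (0 : ℂ) 1 ⊆ outside ρ := fun w hw =>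
    show ρ < ‖w‖ by rwa [mem_sphere_zero_iff_norm.1 hw]
  obtain ⟨γ, hγ, hinj, -, hγL⟩ := hL
  have hpre : ∀ w ∈ Metric.sphere (0 : ℂ) 1, ∃ t ∈ Metric.sphere (0 : ℂ) 1, γ t = ψ w := by
    intro w hw
    have := hmem w hw
    rwa [← hγL] at this
  choose! h hm hh using hpre
  have hc : ContinuousOn h (Metric.sphere 0 1) := by
    rw [continuousOn_iff_continuous_domRestrict, continuous_iff_continuousAt]
    rintro ⟨w, hw⟩
    refine tendsto_of_tendsto_comp_of_injOn (isCompact_sphere 0 1) hγ.continuousOn hinj (hm w hw)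
      (fun x => hm x x.2) ?_
    simp only [domRestrict_apply, hh w hw]
    have h1 : Continuous fun x : Metric.sphere (0 : ℂ) 1 => ψ x :=
      (hψ.differentiableOn.continuousOn.mono hsub).comp_continuous continuous_subtype_val
        fun x => x.2
    exact (h1.tendsto ⟨w, hw⟩).congr fun x => (hh x x.2).symm
  have hinj' : InjOn h (Metric.sphere 0 1) := fun x hx y hy hxy =>
    hψ.injOn (hsub hx) (hsub hy) (by rw [← hh x hx, ← hh y hy, hxy])
  have hs := surjOn_sphere_of_injOn hc (fun w hw => hm w hw) hinj'
  rw [← hγL]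
  rintro _ ⟨ξ, hξ, rfl⟩
  obtain ⟨w, hw, rfl⟩ := hs hξ
  exact ⟨w, hw, (hh w hw).symm⟩

theorem notMem_image_subset_interiorDomain (hL : IsAnalyticJordanCurve L)
    (hψ : IsExteriorMap L ψ ρ) (hA1 : ConditionA1 ψ ρ Θ) (hρ : ρ < 1) {z : ℂ}
    (hz : z ∉ ψ '' outside ρ) : z ∈ interiorDomain L := by
  rw [mem_interiorDomain_iff]
  refine ⟨fun h => hz ?_, fun h => hz ?_⟩
  · obtain ⟨w, hw, rfl⟩ := image_sphere_one_eq hL hψ hA1 hρ h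
    exact mem_image_of_mem ψ (show ρ < ‖w‖ by rwa [mem_sphere_zero_iff_norm.1 hw])
  · rw [← hψ.image_eq] at h
    exact image_mono (fun w (hw : 1 < ‖w‖) => hρ.trans hw) h

theorem innerSet_subset_interiorDomain (hL : IsAnalyticJordanCurve L)
    (hψ : IsExteriorMap L ψ ρ) (hA1 : ConditionA1 ψ ρ Θ) (hρ : ρ < 1) :
    innerSet ψ ρ ⊆ interiorDomain L := fun _ hz =>
  notMem_image_subset_interiorDomain hL hψ hA1 hρ fun h => hz (subset_closure h)

theorem ConditionA1.circlePt_mem_closure (hA1 : ConditionA1 ψ ρ Θ) (hρ : 0 < ρ) (θ : ℝ) :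
    ψ (circlePt ρ θ) ∈ closure (ψ '' outside ρ) := by
  have h := norm_circlePt hρ.le θ
  have := neBot_nhdsWithin_outside hρ h
  exact mem_closure_of_tendsto (hA1.tendsto h.ge)
    (eventually_mem_nhdsWithin.mono fun w hw => mem_image_of_mem ψ hw)

end

/-! ### G_ρ is not empty. -/

section

variable {L : Set ℂ} {ψ : ℂ → ℂ} {ρ : ℝ} {s : ℕ} {Θ lam : Fin s → ℝ}

theorem IsExteriorMap.tendsto_cobounded (hψ : IsExteriorMap L ψ ρ) :
    Tendsto ψ (Bornology.cobounded ℂ) (Bornology.cobounded ℂ) := by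
  obtain ⟨c, hc, hlim⟩ := hψ.deriv_infty
  rw [← tendsto_norm_atTop_iff_cobounded]
  have h1 : Tendsto (fun w : ℂ => ‖ψ w / w‖ * ‖w‖) (Bornology.cobounded ℂ) atTop :=
    hlim.norm.pos_mul_atTop (by simpa using hc.ne') tendsto_norm_cobounded_atTop
  refine h1.congr' ?_
  filter_upwards [tendsto_norm_cobounded_atTop.eventually_gt_atTop 0] with w hw
  rw [norm_div, div_mul_cancel₀ _ hw.ne']

theorem exists_bound_preimage (hψ : IsExteriorMap L ψ ρ) (R : ℝ) :
    ∃ K, ∀ w, ‖ψ w‖ ≤ R → ‖w‖ ≤ K := by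
  have h := (tendsto_norm_atTop_iff_cobounded.2 hψ.tendsto_cobounded).eventually_gt_atTop R
  rw [← comap_norm_atTop, eventually_comap] at h
  obtain ⟨K, hK⟩ := eventually_atTop.1 h
  refine ⟨K, fun w hw => ?_⟩
  by_contra hlt
  exact absurd hw (not_le.2 (hK _ (not_le.1 hlt).le w rfl))

theorem isCompact_annulus (ρ K : ℝ) : IsCompact {w : ℂ | ρ ≤ ‖w‖ ∧ ‖w‖ ≤ K} := by
  have : {w : ℂ | ρ ≤ ‖w‖ ∧ ‖w‖ ≤ K} = Metric.closedBall 0 K ∩ {w | ρ ≤ ‖w‖} := by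
    ext w
    simp [and_comm]
  rw [this]
  exact (isCompact_closedBall 0 K).inter_right (isClosed_le continuous_const continuous_norm)

/-- ψ tends to infinity at infinity, so preimages of bounded sets lie in a compact annulus. -/
theorem closure_image_subset (hψ : IsExteriorMap L ψ ρ) (hA1 : ConditionA1 ψ ρ Θ) :
    closure (ψ '' outside ρ) ⊆ ψ '' {w | ρ ≤ ‖w‖} := by
  intro z hz
  obtain ⟨K, hK⟩ := exists_bound_preimage hψ (‖z‖ + 1)
  have hcl : IsClosed (ψ '' {w : ℂ | ρ ≤ ‖w‖ ∧ ‖w‖ ≤ K}) :=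
    ((isCompact_annulus ρ K).image_of_continuousOn (hA1.continuousOn.mono fun w hw => hw.1)).isClosed
  have h1 : z ∈ closure (ψ '' {w : ℂ | ρ ≤ ‖w‖ ∧ ‖w‖ ≤ K}) := by
    rw [mem_closure_iff_nhds] at hz ⊢
    intro t ht
    obtain ⟨_, ⟨hy1, hy2⟩, w, hw, rfl⟩ := hz _ (inter_mem ht (Metric.ball_mem_nhds z one_pos))
    refine ⟨_, hy1, w, ⟨le_of_lt (show ρ < ‖w‖ from hw), hK w ?_⟩, rfl⟩
    rw [Metric.mem_ball, dist_eq_norm] at hy2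
    linarith [norm_sub_norm_le (ψ w) z]
  rw [hcl.closure_eq] at h1
  exact image_mono (fun w hw => hw.1) h1

theorem eq_of_image_eq (hψ : IsExteriorMap L ψ ρ) (hA1 : ConditionA1 ψ ρ Θ) (hρ : 0 < ρ)
    {w w' : ℂ} (hw : ρ ≤ ‖w‖) (hw' : ρ ≤ ‖w'‖) (h : ψ w = ψ w')
    (hne : ψ w ∉ range fun k => ψ (circlePt ρ (Θ k))) : w = w' := by
  rcases hw.eq_or_lt with h1 | h1 <;> rcases hw'.eq_or_lt with h2 | h2
  · by_contra hww
    obtain ⟨⟨k, hk⟩, -⟩ := hA1.eq_imp w w' h1.symm h2.symm hww h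
    exact hne ⟨k, congrArg ψ hk⟩
  · exact absurd ⟨w', h2, h.symm⟩ (hA1.notMem_image hψ.differentiableOn hψ.injOn hρ h1.symm)
  · exact absurd ⟨w, h1, h⟩ (hA1.notMem_image hψ.differentiableOn hψ.injOn hρ h2.symm)
  · exact hψ.injOn h1 h2 h

/-- Values of χ near z stay in a compact annulus, and off the corner values the preimage of z is
unique, so χ has a single cluster point there. -/
theorem continuousOn_rightInverse (hψ : IsExteriorMap L ψ ρ) (hA1 : ConditionA1 ψ ρ Θ) (hρ : 0 < ρ)
    {χ : ℂ → ℂ} (hχ : ∀ z, ρ ≤ ‖χ z‖) (hψχ : ∀ z, ψ (χ z) = z) {z : ℂ}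
    (hz : z ∉ range fun k => ψ (circlePt ρ (Θ k))) : ContinuousAt χ z := by
  obtain ⟨K, hK⟩ := exists_bound_preimage hψ (‖z‖ + 1)
  refine (isCompact_annulus ρ K).tendsto_nhds_of_unique_mapClusterPt ?_ ?_
  · filter_upwards [Metric.ball_mem_nhds z one_pos] with y hy
    refine ⟨hχ y, hK _ ?_⟩
    rw [Metric.mem_ball, dist_eq_norm] at hy
    rw [hψχ]
    linarith [norm_sub_norm_le y z]
  · intro w hw hcl
    have h1 : MapClusterPt (ψ w) (𝓝 z) (ψ ∘ χ) := by
      have h2 : Tendsto ψ (𝓝 w ⊓ map χ (𝓝 z)) (𝓝 (ψ w)) := by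
        refine (hA1.continuousOn w hw.1).mono_left (inf_le_inf_left _ ?_)
        rw [le_principal_iff, mem_map]
        exact univ_mem' hχ
      have h3 : (𝓝 w ⊓ map χ (𝓝 z)).NeBot := hcl
      have h4 : map ψ (𝓝 w ⊓ map χ (𝓝 z)) ≤ 𝓝 (ψ w) ⊓ map (ψ ∘ χ) (𝓝 z) :=
        le_inf h2 ((map_mono inf_le_right).trans_eq map_map)
      exact (h3.map ψ).mono h4
    have h5 : ψ w = z := by
      refine eq_of_mapClusterPt_of_tendsto h1 (tendsto_id.congr fun y => (hψχ y).symm)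
    refine eq_of_image_eq hψ hA1 hρ hw.1 (hχ z) (by rw [h5, hψχ]) (by rwa [h5])

theorem differentiableAt_rightInverse (hψ : IsExteriorMap L ψ ρ)
    {χ : ℂ → ℂ} (hψχ : ∀ z, ψ (χ z) = z) {z : ℂ} (hz : ρ < ‖χ z‖) (hc : ContinuousAt χ z) :
    DifferentiableAt ℂ χ z := by
  have hd := (hψ.differentiableOn (χ z) hz).differentiableAt ((isOpen_outside ρ).mem_nhds hz)
  exact (HasDerivAt.of_local_left_inverse hc hd.hasDerivAt
    (deriv_ne_zero_of_injOn (isOpen_outside ρ) hψ.differentiableOn hψ.injOn hz)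
    (Eventually.of_forall hψχ)).differentiableAt

/-- Otherwise ψ maps |w| ≥ ρ onto ℂ and has a right inverse χ. Near an interior point of a boundary
arc, χ is continuous and holomorphic off the arc, hence holomorphic after straightening the arc to
the real line. Then 1/|χ| ≤ 1/ρ with equality on the arc, so χ is locally constant, contradicting ψ
∘ χ = id. -/
theorem innerSet_nonempty [NeZero s] (hψ : IsExteriorMap L ψ ρ) (hA1 : ConditionA1 ψ ρ Θ)
    (hρ : 0 < ρ) : (innerSet ψ ρ).Nonempty := by
  by_contra hemp
  have huniv : closure (ψ '' outside ρ) = univ :=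
    compl_empty_iff.1 (not_nonempty_iff_eq_empty.1 hemp)
  have hsurj : ∀ z, ∃ w, ρ ≤ ‖w‖ ∧ ψ w = z := fun z =>
    closure_image_subset hψ hA1 (huniv ▸ mem_univ z)
  choose χ hχ hψχ using hsurj
  obtain ⟨b, hab, hb2, hb, hno⟩ := exists_next_corner hρ.ne'
    (finite_range fun k => circlePt ρ (Θ k)) (mem_range_self (0 : Fin s))
  set a := Θ 0
  have ha : circlePt ρ a ∈ range fun k => circlePt ρ (Θ k) := mem_range_self (0 : Fin s)
  obtain ⟨f, hf, hd, hfi, himg, hf0, hf1⟩ := hA1.arcs a b hab ha hb hno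
  set θ₁ := (a + b) / 2
  have hθ₁ : θ₁ ∈ Ioo a b := ⟨by simp only [θ₁]; linarith, by simp only [θ₁]; linarith⟩
  have hw₁ : ‖circlePt ρ θ₁‖ = ρ := norm_circlePt hρ.le θ₁
  obtain ⟨t₁, ht₁, hft₁⟩ : ψ (circlePt ρ θ₁) ∈ f '' Icc 0 1 :=
    himg ▸ mem_image_of_mem _ (Ioo_subset_Icc_self hθ₁)
  have hne0 : f 0 ≠ f t₁ := by
    rw [hf0, hft₁]; exact (hA1.ne_corner hρ (hno θ₁ hθ₁) ha).symm
  have hne1 : f 1 ≠ f t₁ := by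
    rw [hf1, hft₁]; exact (hA1.ne_corner hρ (hno θ₁ hθ₁) hb).symm
  have ht₁' : t₁ ∈ Ioo (0 : ℝ) 1 := ⟨lt_of_le_of_ne ht₁.1 fun h => hne0 (by rw [h]),
    lt_of_le_of_ne ht₁.2 fun h => hne1 (by rw [h])⟩
  have huniq : ∀ t ∈ Icc (0 : ℝ) 1, f t = f t₁ → t = t₁ := by
    intro t ht h
    refine hfi ⟨lt_of_le_of_ne ht.1 fun h' => hne0 (by rw [h', h]),
      lt_of_le_of_ne ht.2 fun h' => hne1 (by rw [← h', h])⟩ ht₁' h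
  obtain ⟨E, hE, hE0, hEd, hEf, -⟩ := exists_straightening (hf t₁ ht₁) (hd t₁ ht₁) one_ne_zero
  set z₁ := f t₁ with hz₁
  have hz₁c : z₁ ∉ range fun k => ψ (circlePt ρ (Θ k)) := by
    rintro ⟨k, hk⟩
    exact hA1.ne_corner hρ (hno θ₁ hθ₁) (mem_range_self k) (hft₁.symm.trans hk.symm)
  have hVo : IsOpen (range fun k => ψ (circlePt ρ (Θ k)))ᶜ := (finite_range _).isClosed.isOpen_compl
  have hχc : ∀ z ∈ (range fun k => ψ (circlePt ρ (Θ k)))ᶜ, ContinuousAt χ z := fun z hz =>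
    continuousOn_rightInverse hψ hA1 hρ hχ hψχ hz
  have hχz₁ : χ z₁ = circlePt ρ θ₁ :=
    eq_of_image_eq hψ hA1 hρ (hχ z₁) hw₁.ge (by rw [hψχ, hft₁]) (by rwa [hψχ])
  -- near `z₁`, the boundary values lie on the straightened arc
  have hreal : ∀ᶠ z in 𝓝 z₁, ‖χ z‖ = ρ → (E z).im = 0 := by
    -- t₁ is the only parameter of z₁, so by compactness arc points near z₁ have parameters near t₁,
    -- where E ∘ f is real.
    have harc : ∀ᶠ z in 𝓝 z₁, ∀ t ∈ Icc (0 : ℝ) 1, f t = z → E (f t) = ((t - t₁ : ℝ) : ℂ) := by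
      obtain ⟨δ, hδ, hball⟩ := Metric.eventually_nhds_iff_ball.1 hEf
      have hcl : IsClosed (f '' (Icc 0 1 \ Metric.ball t₁ δ)) :=
        ((isCompact_Icc.diff Metric.isOpen_ball).image_of_continuousOn
          (hf.continuousOn.mono sdiff_subset)).isClosed
      have hz : z₁ ∉ f '' (Icc 0 1 \ Metric.ball t₁ δ) := by
        rintro ⟨t, ⟨ht, htb⟩, h⟩
        rw [huniq t ht h] at htb
        exact htb (Metric.mem_ball_self hδ)
      filter_upwards [hcl.isOpen_compl.mem_nhds hz] with z hz t ht htz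
      have htb : t ∈ Metric.ball t₁ δ := by
        by_contra h
        exact hz ⟨t, ⟨ht, h⟩, htz⟩
      have h1 := hball (t - t₁) (by
        rw [Metric.mem_ball, dist_zero_right, ← dist_eq_norm]; exact htb)
      rwa [one_mul, add_sub_cancel] at h1
    -- The complementary closed arc of the circle stays away from χ(z₁), so by continuity nearby
    -- preimages on the circle lie on the chosen arc.
    have hnear : ∀ᶠ z in 𝓝 z₁, ‖χ z‖ = ρ → χ z ∈ circlePt ρ '' Icc a b := by
      have hcl : IsClosed (circlePt ρ '' Icc b (a + 2 * Real.pi)) :=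
        (isCompact_Icc.image (continuous_circlePt ρ)).isClosed
      have hz : χ z₁ ∉ circlePt ρ '' Icc b (a + 2 * Real.pi) := by
        rw [hχz₁]
        rintro ⟨x, hx, h⟩
        obtain ⟨n, hn⟩ := (circlePt_eq_iff hρ.ne').1 h
        have hπ := Real.pi_pos
        have h1 : (0 : ℝ) < n := by nlinarith [hx.1, hθ₁.2]
        have h2 : (n : ℝ) < 1 := by nlinarith [hx.2, hθ₁.1]
        have h3 : 0 < n := by exact_mod_cast h1
        have h4 : n < 1 := by exact_mod_cast h2
        omega
      filter_upwards [(hχc z₁ hz₁c).eventually (hcl.isOpen_compl.mem_nhds hz)] with z hz hzρ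
      obtain ⟨x, hx⟩ := exists_circlePt_eq hzρ
      obtain ⟨y, hy, hyx⟩ : ∃ y ∈ Ico a (a + 2 * Real.pi), circlePt ρ y = circlePt ρ x := by
        have hper : Function.Periodic (circlePt ρ) (2 * Real.pi) := circlePt_add_two_pi ρ
        obtain ⟨y, hy, h⟩ := hper.exists_mem_Ico Real.two_pi_pos x a
        exact ⟨y, hy, h.symm⟩
      rw [← hx, ← hyx]
      refine mem_image_of_mem _ ⟨hy.1, ?_⟩
      by_contra hlt
      exact hz ⟨y, ⟨(not_le.1 hlt).le, hy.2.le⟩, hyx.trans hx⟩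
    filter_upwards [harc, hnear] with z h1 h2 h3
    obtain ⟨x, hx, hxz⟩ := h2 h3
    have h4 : z ∈ f '' Icc 0 1 := by
      rw [himg]
      exact ⟨x, hx, by simp only; rw [hxz, hψχ]⟩
    obtain ⟨t, ht, rfl⟩ := h4
    rw [h1 t ht rfl, Complex.ofReal_im]
  -- transport to the straightened coordinate
  set F := hE.hasStrictDerivAt.localInverse _ _ _ hEd with hF
  have hFa : AnalyticAt ℂ F 0 := hE0 ▸ hE.analyticAt_localInverse hEd
  have hleft : ∀ᶠ x in 𝓝 z₁, F (E x) = x :=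
    HasStrictDerivAt.eventually_left_inverse hE.hasStrictDerivAt hEd
  have hright : ∀ᶠ x in 𝓝 (0 : ℂ), E (F x) = x := by
    rw [← hE0]
    exact HasStrictDerivAt.eventually_right_inverse hE.hasStrictDerivAt hEd
  have hF0 : F 0 = z₁ := by rw [← hE0]; exact hleft.self_of_nhds
  have hFt : Tendsto F (𝓝 0) (𝓝 z₁) := hF0 ▸ hFa.continuousAt.tendsto
  obtain ⟨δ, hδ, hball⟩ := Metric.eventually_nhds_iff_ball.1
    ((hFa.eventually_analyticAt.and hright).and
      ((hFt.eventually hreal).and (hFt.eventually (hVo.mem_nhds hz₁c))))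
  have hG : DifferentiableOn ℂ (fun x => χ (F x)) (Metric.ball 0 δ) := by
    refine differentiableOn_of_differentiableAt_off_real Metric.isOpen_ball ?_ ?_
    · intro x hx
      obtain ⟨⟨h1, -⟩, -, h2⟩ := hball x hx
      exact (ContinuousAt.comp (g := χ) (hχc _ h2) h1.continuousAt).continuousWithinAt
    · intro x hx him
      obtain ⟨⟨h1, h3⟩, h4, h2⟩ := hball x hx
      have h5 : ρ < ‖χ (F x)‖ := lt_of_le_of_ne (hχ _) fun h => him (by
        rw [← h3]; exact h4 h.symm)
      exact (differentiableAt_rightInverse hψ hψχ h5 (hχc _ h2)).comp x h1.differentiableAt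
  have hconst := Complex.eventually_eq_of_isLocalMax_norm (f := fun x => (χ (F x))⁻¹) (c := 0) (by
    filter_upwards [Metric.ball_mem_nhds (0 : ℂ) hδ] with x hx
    refine (hG.differentiableAt (Metric.isOpen_ball.mem_nhds hx)).inv ?_
    exact norm_pos_iff.1 (hρ.trans_le (hχ _))) (by
    refine Eventually.of_forall fun x => ?_
    simp only [Function.comp, norm_inv]
    rw [hF0, hχz₁, hw₁]
    exact inv_anti₀ hρ (hχ _))
  refine not_eventually_eq_of_injOn (f := id) isOpen_univ (injOn_id univ) (mem_univ (0 : ℂ)) ?_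
  filter_upwards [hconst, hright] with x hx h3
  have h4 : F x = F 0 := by rw [← hψχ (F x), inv_injective hx, hψχ]
  rw [id, id, ← h3, h4, hF0, hE0]

end

/-! ### The kernel sum and its coefficients. -/

theorem tendstoLocallyUniformlyOn_sum_mul {ι : Type*} [Fintype ι] {G : Set ℂ} {g : ι → ℂ → ℂ}
    (hg : ∀ k, ContinuousOn (g k) G) {a : ℕ → ι → ℂ} {b : ι → ℂ}
    (h : ∀ k, Tendsto (fun i => a i k) atTop (𝓝 (b k))) :
    TendstoLocallyUniformlyOn (fun i z => ∑ k, g k z * a i k) (fun z => ∑ k, g k z * b k)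
      atTop G := by
  rw [Metric.tendstoLocallyUniformlyOn_iff]
  intro ε hε z hz
  have hbd : ∀ᶠ y in 𝓝[G] z, ∀ k, ‖g k y‖ < ‖g k z‖ + 1 := eventually_all.2 fun k =>
    ((hg k) z hz).norm.eventually (gt_mem_nhds (lt_add_one _))
  refine ⟨_, hbd, ?_⟩
  have hlim : Tendsto (fun i => ∑ k, (‖g k z‖ + 1) * ‖b k - a i k‖) atTop (𝓝 0) := by
    have : Tendsto (fun i => ∑ k, (‖g k z‖ + 1) * ‖b k - a i k‖) atTop
        (𝓝 (∑ k, (‖g k z‖ + 1) * ‖b k - b k‖)) :=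
      tendsto_finsetSum _ fun k _ => ((h k).const_sub (b k)).norm.const_mul _
    simpa using this
  filter_upwards [hlim.eventually (gt_mem_nhds hε)] with i hi y hy
  refine lt_of_le_of_lt ?_ hi
  rw [dist_eq_norm, ← Finset.sum_sub_distrib]
  refine (norm_sum_le _ _).trans (Finset.sum_le_sum fun k _ => ?_)
  rw [← mul_sub, norm_mul]
  exact mul_le_mul_of_nonneg_right (hy k).le (norm_nonneg _)

section

variable {ψ φ : ℂ → ℂ} {ρ : ℝ} {s u : ℕ} [NeZero s] {hus : u ≤ s} {Θ lam : Fin s → ℝ}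

/-- The coefficient of `e^{2πi x_k}` in the kernel sum. -/
def kernelTerm (ψ φ : ℂ → ℂ) (ρ : ℝ) {s u : ℕ} [NeZero s] (hus : u ≤ s) (Θ lam : Fin s → ℝ)
    (k : Fin u) (z : ℂ) : ℂ :=
  deriv φ z * (deriv φ (ψ (circlePt ρ (Θ (Fin.castLE hus k)))) *
    hatCoeff ψ ρ Θ lam (Fin.castLE hus k)) /
      (φ z - φ (ψ (circlePt ρ (Θ (Fin.castLE hus k))))) ^ 2

theorem kernelSum_eq (x : Fin u → ℝ) (z : ℂ) :
    kernelSum ψ φ ρ hus Θ lam x z =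
      ∑ k, kernelTerm ψ φ ρ hus Θ lam k z * Complex.exp (2 * Real.pi * Complex.I * x k) := by
  rw [kernelSum, Finset.mul_sum]
  refine Finset.sum_congr rfl fun k _ => ?_
  rw [kernelTerm]
  ring

variable {L : Set ℂ}

/-- z_k lies in G_1, where φ is injective, and in the closure of Ω_ρ, hence outside G_ρ, so the
denominator has no zero. The numerator is nonzero because φ' and A_k are. -/
theorem kernelTerm_facts (hL : IsAnalyticJordanCurve L) (hψ : IsExteriorMap L ψ ρ)
    (hφ : IsConformalOntoDisk (interiorDomain L) φ) (hA1 : ConditionA1 ψ ρ Θ)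
    (hA2 : ConditionA2 ψ ρ Θ lam) (k : Fin u) :
    ContinuousOn (kernelTerm ψ φ ρ hus Θ lam k) (innerSet ψ ρ) ∧
      ∀ z ∈ innerSet ψ ρ, kernelTerm ψ φ ρ hus Θ lam k z ≠ 0 := by
  set j := Fin.castLE hus k with hj
  have hρ := hψ.pos (hA2.angle j)
  obtain ⟨h0, h1, h2⟩ := hA2.ne j
  have hρ1 := lt_one_of_angle hL hψ hA1 (hA2.angle j) h0 h1 h2
  have hsub := innerSet_subset_interiorDomain hL hψ hA1 hρ1
  have hopen := isOpen_interiorDomain hL.isClosed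
  have hzk : ψ (circlePt ρ (Θ j)) ∈ interiorDomain L :=
    notMem_image_subset_interiorDomain hL hψ hA1 hρ1
      (hA1.notMem_image hψ.differentiableOn hψ.injOn hρ (norm_circlePt hρ.le _))
  have hne : ∀ z ∈ innerSet ψ ρ, (φ z - φ (ψ (circlePt ρ (Θ j)))) ^ 2 ≠ 0 := by
    intro z hz
    refine pow_ne_zero 2 (sub_ne_zero.2 fun h => hz ?_)
    rw [hφ.injOn (hsub hz) hzk h]
    exact hA1.circlePt_mem_closure hρ _
  refine ⟨?_, fun z hz => ?_⟩
  · have hc := hφ.differentiableOn.continuousOn.mono hsub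
    have hd := (hφ.differentiableOn.deriv hopen).continuousOn.mono hsub
    exact (hd.mul continuousOn_const).div ((hc.sub continuousOn_const).pow 2) hne
  · refine div_ne_zero (mul_ne_zero ?_ (mul_ne_zero ?_ (mul_ne_zero ?_ ?_))) (hne z hz)
    · exact deriv_ne_zero_of_injOn hopen hφ.differentiableOn hφ.injOn (hsub hz)
    · exact deriv_ne_zero_of_injOn hopen hφ.differentiableOn hφ.injOn hzk
    · exact hA1.cornerCoeff_ne_zero hψ.differentiableOn hψ.injOn hρ (mem_range_self j)
        (hA2.angle j) h0 h2
    · exact Complex.exp_ne_zero _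

theorem IsRelativeArg.first_eq_one {θ : Fin u → ℝ} (hθ : IsRelativeArg hus Θ θ) {k : Fin u}
    (hk : Fin.castLE hus k = 0) : θ k = 1 := by
  have h := hθ.exp_eq k
  rw [hk, sub_self, Complex.ofReal_zero, mul_zero, Complex.exp_zero,
    Complex.exp_eq_one_iff] at h
  obtain ⟨n, hn⟩ := h
  have h1 : (θ k : ℂ) = n := mul_left_cancel₀ Complex.two_pi_I_ne_zero (by rw [hn]; ring)
  have h2 : θ k = n := by exact_mod_cast h1
  have h3 := hθ.mem k
  rw [h2] at h3 ⊢
  have h4 : 0 < n := by exact_mod_cast h3.1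
  have h5 : n ≤ 1 := by exact_mod_cast h3.2
  have : n = 1 := by omega
  rw [this, Int.cast_one]

open Complex in
theorem IsRelativeArg.injective_exp {θ : Fin u → ℝ} (hθ : IsRelativeArg hus Θ θ)
    (hA1 : ConditionA1 ψ ρ Θ) :
    Function.Injective fun k => exp (2 * Real.pi * I * θ k) := by
  intro k k' h
  simp only [hθ.exp_eq] at h
  refine Fin.castLE_injective hus (hA1.distinct ?_)
  simp only [circlePt]
  have h2 : ∀ j : Fin s, exp (Θ j * I) = exp (I * (Θ j - Θ 0 : ℝ)) * exp (I * Θ 0) := by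
    intro j
    rw [← Complex.exp_add]
    congr 1
    push_cast
    ring
  rw [h2, h2, h]

end

end Carleman

/-! ### The main theorem. -/

open Carleman in
theorem mainTheorem5
    (L : Set ℂ) (hL : Carleman.IsAnalyticJordanCurve L)
    (ψ : ℂ → ℂ) (ρ : ℝ) (hψ : Carleman.IsExteriorMap L ψ ρ)
    (φ : ℂ → ℂ) (hφ : Carleman.IsConformalOntoDisk (Carleman.interiorDomain L) φ)
    (s : ℕ) [NeZero s] (Θ lam : Fin s → ℝ)
    (hA1 : Carleman.ConditionA1 ψ ρ Θ) (hA2 : Carleman.ConditionA2 ψ ρ Θ lam)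
    (u : ℕ) (hus : u ≤ s) (hu : Carleman.IsIndexed lam u)
    (θ : Fin u → ℝ) (hθ : Carleman.IsRelativeArg hus Θ θ)
    (v : ℕ) (hvu : v + 1 ≤ u) (r : Fin u → Fin (v + 1) → ℚ)
    (hr : Carleman.IsRationalBasis hvu θ r)
    (p q : Fin u → ℕ) (hpq : Carleman.IsReducedFraction r p q) :
    (∀ f : ℂ → ℂ,
      Carleman.IsSubseqLimitOn (Carleman.H ψ φ ρ hus Θ lam θ) (Carleman.innerSet ψ ρ) f ↔
        ∃ l ∈ Finset.Icc 1 (Finset.univ.lcm q), ∃ α : Fin v → ℝ,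
          Set.EqOn f (Carleman.limitFunction ψ φ ρ hus Θ lam r p q l α)
            (Carleman.innerSet ψ ρ)) ∧
    ∃ f : ℂ → ℂ,
      Carleman.IsSubseqLimitOn (Carleman.H ψ φ ρ hus Θ lam θ) (Carleman.innerSet ψ ρ) f ∧
        ∃ z ∈ Carleman.innerSet ψ ρ, f z ≠ 0 := by
  have h1 : θ (Fin.castLE hvu 0) = 1 := hθ.first_eq_one (Fin.ext (by simp))
  have hterm : ∀ k : Fin u, _ := fun k => kernelTerm_facts (hus := hus) hL hψ hφ hA1 hA2 k
  have hlim : ∀ (n : ℕ → ℕ) (l : ℕ) (α : Fin v → ℝ), (∀ k, Tendsto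
      (fun i => Complex.exp (2 * Real.pi * Complex.I * (n i * θ k : ℝ))) atTop
      (𝓝 (Complex.exp (2 * Real.pi * Complex.I * candidatePhase r p q l α k)))) →
      TendstoLocallyUniformlyOn (fun i => H ψ φ ρ hus Θ lam θ (n i))
        (limitFunction ψ φ ρ hus Θ lam r p q l α) atTop (innerSet ψ ρ) := by
    intro n l α h
    have h2 := tendstoLocallyUniformlyOn_sum_mul (fun k => (hterm k).1) h
    simp only [← kernelSum_eq] at h2
    exact h2
  have hiff : ∀ f : ℂ → ℂ,
      IsSubseqLimitOn (H ψ φ ρ hus Θ lam θ) (innerSet ψ ρ) f ↔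
        ∃ l ∈ Finset.Icc 1 (Finset.univ.lcm q), ∃ α : Fin v → ℝ,
          EqOn f (limitFunction ψ φ ρ hus Θ lam r p q l α) (innerSet ψ ρ) := by
    intro f
    constructor
    · rintro ⟨n, hn, hf⟩
      obtain ⟨l, hl, α, m, hm, hlm⟩ := exists_subseq_tendsto_exp hr hpq h1 n
      refine ⟨l, hl, α, fun z hz => ?_⟩
      exact tendsto_nhds_unique ((hf.tendsto_at hz).comp hm.tendsto_atTop)
        ((hlim (n ∘ m) l α hlm).tendsto_at hz)
    · rintro ⟨l, -, α, hf⟩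
      obtain ⟨n, hn, h⟩ := exists_strictMono_tendsto_exp hr hpq h1 l α
      exact ⟨n, hn, (hlim n l α h).congr_right hf.symm⟩
  refine ⟨hiff, ?_⟩
  obtain ⟨z, hz⟩ := innerSet_nonempty hψ hA1 (hψ.pos (hA2.angle 0))
  obtain ⟨n, hn⟩ : ∃ n, H ψ φ ρ hus Θ lam θ n z ≠ 0 := by
    by_contra! hall
    -- At fixed z the numbers H_n(z) are power sums in the distinct nodes e^{2πiθ_k} with weights
    -- g_k(z); by Vandermonde, if all vanished, so would every weight.
    have hzero := Matrix.eq_zero_of_forall_pow_sum_mul_pow_eq_zero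
      (v := fun k => kernelTerm ψ φ ρ hus Θ lam k z) (hθ.injective_exp hA1) (fun i => by
        rw [← hall i, H, kernelSum_eq]
        refine Finset.sum_congr rfl fun k _ => ?_
        rw [← Complex.exp_nat_mul]
        congr 2
        push_cast
        ring)
    exact (hterm (Fin.castLE hvu 0)).2 z hz (congrFun hzero _)
  obtain ⟨l, hl, α, hα⟩ := exists_candidatePhase_eq hr hpq h1 n
  refine ⟨_, (hiff _).2 ⟨l, hl, α, fun _ _ => rfl⟩, z, hz, ?_⟩
  have h3 : limitFunction ψ φ ρ hus Θ lam r p q l α z = H ψ φ ρ hus Θ lam θ n z := by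
    rw [H, kernelSum_eq]
    exact (kernelSum_eq (candidatePhase r p q l α) z).trans
      (Finset.sum_congr rfl fun k _ => by rw [hα k])
  rw [h3]
  exact hn

end
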